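/- All graphs are finite and simple. A subdivision of a graph $F$ is any graph obtained from $F$ by repeatedly subdividing edges (possibly zero times). A graph is ISK4-free if none of its induced subgraphs is a subdivision of $K_4$, and series-parallel if none of its subgraphs (induced or not) is a subdivision of $K_4$. A cutset of a graph $G$ is a set $C \subseteq V(G)$ such that $G \setminus C = G[V(G)\setminus C]$ is disconnected, i.e. has two vertices that are not joined by a path of $G \setminus C$; it is a clique cutset if its vertices are pairwise adjacent, and a star cutset if it contains a vertex adjacent to all other vertices of $C$. Theorem. Let $G$ be a triangle-free, ISK4-free graph. Then $G$ is series-parallel, or $G$ is a complete bipartite graph, or $G$ has a clique cutset of size at most two, or $G$ has a star cutset. -/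

import Mathlib

namespace SimpleGraph

/-- `H` is a subdivision of `F`: `H` arises from `F` by replacing the edges of `F` by internally
vertex-disjoint paths (of length at least one) with the same ends. Here `b` places the original
vertices of `F` in `H`, and `P u v h` is the path of `H` that replaces the edge `uv` of `F`,
read from `u` to `v`. -/
def IsSubdivisionOf {V W : Type*} (H : SimpleGraph W) (F : SimpleGraph V) : Prop :=
  ∃ (b : V ↪ W) (P : ∀ u v : V, F.Adj u v → H.Walk (b u) (b v)),
    -- each `P u v h` is a path, and reading the edge backwards reverses it
    (∀ u v h, (P u v h).IsPath) ∧
    (∀ u v h, P v u h.symm = (P u v h).reverse) ∧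
    -- the inner vertices of the paths are not original vertices
    (∀ u v h x, b x ∈ (P u v h).support → x = u ∨ x = v) ∧
    -- paths replacing distinct edges have no common inner vertex
    (∀ u v h u' v' h', s(u, v) ≠ s(u', v') →
      ∀ w, w ∈ (P u v h).support → w ∈ (P u' v' h').support → w ∈ Set.range b) ∧
    -- `H` has no further vertices and no further edges
    (∀ w, w ∈ Set.range b ∨ ∃ u v h, w ∈ (P u v h).support) ∧
    (∀ e ∈ H.edgeSet, ∃ u v h, e ∈ (P u v h).edges)

/-- No subgraph of `G`, induced or not, is a subdivision of `K₄`. -/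
def IsSeriesParallel {V : Type*} (G : SimpleGraph V) : Prop :=
  ∀ H : G.Subgraph, ¬ H.coe.IsSubdivisionOf (completeGraph (Fin 4))

/-- No induced subgraph of `G` is a subdivision of `K₄`. -/
def ISK4Free {V : Type*} (G : SimpleGraph V) : Prop :=
  ∀ S : Set V, ¬ (G.induce S).IsSubdivisionOf (completeGraph (Fin 4))

/-- `G` is isomorphic to `K_{m,n}` for some `m` and `n`. -/
def IsCompleteBipartite {V : Type*} (G : SimpleGraph V) : Prop :=
  ∃ m n : ℕ, Nonempty (G ≃g completeBipartiteGraph (Fin m) (Fin n))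

/-- `C` is a cutset: `G \ C` is disconnected, that is, it has two vertices that are not
joined by a path of `G \ C`. (So the whole vertex set is not a cutset.) -/
def IsCutset {V : Type*} (G : SimpleGraph V) (C : Set V) : Prop :=
  ¬ (G.induce Cᶜ).Preconnected

/-- `C` is a star cutset: a cutset with a vertex `c` adjacent to all other vertices of `C`. -/
def IsStarCutset {V : Type*} (G : SimpleGraph V) (C : Set V) : Prop :=
  G.IsCutset C ∧ ∃ c ∈ C, ∀ v ∈ C, v ≠ c → G.Adj c v

end SimpleGraph

/-! Everything rests on one obstruction, `no_three_edges`: a connected set disjoint from a hole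
cannot send exactly three edges to it if these have distinct ends on the hole. In a triangle-free
graph any three vertices of a connected set are the ends of a tripod (`exists_isTripod`), and a
tripod whose ends send one edge each to the hole induces with it a subdivision of `K₄`; its corners
are the centre and three vertices of the hole. Most contradictions below consist in exhibiting a
hole and a connected set that violate this.

If `G` is not series-parallel, a subdivision of `K₄` yields a cycle and a connected set attached to
at least three of its vertices. A shortest such cycle is a hole, and a smallest attached set is a
tripod. If all its legs are nontrivial, minimality leaves only three edges to the hole, which is
excluded. So the set is an induced path, and comparing the attachments of its ends gives a wheel or
a `K₃,₃` (`wheel_or_biclique`).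

For a wheel, call the rim positions adjacent to the hub spokes; they cut the rim into sectors. A
shortest wheel is proper (`IsWheel.isProper`). Among the proper wheels with the same hub, take one
with the fewest spokes. If deleting the closed neighbourhood of the hub left a connected graph,
there would be a bad path: a shortest path off the wheel between attachments that share no sector.
Either such a path violates `no_three_edges` directly, or replacing an arc of the rim by it gives a
proper wheel with fewer spokes (`IsWheel.no_reroute`). Hence the closed neighbourhood of the hub is
a star cutset.

For a biclique of maximum order, a vertex outside has at most one neighbour in it, and a connected
set outside is attached to a clique only (`IsBiclique.isClique_attach`). So either nothing lies
outside and `G` is complete bipartite, or a component outside is cut off by a clique, of size at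
most two because there are no triangles.

Paths are functions on `ℤ` of which only an interval matters, and rims are periodic functions on
`ℤ`. Arcs of a rim, also those passing the origin, are thus intervals of integers, and reversal is
`i ↦ s - i`. -/

namespace SimpleGraph

variable {V : Type*} {G : SimpleGraph V}

/-! ### Sets inducing connected subgraphs -/

/-- Any two vertices of `T` are joined by a walk inside `T`. -/
def IsConnOn (G : SimpleGraph V) (T : Set V) : Prop :=
  ∀ x ∈ T, ∀ y ∈ T, Relation.ReflTransGen (fun a b => G.Adj a b ∧ b ∈ T) x y

lemma reflTransGen_within_mono {S T : Set V} (h : S ⊆ T) {x y : V}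
    (hxy : Relation.ReflTransGen (fun a b => G.Adj a b ∧ b ∈ S) x y) :
    Relation.ReflTransGen (fun a b => G.Adj a b ∧ b ∈ T) x y :=
  Relation.ReflTransGen.mono (p := fun a b => G.Adj a b ∧ b ∈ T)
    (fun _ _ hab => ⟨hab.1, h hab.2⟩) _ _ hxy

lemma isConnOn_singleton (x : V) : G.IsConnOn {x} := by
  rintro a rfl b rfl
  exact .refl

lemma IsConnOn.union_of_mem {S T : Set V} (hS : G.IsConnOn S) (hT : G.IsConnOn T) {x : V}
    (hxS : x ∈ S) (hxT : x ∈ T) : G.IsConnOn (S ∪ T) := by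
  -- The relation asks membership of the second vertex only, so it is not symmetric and both
  -- directions are needed.
  have key : ∀ a ∈ S ∪ T, Relation.ReflTransGen (fun a b => G.Adj a b ∧ b ∈ S ∪ T) a x ∧
      Relation.ReflTransGen (fun a b => G.Adj a b ∧ b ∈ S ∪ T) x a := by
    rintro a (ha | ha)
    · exact ⟨reflTransGen_within_mono Set.subset_union_left (hS a ha x hxS),
        reflTransGen_within_mono Set.subset_union_left (hS x hxS a ha)⟩
    · exact ⟨reflTransGen_within_mono Set.subset_union_right (hT a ha x hxT),
        reflTransGen_within_mono Set.subset_union_right (hT x hxT a ha)⟩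
  intro a ha b hb
  exact (key a ha).1.trans (key b hb).2

lemma isConnOn_pair {x y : V} (h : G.Adj x y) : G.IsConnOn {x, y} := by
  rintro a (rfl | rfl) b (rfl | rfl)
  · exact .refl
  · exact .single ⟨h, by simp⟩
  · exact .single ⟨h.symm, by simp⟩
  · exact .refl

lemma IsConnOn.union {S T : Set V} (hS : G.IsConnOn S) (hT : G.IsConnOn T) {x y : V}
    (hx : x ∈ S) (hy : y ∈ T) (h : G.Adj x y) : G.IsConnOn (S ∪ T) := by
  have h1 := (hS.union_of_mem (isConnOn_pair h) hx (by simp)).union_of_mem hT (x := y)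
    (by simp) hy
  convert h1 using 1
  ext a
  simp only [Set.mem_union, Set.mem_insert_iff, Set.mem_singleton_iff]
  constructor
  · tauto
  · rintro ((h | rfl | rfl) | h) <;> tauto

lemma IsConnOn.insert {T : Set V} (hT : G.IsConnOn T) {x y : V} (hy : y ∈ T)
    (h : G.Adj x y) : G.IsConnOn (insert x T) :=
  (isConnOn_singleton x).union hT rfl hy h

lemma isConnOn_empty : G.IsConnOn ∅ := fun _ h => h.elim

lemma isConnOn_image {f : ℤ → V} {a b : ℤ}
    (h : ∀ i, a ≤ i → i < b → G.Adj (f i) (f (i + 1))) : G.IsConnOn (f '' Set.Icc a b) := by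
  rcases lt_or_ge b a with hab | hab
  · rw [Set.Icc_eq_empty (by omega), Set.image_empty]
    exact isConnOn_empty
  · have key : ∀ n : ℕ, a + n ≤ b → G.IsConnOn (f '' Set.Icc a (a + n)) := by
      intro n
      induction n with
      | zero =>
        intro _
        simpa using isConnOn_singleton (f a)
      | succ n ih =>
        intro hn
        push_cast at hn ⊢
        have h1 := (ih (by omega)).insert (x := f (a + n + 1)) (y := f (a + n))
          ⟨a + n, ⟨by omega, by omega⟩, rfl⟩ (h _ (by omega) (by omega)).symm
        convert h1 using 1
        rw [← Set.image_insert_eq]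
        congr 1
        ext i
        simp only [Set.mem_Icc, Set.mem_insert_iff]
        omega
    have := key (b - a).toNat (by omega)
    rwa [show a + ((b - a).toNat : ℤ) = b by omega] at this

/-! ### Walks as sequences -/

/-- `f 0, …, f n` is a walk inside `T`. -/
structure IsSeq (G : SimpleGraph V) (T : Set V) (f : ℤ → V) (n : ℤ) : Prop where
  nonneg : 0 ≤ n
  mem : ∀ i, 0 ≤ i → i ≤ n → f i ∈ T
  adj : ∀ i, 0 ≤ i → i < n → G.Adj (f i) (f (i + 1))

/-- `f a, …, f b` are the vertices of an induced path of `G`, in this order. -/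
def IsIPath (G : SimpleGraph V) (f : ℤ → V) (a b : ℤ) : Prop :=
  ∀ i j, a ≤ i → i < j → j ≤ b → f i ≠ f j ∧ (G.Adj (f i) (f j) ↔ j = i + 1)

lemma IsConnOn.exists_isSeq {T : Set V} (hT : G.IsConnOn T) {x y : V} (hx : x ∈ T)
    (hy : y ∈ T) : ∃ f n, G.IsSeq T f n ∧ f 0 = x ∧ f n = y := by
  have h := hT x hx y hy
  clear hy
  induction h with
  | refl => exact ⟨fun _ => x, 0, ⟨le_rfl, fun _ _ _ => hx, fun i h h' => by omega⟩, rfl, rfl⟩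
  | @tail b c _ hbc ih =>
    obtain ⟨f, n, hf, h0, hn⟩ := ih
    have hn0 := hf.nonneg
    refine ⟨fun i => if i ≤ n then f i else c, n + 1, ⟨by omega, ?_, ?_⟩, ?_, ?_⟩
    · intro i hi _
      split_ifs with h
      · exact hf.mem i hi h
      · exact hbc.2
    · intro i hi hi'
      rw [if_pos (by omega)]
      split_ifs with h
      · exact hf.adj i hi (by omega)
      · rw [show i = n by omega, hn]
        exact hbc.1
    · simp only
      rw [if_pos hn0, h0]
    · simp

/-- Leaving out the vertices of a walk strictly between positions `a` and `b`, and one of the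
positions `a`, `b`. -/
lemma IsSeq.shortcut {T : Set V} {f : ℤ → V} {n a b : ℤ} (h : G.IsSeq T f n) (ha : 0 ≤ a)
    (hab : a < b) (hb : b ≤ n) (hadj : G.Adj (f a) (f b)) :
    G.IsSeq T (fun i => if i ≤ a then f i else f (i + (b - a - 1))) (n - (b - a - 1)) := by
  refine ⟨by omega, ?_, ?_⟩
  · intro i h1 h2
    split_ifs with h3
    · exact h.mem _ (by omega) (by omega)
    · exact h.mem _ (by omega) (by omega)
  · intro i h1 h2
    rcases lt_trichotomy i a with h3 | h3 | h3
    · rw [if_pos (by omega), if_pos (by omega)]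
      exact h.adj i h1 (by omega)
    · subst h3
      rw [if_pos (by omega), if_neg (by omega), show i + 1 + (b - i - 1) = b by ring]
      exact hadj
    · rw [if_neg (by omega), if_neg (by omega),
        show i + 1 + (b - a - 1) = i + (b - a - 1) + 1 by ring]
      exact h.adj _ (by omega) (by omega)

lemma IsSeq.skip {T : Set V} {f : ℤ → V} {n a b : ℤ} (h : G.IsSeq T f n) (ha : 0 ≤ a)
    (hab : a < b) (hb : b ≤ n) (heq : f a = f b) :
    G.IsSeq T (fun i => if i ≤ a then f i else f (i + (b - a))) (n - (b - a)) := by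
  refine ⟨by omega, ?_, ?_⟩
  · intro i h1 h2
    split_ifs with h3
    · exact h.mem _ (by omega) (by omega)
    · exact h.mem _ (by omega) (by omega)
  · intro i h1 h2
    rcases lt_trichotomy i a with h3 | h3 | h3
    · rw [if_pos (by omega), if_pos (by omega)]
      exact h.adj i h1 (by omega)
    · subst h3
      rw [if_pos (by omega), if_neg (by omega), show i + 1 + (b - i) = b + 1 by ring, heq]
      exact h.adj b (by omega) (by omega)
    · rw [if_neg (by omega), if_neg (by omega),
        show i + 1 + (b - a) = i + (b - a) + 1 by ring]
      exact h.adj _ (by omega) (by omega)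

lemma IsSeq.sub {T : Set V} {f : ℤ → V} {n a b : ℤ} (h : G.IsSeq T f n) (ha : 0 ≤ a)
    (hab : a ≤ b) (hb : b ≤ n) : G.IsSeq T (fun i => f (a + i)) (b - a) := by
  refine ⟨by omega, fun i h1 h2 => h.mem _ (by omega) (by omega), fun i h1 h2 => ?_⟩
  have := h.adj (a + i) (by omega) (by omega)
  rwa [add_assoc] at this

lemma IsSeq.reverse {T : Set V} {f : ℤ → V} {n : ℤ} (h : G.IsSeq T f n) :
    G.IsSeq T (fun i => f (n - i)) n := by
  refine ⟨h.nonneg, fun i h1 h2 => h.mem _ (by omega) (by omega), fun i h1 h2 => ?_⟩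
  have := (h.adj (n - (i + 1)) (by omega) (by omega)).symm
  rwa [show n - (i + 1) + 1 = n - i by ring] at this

/-- A walk followed by one more vertex. -/
lemma IsSeq.snoc {T : Set V} {f : ℤ → V} {n : ℤ} (h : G.IsSeq T f n) {q : V} (hq : q ∈ T)
    (hadj : G.Adj (f n) q) : G.IsSeq T (fun i => if i ≤ n then f i else q) (n + 1) := by
  have := h.nonneg
  refine ⟨by omega, fun i h1 h2 => ?_, fun i h1 h2 => ?_⟩
  · split_ifs with h3
    · exact h.mem i h1 h3
    · exact hq
  · rw [if_pos (by omega)]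
    split_ifs with h3
    · exact h.adj i h1 (by omega)
    · rwa [show i = n by omega]

/-- A shortest walk inside `T` whose ends are related by `R` is an induced path. -/
lemma exists_min_seq {T : Set V} {R : V → V → Prop}
    (h : ∃ f n, G.IsSeq T f n ∧ R (f 0) (f n)) :
    ∃ f n, G.IsSeq T f n ∧ R (f 0) (f n) ∧ G.IsIPath f 0 n ∧
      ∀ g m, G.IsSeq T g m → R (g 0) (g m) → n ≤ m := by
  classical
  have hP : ∃ k : ℕ, ∃ f, G.IsSeq T f k ∧ R (f 0) (f k) := by
    obtain ⟨f, n, hf, hR⟩ := h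
    refine ⟨n.toNat, f, ?_⟩
    rw [Int.toNat_of_nonneg hf.nonneg]
    exact ⟨hf, hR⟩
  obtain ⟨f, hf, hR⟩ := Nat.find_spec hP
  have hmin : ∀ g m, G.IsSeq T g m → R (g 0) (g m) → (Nat.find hP : ℤ) ≤ m := by
    intro g m hg hgR
    have : Nat.find hP ≤ m.toNat := by
      apply Nat.find_min' hP
      refine ⟨g, ?_⟩
      rw [Int.toNat_of_nonneg hg.nonneg]
      exact ⟨hg, hgR⟩
    have := hg.nonneg
    omega
  refine ⟨f, Nat.find hP, hf, hR, ?_, hmin⟩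
  generalize (Nat.find hP : ℤ) = n at *
  intro i j h0 hij hj
  constructor
  · intro heq
    have h1 := hmin _ _ (hf.skip h0 hij hj heq) (by
      rw [if_pos h0]
      -- If `j = n`, the shortened walk ends at position `i`, where `f i = f n`; otherwise it still
      -- ends with `f n`.
      split_ifs with h2
      · have hj' : j = n := by omega
        rw [show n - (j - i) = i by omega, heq, hj']
        exact hR
      · rw [show n - (j - i) + (j - i) = n by ring]
        exact hR)
    omega
  · constructor
    · intro hadj
      have h1 := hmin _ _ (hf.shortcut h0 hij hj hadj) (by
        rw [if_pos h0, if_neg (by omega), show n - (j - i - 1) + (j - i - 1) = n by ring]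
        exact hR)
      omega
    · rintro rfl
      exact hf.adj i h0 (by omega)

/-! ### Induced paths -/

lemma IsIPath.mono {f : ℤ → V} {a b a' b' : ℤ} (h : G.IsIPath f a b) (ha : a ≤ a')
    (hb : b' ≤ b) : G.IsIPath f a' b' :=
  fun i j h1 h2 h3 => h i j (by omega) h2 (by omega)

lemma IsIPath.adj_succ {f : ℤ → V} {a b i : ℤ} (h : G.IsIPath f a b) (hi : a ≤ i)
    (hi' : i < b) : G.Adj (f i) (f (i + 1)) :=
  (h i (i + 1) hi (by omega) (by omega)).2.2 rfl

lemma IsIPath.adj_iff {f : ℤ → V} {a b i j : ℤ} (h : G.IsIPath f a b) (hi : a ≤ i)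
    (hi' : i ≤ b) (hj : a ≤ j) (hj' : j ≤ b) :
    G.Adj (f i) (f j) ↔ j = i + 1 ∨ i = j + 1 := by
  rcases lt_trichotomy i j with h1 | h1 | h1
  · rw [(h i j hi h1 hj').2]
    omega
  · subst h1
    simp
  · rw [G.adj_comm, (h j i hj h1 hi').2]
    omega

lemma IsIPath.inj {f : ℤ → V} {a b i j : ℤ} (h : G.IsIPath f a b) (hi : a ≤ i)
    (hi' : i ≤ b) (hj : a ≤ j) (hj' : j ≤ b) : f i = f j ↔ i = j := by
  refine ⟨fun heq => ?_, fun heq => heq ▸ rfl⟩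
  rcases lt_trichotomy i j with h1 | h1 | h1
  · exact absurd heq (h i j hi h1 hj').1
  · exact h1
  · exact absurd heq.symm (h j i hj h1 hi').1

lemma IsIPath.isConnOn {f : ℤ → V} {a b : ℤ} (h : G.IsIPath f a b) :
    G.IsConnOn (f '' Set.Icc a b) := isConnOn_image fun _ h1 h2 => h.adj_succ h1 h2

lemma IsIPath.reverse {f : ℤ → V} {a b : ℤ} (s : ℤ) (h : G.IsIPath f a b) :
    G.IsIPath (fun i => f (s - i)) (s - b) (s - a) := by
  intro i j h1 h2 h3
  have := h (s - j) (s - i) (by omega) (by omega) (by omega)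
  refine ⟨this.1.symm, ?_⟩
  rw [G.adj_comm, this.2]
  omega

lemma isIPath_self (f : ℤ → V) (a : ℤ) : G.IsIPath f a a := fun i j h1 h2 h3 => by omega

/-- `f a, …, f b` followed by `g d, g (d+1), …`. -/
def glueSeq (f : ℤ → V) (b : ℤ) (g : ℤ → V) (d : ℤ) : ℤ → V :=
  fun t => if t ≤ b then f t else g (t - b - 1 + d)

lemma image_glueSeq (f : ℤ → V) (a b : ℤ) (g : ℤ → V) (d e : ℤ) (hab : a ≤ b) (hde : d ≤ e) :
    glueSeq f b g d '' Set.Icc a (b + 1 + (e - d)) = f '' Set.Icc a b ∪ g '' Set.Icc d e := by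
  ext x
  constructor
  · rintro ⟨t, ⟨h1, h2⟩, rfl⟩
    unfold glueSeq
    split_ifs with h
    · exact .inl ⟨t, ⟨h1, h⟩, rfl⟩
    · exact .inr ⟨_, ⟨by omega, by omega⟩, rfl⟩
  · rintro (⟨t, ⟨h1, h2⟩, rfl⟩ | ⟨t, ⟨h1, h2⟩, rfl⟩)
    · exact ⟨t, ⟨h1, by omega⟩, by simp [glueSeq, h2]⟩
    · refine ⟨t + b + 1 - d, ⟨by omega, by omega⟩, ?_⟩
      rw [glueSeq, if_neg (by omega)]
      congr 1
      omega

/-- Two induced paths joined by an edge form an induced path. -/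
lemma IsIPath.glue {f g : ℤ → V} {a b d e : ℤ} (hf : G.IsIPath f a b) (hg : G.IsIPath g d e)
    (hne : ∀ i j, a ≤ i → i ≤ b → d ≤ j → j ≤ e → f i ≠ g j)
    (hadj : ∀ i j, a ≤ i → i ≤ b → d ≤ j → j ≤ e → (G.Adj (f i) (g j) ↔ i = b ∧ j = d)) :
    G.IsIPath (glueSeq f b g d) a (b + 1 + (e - d)) := by
  intro i j h1 h2 h3
  unfold glueSeq
  by_cases hj : j ≤ b
  · rw [if_pos (by omega), if_pos hj]
    exact hf i j h1 h2 hj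
  · by_cases hi : i ≤ b
    · rw [if_pos hi, if_neg hj]
      refine ⟨hne _ _ h1 hi (by omega) (by omega), ?_⟩
      rw [hadj _ _ h1 hi (by omega) (by omega)]
      omega
    · rw [if_neg hi, if_neg hj]
      have := hg (i - b - 1 + d) (j - b - 1 + d) (by omega) (by omega) (by omega)
      refine ⟨this.1, ?_⟩
      rw [this.2]
      omega

/-! ### Holes -/

/-- `c` runs around an induced cycle of length `L`, with period `L`. -/
structure IsHole (G : SimpleGraph V) (L : ℤ) (c : ℤ → V) : Prop where
  four_le : 4 ≤ L
  periodic : ∀ i, c (i + L) = c i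
  ne : ∀ i j, i < j → j < i + L → c i ≠ c j
  adj : ∀ i j, i < j → j < i + L → (G.Adj (c i) (c j) ↔ j = i + 1 ∨ j = i + L - 1)

/-- `H` is the vertex set of an induced cycle of length at least four. -/
def IsHoleSet (G : SimpleGraph V) (H : Set V) : Prop :=
  ∃ L c, G.IsHole L c ∧ Set.range c = H

section Periodic

variable {c : ℤ → V} {L : ℤ}

lemma periodic_add_mul (h : ∀ i, c (i + L) = c i) (i k : ℤ) : c (i + k * L) = c i := by
  induction k using Int.induction_on with
  | zero => simp
  | succ n ih => rw [← ih, ← h (i + n * L)]; congr 1; ring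
  | pred n ih => rw [← ih, ← h (i + (-n - 1) * L)]; congr 1; ring

lemma periodic_exists (h : ∀ i, c (i + L) = c i) (hL : 0 < L) (i r : ℤ) :
    ∃ j, r ≤ j ∧ j < r + L ∧ c j = c i ∧ ∃ k, j = i + k * L := by
  refine ⟨r + (i - r) % L, ?_, ?_, ?_, ?_⟩
  · have := Int.emod_nonneg (i - r) hL.ne'
    omega
  · have := Int.emod_lt_of_pos (i - r) hL
    omega
  · rw [← periodic_add_mul h i (-((i - r) / L))]
    congr 1
    have := Int.mul_ediv_add_emod (i - r) L
    linarith
  · refine ⟨-((i - r) / L), ?_⟩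
    have := Int.mul_ediv_add_emod (i - r) L
    linarith

lemma range_eq_image_window (h : ∀ i, c (i + L) = c i) (hL : 0 < L) (r : ℤ) :
    Set.range c = c '' Set.Ico r (r + L) := by
  ext x
  constructor
  · rintro ⟨i, rfl⟩
    obtain ⟨j, h1, h2, h3, -⟩ := periodic_exists h hL i r
    exact ⟨j, ⟨h1, h2⟩, h3⟩
  · rintro ⟨i, -, rfl⟩
    exact ⟨i, rfl⟩

end Periodic

section Hole

variable {c : ℤ → V} {L : ℤ}

/-- The start `r` of the window is free, so a window can be chosen in which the arcs at hand do not
wrap around. -/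
lemma IsHole.exists_window (h : G.IsHole L c) {x : V} (hx : x ∈ Set.range c) (r : ℤ) :
    ∃ j, r ≤ j ∧ j < r + L ∧ c j = x := by
  have := h.four_le
  rw [range_eq_image_window h.periodic (by omega) r] at hx
  obtain ⟨j, ⟨h1, h2⟩, h3⟩ := hx
  exact ⟨j, h1, h2, h3⟩

lemma IsHole.adj_window (h : G.IsHole L c) (r : ℤ) {i j : ℤ} (hi : r ≤ i) (hi' : i < r + L)
    (hj : r ≤ j) (hj' : j < r + L) :
    G.Adj (c i) (c j) ↔ j = i + 1 ∨ i = j + 1 ∨ j = i + L - 1 ∨ i = j + L - 1 := by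
  have := h.four_le
  rcases lt_trichotomy i j with h1 | h1 | h1
  · rw [h.adj i j h1 (by omega)]
    omega
  · subst h1
    simp only [SimpleGraph.irrefl, false_iff]
    omega
  · rw [G.adj_comm, h.adj j i h1 (by omega)]
    omega

lemma IsHole.inj_window (h : G.IsHole L c) (r : ℤ) {i j : ℤ} (hi : r ≤ i) (hi' : i < r + L)
    (hj : r ≤ j) (hj' : j < r + L) : c i = c j ↔ i = j := by
  refine ⟨fun heq => ?_, fun heq => heq ▸ rfl⟩
  rcases lt_trichotomy i j with h1 | h1 | h1
  · exact absurd heq (h.ne i j h1 (by omega))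
  · exact h1
  · exact absurd heq.symm (h.ne j i h1 (by omega))

lemma IsHole.adj_succ (h : G.IsHole L c) (i : ℤ) : G.Adj (c i) (c (i + 1)) := by
  have := h.four_le
  exact (h.adj i (i + 1) (by omega) (by omega)).2 (.inl rfl)

lemma IsHole.eq_of_add (h : G.IsHole L c) {i j : ℤ} (hij : i = j + L) : c i = c j := by
  rw [hij, h.periodic]

lemma IsHole.reflect (h : G.IsHole L c) (s : ℤ) : G.IsHole L (fun i => c (s - i)) := by
  refine ⟨h.four_le, fun i => ?_, fun i j h1 h2 => ?_, fun i j h1 h2 => ?_⟩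
  · rw [← h.periodic]
    congr 1
    ring
  · exact (h.ne (s - j) (s - i) (by omega) (by omega)).symm
  · rw [G.adj_comm, h.adj (s - j) (s - i) (by omega) (by omega)]
    omega

lemma IsHole.isIPath (h : G.IsHole L c) {a b : ℤ} (hab : b ≤ a + L - 2) :
    G.IsIPath c a b := by
  intro i j h1 h2 h3
  refine ⟨h.ne i j h2 (by omega), ?_⟩
  rw [h.adj i j h2 (by omega)]
  omega

lemma IsHole.isConnOn_arc (h : G.IsHole L c) (a b : ℤ) :
    G.IsConnOn (c '' Set.Icc a b) := isConnOn_image fun i _ _ => h.adj_succ i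

/-- Periodic extension of a cyclic sequence. -/
lemma exists_periodic_ext (f : ℤ → V) (L : ℤ) :
    ∃ c : ℤ → V, (∀ i, c (i + L) = c i) ∧ (∀ i, 0 ≤ i → i < L → c i = f i) :=
  ⟨fun i => f (i % L), fun i => by simp, fun i h1 h2 => by simp [Int.emod_eq_of_lt h1 h2]⟩

/-- Two positions less than one turn apart can be shifted into `[0, L)` by a multiple of `L`, except
that the later one may have to be lowered by one more turn. This swaps their order, and also swaps
the two alternatives for adjacency. -/
lemma isHole_of_window (hL : 4 ≤ L) (hper : ∀ i, c (i + L) = c i)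
    (h : ∀ i j, 0 ≤ i → i < j → j < L →
      c i ≠ c j ∧ (G.Adj (c i) (c j) ↔ j = i + 1 ∨ j = i + L - 1)) : G.IsHole L c := by
  have key : ∀ i j, i < j → j < i + L →
      c i ≠ c j ∧ (G.Adj (c i) (c j) ↔ j = i + 1 ∨ j = i + L - 1) := by
    intro i j h1 h2
    obtain ⟨i', a1, a2, a3, k, a4⟩ := periodic_exists hper (by omega) i 0
    have hj : c (j + k * L) = c j := periodic_add_mul hper j k
    rcases lt_or_ge (j + k * L) L with h3 | h3
    · rw [← a3, ← hj]
      have := h i' (j + k * L) a1 (by omega) h3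
      refine ⟨this.1, this.2.trans ?_⟩
      omega
    · have hj' : c (j + k * L - L) = c j := by
        rw [← hj, ← hper]
        congr 1
        ring
      rw [← a3, ← hj']
      have := h (j + k * L - L) i' (by omega) (by omega) (by omega)
      refine ⟨this.1.symm, ?_⟩
      rw [G.adj_comm, this.2]
      omega
  exact ⟨hL, hper, fun i j h1 h2 => (key i j h1 h2).1, fun i j h1 h2 => (key i j h1 h2).2⟩

/-- Two induced paths, joined by edges at both pairs of ends, form a hole. -/
lemma exists_isHole_glue {f g : ℤ → V} {a b d e : ℤ} (hf : G.IsIPath f a b)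
    (hg : G.IsIPath g d e) (hab : a ≤ b) (hde : d ≤ e) (hlen : 2 ≤ (b - a) + (e - d))
    (hne : ∀ i j, a ≤ i → i ≤ b → d ≤ j → j ≤ e → f i ≠ g j)
    (hadj : ∀ i j, a ≤ i → i ≤ b → d ≤ j → j ≤ e →
      (G.Adj (f i) (g j) ↔ (i = b ∧ j = d) ∨ (i = a ∧ j = e))) :
    ∃ c, G.IsHole ((b - a) + (e - d) + 2) c ∧ (∀ i, 0 ≤ i → i ≤ b - a → c i = f (a + i)) ∧
      (∀ i, 0 ≤ i → i ≤ e - d → c (b - a + 1 + i) = g (d + i)) ∧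
      Set.range c = f '' Set.Icc a b ∪ g '' Set.Icc d e := by
  -- The paths have `b - a + 1` and `e - d + 1` vertices, so `hlen` says that the cycle has length
  -- at least four.
  obtain ⟨c, hper, hc⟩ := exists_periodic_ext
    (fun i => glueSeq f b g d (a + i)) ((b - a) + (e - d) + 2)
  have hc1 : ∀ i, 0 ≤ i → i ≤ b - a → c i = f (a + i) := by
    intro i h1 h2
    rw [hc i h1 (by omega), glueSeq, if_pos (by omega)]
  have hc2 : ∀ i, 0 ≤ i → i ≤ e - d → c (b - a + 1 + i) = g (d + i) := by
    intro i h1 h2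
    rw [hc _ (by omega) (by omega), glueSeq, if_neg (by omega)]
    congr 1
    ring
  refine ⟨c, isHole_of_window (by omega) hper ?_, hc1, hc2, ?_⟩
  · intro i j h0 hij hj
    by_cases hj' : j ≤ b - a
    · rw [hc1 i h0 (by omega), hc1 j (by omega) hj']
      have := hf (a + i) (a + j) (by omega) (by omega) (by omega)
      refine ⟨this.1, this.2.trans ?_⟩
      omega
    · obtain ⟨j', rfl⟩ : ∃ j', j = b - a + 1 + j' := ⟨j - (b - a + 1), by ring⟩
      rw [hc2 j' (by omega) (by omega)]
      by_cases hi : i ≤ b - a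
      · rw [hc1 i h0 hi]
        refine ⟨hne _ _ (by omega) (by omega) (by omega) (by omega), ?_⟩
        rw [hadj _ _ (by omega) (by omega) (by omega) (by omega)]
        omega
      · obtain ⟨i', rfl⟩ : ∃ i', i = b - a + 1 + i' := ⟨i - (b - a + 1), by ring⟩
        rw [hc2 i' (by omega) (by omega)]
        have := hg (d + i') (d + j') (by omega) (by omega) (by omega)
        refine ⟨this.1, this.2.trans ?_⟩
        omega
  · rw [range_eq_image_window hper (by omega) 0]
    ext x
    constructor
    · rintro ⟨i, ⟨h1, h2⟩, rfl⟩
      by_cases hi : i ≤ b - a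
      · rw [hc1 i h1 hi]
        exact .inl ⟨_, ⟨by omega, by omega⟩, rfl⟩
      · obtain ⟨i', rfl⟩ : ∃ i', i = b - a + 1 + i' := ⟨i - (b - a + 1), by ring⟩
        rw [hc2 i' (by omega) (by omega)]
        exact .inr ⟨_, ⟨by omega, by omega⟩, rfl⟩
    · rintro (⟨i, ⟨h1, h2⟩, rfl⟩ | ⟨i, ⟨h1, h2⟩, rfl⟩)
      · refine ⟨i - a, ⟨by omega, by omega⟩, ?_⟩
        rw [hc1 _ (by omega) (by omega)]
        congr 1
        ring
      · refine ⟨b - a + 1 + (i - d), ⟨by omega, by omega⟩, ?_⟩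
        rw [hc2 _ (by omega) (by omega)]
        congr 1
        ring

lemma isHoleSet_glue {f g : ℤ → V} {a b d e : ℤ} (hf : G.IsIPath f a b)
    (hg : G.IsIPath g d e) (hab : a ≤ b) (hde : d ≤ e) (hlen : 2 ≤ (b - a) + (e - d))
    (hne : ∀ i j, a ≤ i → i ≤ b → d ≤ j → j ≤ e → f i ≠ g j)
    (hadj : ∀ i j, a ≤ i → i ≤ b → d ≤ j → j ≤ e →
      (G.Adj (f i) (g j) ↔ (i = b ∧ j = d) ∨ (i = a ∧ j = e))) :
    G.IsHoleSet (f '' Set.Icc a b ∪ g '' Set.Icc d e) := by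
  obtain ⟨c, hc, -, -, hr⟩ := exists_isHole_glue hf hg hab hde hlen hne hadj
  exact ⟨_, c, hc, hr⟩

end Hole

lemma CliqueFree.not_triangle (h : G.CliqueFree 3) {x y z : V} (hxy : G.Adj x y)
    (hyz : G.Adj y z) (hxz : G.Adj x z) : False := by
  classical
  exact h {x, y, z} (is3Clique_triple_iff.2 ⟨hxy, hxz, hyz⟩)

end SimpleGraph

namespace SimpleGraph

variable {V : Type*} {G : SimpleGraph V}

/-! ### Building subdivisions of `K₄` -/

lemma exists_walk_of_seq (f : ℤ → V) (n : ℕ)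
    (h : ∀ i : ℤ, 0 ≤ i → i < n → G.Adj (f i) (f (i + 1))) :
    ∃ w : G.Walk (f 0) (f n), w.support = (List.range (n + 1)).map (fun i : ℕ => f i) ∧
      ∀ i : ℤ, 0 ≤ i → i < n → s(f i, f (i + 1)) ∈ w.edges := by
  induction n with
  | zero => exact ⟨Walk.nil, by simp, fun i h1 h2 => by simp at h2; omega⟩
  | succ n ih =>
    obtain ⟨w, hw, he⟩ := ih fun i h1 h2 => h i h1 (by push_cast; omega)
    have hadj : G.Adj (f n) (f (n + 1 : ℕ)) := by
      have := h n (by omega) (by push_cast; omega)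
      simpa using this
    refine ⟨w.concat hadj, ?_, fun i h1 h2 => ?_⟩
    · rw [Walk.support_concat, hw, List.range_succ (n := n + 1)]
      simp
    · rw [Walk.edges_concat, List.concat_eq_append, List.mem_append]
      rcases lt_or_ge i n with h3 | h3
      · exact .inl (he i h1 h3)
      · right
        have : i = n := by push_cast at h2; omega
        subst this
        simp

/-- Subdivisions are defined through walks, whereas all constructions use sequences; this is the
passage between them. Injectivity makes the walk a path, and it lives in `G.induce S` because its
support does. -/
lemma exists_induce_path_of_seq (f : ℤ → V) (n : ℕ) (S : Set V) {x y : S} (h0 : f 0 = x)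
    (hn : f n = y) (hS : ∀ i : ℤ, 0 ≤ i → i ≤ n → f i ∈ S)
    (hadj : ∀ i : ℤ, 0 ≤ i → i < n → G.Adj (f i) (f (i + 1)))
    (hinj : ∀ i j : ℤ, 0 ≤ i → i < j → j ≤ n → f i ≠ f j) :
    ∃ w : (G.induce S).Walk x y, w.IsPath ∧
      (∀ z, z ∈ w.support ↔ ∃ i : ℤ, 0 ≤ i ∧ i ≤ n ∧ f i = z) ∧
      ∀ z z' : S, (∃ i : ℤ, 0 ≤ i ∧ i < n ∧ f i = z ∧ f (i + 1) = z') → s(z, z') ∈ w.edges := by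
  obtain ⟨x, hx⟩ := x
  obtain ⟨y, hy⟩ := y
  dsimp only at h0 hn
  subst h0 hn
  obtain ⟨w, hw, he⟩ := exists_walk_of_seq f n hadj
  have hmem : ∀ z ∈ w.support, z ∈ S := by
    intro z hz
    rw [hw, List.mem_map] at hz
    obtain ⟨i, hi, rfl⟩ := hz
    rw [List.mem_range] at hi
    exact hS i (by omega) (by omega)
  have hpath : w.IsPath := by
    rw [Walk.isPath_def, hw]
    refine List.Nodup.map_on ?_ List.nodup_range
    intro i hi j hj hij
    rw [List.mem_range] at hi hj
    rcases lt_trichotomy i j with h | h | h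
    · exact absurd hij (hinj i j (by omega) (by omega) (by omega))
    · exact h
    · exact absurd hij.symm (hinj j i (by omega) (by omega) (by omega))
  refine ⟨w.induce S hmem, ?_, ?_, ?_⟩
  · rw [← Walk.isPath_map_iff_of_injective (f := (Embedding.induce S).toHom)
      (Embedding.induce (G := G) S).injective]
    rw [Walk.map_induce]
    exact hpath
  · rintro ⟨z, hz⟩
    rw [Walk.support_induce, List.mem_attachWith, hw, List.mem_map]
    constructor
    · rintro ⟨i, hi, rfl⟩
      rw [List.mem_range] at hi
      exact ⟨i, by omega, by omega, rfl⟩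
    · rintro ⟨i, h1, h2, rfl⟩
      refine ⟨i.toNat, List.mem_range.2 (by omega), ?_⟩
      rw [Int.toNat_of_nonneg h1]
  · rintro z z' ⟨i, h1, h2, h3, h4⟩
    have h5 := he i h1 h2
    rw [h3, h4] at h5
    have h6 : s((z : V), (z' : V)) ∈
        ((w.induce S hmem).map (Embedding.induce S).toHom).edges := by
      rw [Walk.map_induce]
      exact h5
    rw [Walk.edges_map, List.mem_map] at h6
    obtain ⟨e, he1, he2⟩ := h6
    have : e = s(z, z') := by
      apply Sym2.map.injective (Embedding.induce (G := G) S).injective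
      exact he2
    rwa [this] at he1

/-- Four corners and six paths inducing a subdivision of `K₄`. -/
lemma not_isk4Free_of_seqs (b : Fin 4 → V) (f : Fin 4 → Fin 4 → ℤ → V) (n : Fin 4 → Fin 4 → ℕ)
    (hb : Function.Injective b)
    (h0 : ∀ u v, u < v → f u v 0 = b u) (h1 : ∀ u v, u < v → f u v (n u v) = b v)
    (hadj : ∀ u v, u < v → ∀ i : ℤ, 0 ≤ i → i < n u v → G.Adj (f u v i) (f u v (i + 1)))
    (hinj : ∀ u v, u < v → ∀ i j : ℤ, 0 ≤ i → i < j → j ≤ n u v → f u v i ≠ f u v j)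
    (hinner : ∀ u v, u < v → ∀ i : ℤ, 0 ≤ i → i ≤ n u v → ∀ x, b x = f u v i → x = u ∨ x = v)
    (hdisj : ∀ u v u' v', u < v → u' < v' → (u, v) ≠ (u', v') → ∀ i j : ℤ, 0 ≤ i → i ≤ n u v →
      0 ≤ j → j ≤ n u' v' → f u v i = f u' v' j → ∃ x, b x = f u v i)
    (hedge : ∀ u v u' v', u < v → u' < v' → ∀ i j : ℤ, 0 ≤ i → i ≤ n u v →
      0 ≤ j → j ≤ n u' v' → G.Adj (f u v i) (f u' v' j) →
      ∃ p q, p < q ∧ ∃ k : ℤ, 0 ≤ k ∧ k < n p q ∧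
        ((f p q k = f u v i ∧ f p q (k + 1) = f u' v' j) ∨
          (f p q k = f u' v' j ∧ f p q (k + 1) = f u v i))) :
    ¬ G.ISK4Free := by
  classical
  intro hfree
  -- The union of the six paths; `hedge` says that its induced subgraph has no edges beyond those of
  -- the paths.
  let S : Set V := {x | ∃ u v, u < v ∧ ∃ i : ℤ, 0 ≤ i ∧ i ≤ n u v ∧ f u v i = x}
  apply hfree S
  have hbS : ∀ u, b u ∈ S := by
    intro u
    -- Every corner starts the path to corner 3, except corner 3 itself, which ends the path from
    -- corner 0.
    by_cases hu : u = 3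
    · exact ⟨0, 3, by decide, n 0 3, by omega, le_rfl, by rw [h1 _ _ (by decide), hu]⟩
    · exact ⟨u, 3, by omega, 0, le_rfl, by omega, h0 _ _ (by omega)⟩
  have hW : ∀ u v, u < v → ∃ w : (G.induce S).Walk ⟨b u, hbS u⟩ ⟨b v, hbS v⟩, w.IsPath ∧
      (∀ z, z ∈ w.support ↔ ∃ i : ℤ, 0 ≤ i ∧ i ≤ n u v ∧ f u v i = z) ∧
      ∀ z z' : S, (∃ i : ℤ, 0 ≤ i ∧ i < n u v ∧ f u v i = z ∧ f u v (i + 1) = z') →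
        s(z, z') ∈ w.edges := fun u v huv =>
    exists_induce_path_of_seq (f u v) (n u v) S (h0 u v huv) (h1 u v huv)
      (fun i hi hi' => ⟨u, v, huv, i, hi, hi', rfl⟩) (hadj u v huv) (hinj u v huv)
  choose W hWp hWs hWe using hW
  have key : ∀ u v : Fin 4, (completeGraph (Fin 4)).Adj u v → ¬ u < v → v < u := by
    intro u v h h'
    have : u ≠ v := h
    omega
  -- The data cover `u < v`; the other direction is obtained by reversal.
  let P : ∀ u v : Fin 4, (completeGraph (Fin 4)).Adj u v →
      (G.induce S).Walk ⟨b u, hbS u⟩ ⟨b v, hbS v⟩ := fun u v h =>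
    if huv : u < v then W u v huv else (W v u (key u v h huv)).reverse
  have hPs : ∀ u v h z, z ∈ (P u v h).support →
      ∃ u' v', u' < v' ∧ s(u, v) = s(u', v') ∧ ∃ i : ℤ, 0 ≤ i ∧ i ≤ n u' v' ∧ f u' v' i = z := by
    intro u v h z hz
    simp only [P] at hz
    split_ifs at hz with huv
    · exact ⟨u, v, huv, rfl, (hWs u v huv z).1 hz⟩
    · rw [Walk.support_reverse, List.mem_reverse] at hz
      exact ⟨v, u, key u v h huv, Sym2.eq_swap, (hWs v u _ z).1 hz⟩
  refine ⟨⟨fun u => ⟨b u, hbS u⟩, fun u v h => hb (by simpa using h)⟩, P, ?_, ?_, ?_, ?_, ?_, ?_⟩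
  · intro u v h
    simp only [P]
    split_ifs with huv
    · exact hWp u v huv
    · exact (hWp v u _).reverse
  · intro u v h
    have : u ≠ v := h
    simp only [P]
    by_cases huv : u < v
    · rw [dif_neg (by omega), dif_pos huv]
    · rw [dif_pos (by omega), dif_neg huv, Walk.reverse_reverse]
  · intro u v h x hx
    obtain ⟨u', v', h2, h3, i, hi, hi', h4⟩ := hPs u v h _ hx
    have h5 := hinner u' v' h2 i hi hi' x h4.symm
    rw [Sym2.eq_iff] at h3
    rcases h3 with ⟨rfl, rfl⟩ | ⟨rfl, rfl⟩
    · exact h5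
    · exact h5.symm
  · intro u v h u' v' h' hne w hw hw'
    obtain ⟨p, q, h2, h3, i, hi, hi', h4⟩ := hPs u v h _ hw
    obtain ⟨p', q', h2', h3', j, hj, hj', h4'⟩ := hPs u' v' h' _ hw'
    obtain ⟨x, hx⟩ := hdisj p q p' q' h2 h2' (by
      rintro heq
      rw [Prod.mk.injEq] at heq
      apply hne
      rw [h3, h3', heq.1, heq.2]) i j hi hi' hj hj' (h4.trans h4'.symm)
    exact ⟨x, Subtype.ext (hx.trans h4)⟩
  · rintro ⟨w, u, v, huv, i, hi, hi', rfl⟩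
    refine .inr ⟨u, v, show u ≠ v by omega, ?_⟩
    simp only [P]
    rw [dif_pos huv]
    exact (hWs u v huv _).2 ⟨i, hi, hi', rfl⟩
  · intro e
    refine Sym2.ind ?_ e
    rintro ⟨x, u, v, huv, i, hi, hi', rfl⟩ ⟨y, u', v', huv', j, hj, hj', rfl⟩ hxy
    rw [mem_edgeSet, comap_adj] at hxy
    obtain ⟨p, q, hpq, k, hk, hk', h2⟩ := hedge u v u' v' huv huv' i j hi hi' hj hj' hxy
    refine ⟨p, q, show p ≠ q by omega, ?_⟩
    simp only [P]
    rw [dif_pos hpq]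
    rcases h2 with h2 | h2
    · exact hWe p q hpq _ _ ⟨k, hk, hk', h2.1, h2.2⟩
    · rw [Sym2.eq_swap]
      exact hWe p q hpq _ _ ⟨k, hk, hk', h2.1, h2.2⟩

/-! ### Tripods -/

/-- Three induced paths (legs) of `T` starting at a common vertex `f r 0`, otherwise disjoint and
without edges between them. -/
structure IsTripod (G : SimpleGraph V) (T : Set V) (f : Fin 3 → ℤ → V) (n : Fin 3 → ℤ) :
    Prop where
  nonneg : ∀ r, 0 ≤ n r
  mem : ∀ r i, 0 ≤ i → i ≤ n r → f r i ∈ T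
  center : ∀ r s, f r 0 = f s 0
  ipath : ∀ r, G.IsIPath (f r) 0 (n r)
  ne : ∀ r s, r ≠ s → ∀ i j, 1 ≤ i → i ≤ n r → 1 ≤ j → j ≤ n s → f r i ≠ f s j
  not_adj : ∀ r s, r ≠ s → ∀ i j, 1 ≤ i → i ≤ n r → 1 ≤ j → j ≤ n s → ¬ G.Adj (f r i) (f s j)

lemma IsTripod.of_lt {T : Set V} {f : Fin 3 → ℤ → V} {n : Fin 3 → ℤ} (h1 : ∀ r, 0 ≤ n r)
    (h2 : ∀ r i, 0 ≤ i → i ≤ n r → f r i ∈ T) (h3 : ∀ r s, f r 0 = f s 0)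
    (h4 : ∀ r, G.IsIPath (f r) 0 (n r))
    (h5 : ∀ r s, r < s → ∀ i j, 1 ≤ i → i ≤ n r → 1 ≤ j → j ≤ n s →
      f r i ≠ f s j ∧ ¬ G.Adj (f r i) (f s j)) : G.IsTripod T f n := by
  refine ⟨h1, h2, h3, h4, ?_, ?_⟩ <;> intro r s hrs i j a1 a2 a3 a4 <;>
    rcases lt_or_gt_of_ne hrs with h | h
  · exact (h5 r s h i j a1 a2 a3 a4).1
  · exact (h5 s r h j i a3 a4 a1 a2).1.symm
  · exact (h5 r s h i j a1 a2 a3 a4).2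
  · exact fun h' => (h5 s r h j i a3 a4 a1 a2).2 h'.symm

end SimpleGraph

namespace SimpleGraph

variable {V : Type*} {G : SimpleGraph V}

lemma exists_least_int {p : ℤ → Prop} {a b : ℤ} (hab : a ≤ b) (hb : p b) :
    ∃ i, a ≤ i ∧ i ≤ b ∧ p i ∧ ∀ j, a ≤ j → j < i → ¬ p j := by
  obtain ⟨i, ⟨h1, h2⟩, h3⟩ := Int.exists_least_of_bdd (P := fun i => a ≤ i ∧ p i)
    ⟨a, fun z hz => hz.1⟩ ⟨b, hab, hb⟩
  exact ⟨i, h1, h3 b ⟨hab, hb⟩, h2, fun j h4 h5 h6 => by have := h3 j ⟨h4, h6⟩; omega⟩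

lemma exists_greatest_int {p : ℤ → Prop} {a b : ℤ} (hab : a ≤ b) (ha : p a) :
    ∃ i, a ≤ i ∧ i ≤ b ∧ p i ∧ ∀ j, i < j → j ≤ b → ¬ p j := by
  obtain ⟨i, ⟨h1, h2⟩, h3⟩ := Int.exists_greatest_of_bdd (P := fun i => i ≤ b ∧ p i)
    ⟨b, fun z hz => hz.1⟩ ⟨a, hab, ha⟩
  exact ⟨i, h3 a ⟨hab, ha⟩, h1, h2, fun j h4 h5 h6 => by have := h3 j ⟨h5, h6⟩; omega⟩

/-- In a triangle-free graph, any three vertices of a connected set are the ends of a tripod. -/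
lemma exists_isTripod (h3 : G.CliqueFree 3) {T : Set V} (hT : G.IsConnOn T) (t : Fin 3 → V)
    (ht : ∀ r, t r ∈ T) : ∃ f n, G.IsTripod T f n ∧ ∀ r, f r (n r) = t r := by
  -- `p` is a shortest path from `t 0` to `t 1`, and `r` below a shortest path from `t 2` to `p`,
  -- reaching it at `p m`. By minimality only the last two vertices of `r` can be adjacent to a
  -- vertex of `p`.
  obtain ⟨p, k, hp, ⟨hp0, hpk⟩, hpi, -⟩ := exists_min_seq
    (R := fun x y => x = t 0 ∧ y = t 1) (by
      obtain ⟨f, n, h1, h2, h3⟩ := hT.exists_isSeq (ht 0) (ht 1)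
      exact ⟨f, n, h1, h2, h3⟩)
  have hk := hp.nonneg
  obtain ⟨r, l, hr, ⟨hr0, m, hm, hm', hrl⟩, hri, hrmin⟩ := exists_min_seq
    (T := T) (R := fun x y => x = t 2 ∧ ∃ i, 0 ≤ i ∧ i ≤ k ∧ y = p i) (by
      obtain ⟨f, n, h1, h2, h3⟩ := hT.exists_isSeq (ht 2) (ht 0)
      exact ⟨f, n, h1, h2, 0, le_rfl, hk, h3.trans hp0.symm⟩)
  have hl := hr.nonneg
  have hr1 : ∀ i j, 0 ≤ i → i < l → 0 ≤ j → j ≤ k → r i ≠ p j := by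
    intro i j h1 h2 h3 h4 heq
    have := hrmin _ _ (hr.sub le_rfl h1 h2.le) ⟨hr0, j, h3, h4, by simp [heq]⟩
    omega
  have hr2 : ∀ i j, 0 ≤ i → i < l - 1 → 0 ≤ j → j ≤ k → ¬ G.Adj (r i) (p j) := by
    intro i j h1 h2 h3 h4 hadj
    have h5 := hr.sub le_rfl h1 (show i ≤ l by omega)
    have := hrmin _ _ (h5.snoc (hp.mem j h3 h4) (by simpa using hadj))
      ⟨by simp [h1, hr0], j, h3, h4, by simp⟩
    omega
  -- If the last vertex of `r` before `p` has no neighbour on `p` but `p m`, then `p m` is the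
  -- centre. The condition `1 ≤ l` ensures that position `l - 1` belongs to `r`.
  by_cases hcase : ∀ j, 0 ≤ j → j ≤ k → 1 ≤ l → G.Adj (r (l - 1)) (p j) → j = m
  · refine ⟨![fun i => p (m - i), fun i => p (m + i), fun i => r (l - i)],
      ![m, k - m, l], IsTripod.of_lt ?_ ?_ ?_ ?_ ?_, ?_⟩
    · intro s
      fin_cases s <;> simp <;> omega
    · intro s i h1 h2
      fin_cases s <;> simp at h2 ⊢
      · exact hp.mem _ (by omega) (by omega)
      · exact hp.mem _ (by omega) (by omega)
      · exact hr.mem _ (by omega) (by omega)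
    · have : ∀ s, (![fun i => p (m - i), fun i => p (m + i), fun i => r (l - i)] :
          Fin 3 → ℤ → V) s 0 = p m := by
        intro s
        fin_cases s <;> simp [hrl]
      intro s s'
      rw [this, this]
    · intro s
      fin_cases s <;> simp
      · simpa using (hpi.mono (a' := 0) (b' := m) le_rfl hm').reverse m
      · intro i j h1 h2 h3
        have := hpi (m + i) (m + j) (by omega) (by omega) (by omega)
        refine ⟨this.1, this.2.trans ?_⟩
        omega
      · simpa using hri.reverse l
    · intro s s' hss i j h1 h2 h3 h4
      fin_cases s <;> fin_cases s' <;> simp at hss h2 h4 ⊢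
      · rw [hpi.inj (by omega) (by omega) (by omega) (by omega),
          hpi.adj_iff (by omega) (by omega) (by omega) (by omega)]
        omega
      · refine ⟨(hr1 _ _ (by omega) (by omega) (by omega) (by omega)).symm, fun hadj => ?_⟩
        rcases eq_or_ne j 1 with rfl | hj
        · have := hcase _ (by omega) (by omega) (by omega) hadj.symm
          omega
        · exact hr2 _ _ (by omega) (by omega) (by omega) (by omega) hadj.symm
      · refine ⟨(hr1 _ _ (by omega) (by omega) (by omega) (by omega)).symm, fun hadj => ?_⟩
        rcases eq_or_ne j 1 with rfl | hj
        · have := hcase _ (by omega) (by omega) (by omega) hadj.symm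
          omega
        · exact hr2 _ _ (by omega) (by omega) (by omega) (by omega) hadj.symm
    · intro s
      fin_cases s <;> simp [hp0, hpk, hr0]
  -- Otherwise `x = r (l - 1)` has several neighbours on `p` and becomes the centre: two legs leave
  -- through its first and last neighbours `p a` and `p b`, the third is the rest of `r`.
  · push Not at hcase
    obtain ⟨j1, hj1, hj1', hl1, hadj1, hne⟩ := hcase
    set x := r (l - 1) with hx
    have hxm : G.Adj x (p m) := by
      have := hr.adj (l - 1) (by omega) (by omega)
      rwa [show l - 1 + 1 = l by ring, hrl] at this
    obtain ⟨a, ha, hja, ha1, ha2⟩ := exists_least_int (p := fun j => G.Adj x (p j)) hj1 hadj1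
    obtain ⟨b, hjb, hb, hb1, hb2⟩ := exists_greatest_int (p := fun j => G.Adj x (p j)) hj1' hadj1
    have ham : a ≤ m := by
      by_contra h
      exact ha2 m hm (by omega) hxm
    have hbm : m ≤ b := by
      by_contra h
      exact hb2 m (by omega) hm' hxm
    -- This keeps the first two legs nonadjacent; it is where triangle-freeness enters.
    have hab : a + 2 ≤ b := by
      by_contra h
      have : b = a + 1 := by omega
      subst this
      exact h3.not_triangle ha1 (hpi.adj_succ ha (by omega)) hb1
    have hxp : ∀ j, 0 ≤ j → j ≤ k → x ≠ p j := fun j h1 h2 =>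
      hr1 _ _ (by omega) (by omega) h1 h2
    refine ⟨![fun i => if i = 0 then x else p (a + 1 - i),
      fun i => if i = 0 then x else p (b - 1 + i), fun i => r (l - 1 - i)],
      ![a + 1, k - b + 1, l - 1], IsTripod.of_lt ?_ ?_ ?_ ?_ ?_, ?_⟩
    · intro s
      fin_cases s <;> simp <;> omega
    · have hxT : x ∈ T := hr.mem _ (by omega) (by omega)
      intro s i h1 h2
      fin_cases s <;> simp at h2 ⊢
      · split_ifs
        · exact hxT
        · exact hp.mem _ (by omega) (by omega)
      · split_ifs
        · exact hxT
        · exact hp.mem _ (by omega) (by omega)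
      · exact hr.mem _ (by omega) (by omega)
    · have : ∀ s, (![fun i => if i = 0 then x else p (a + 1 - i),
          fun i => if i = 0 then x else p (b - 1 + i), fun i => r (l - 1 - i)] :
          Fin 3 → ℤ → V) s 0 = x := by
        intro s
        fin_cases s <;> simp [hx]
      intro s s'
      rw [this, this]
    · intro s
      fin_cases s <;> simp
      · intro i j h1 h2 h3
        beta_reduce
        rw [if_neg (show j ≠ 0 by omega)]
        split_ifs with hi
        · subst hi
          refine ⟨hxp _ (by omega) (by omega), ⟨fun hadj => ?_, ?_⟩⟩
          · by_contra h
            exact ha2 _ (by omega) (by omega) hadj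
          · rintro rfl
            simpa using ha1
        · rw [Ne, hpi.inj (by omega) (by omega) (by omega) (by omega),
            hpi.adj_iff (by omega) (by omega) (by omega) (by omega)]
          omega
      · intro i j h1 h2 h3
        beta_reduce
        rw [if_neg (show j ≠ 0 by omega)]
        split_ifs with hi
        · subst hi
          refine ⟨hxp _ (by omega) (by omega), ⟨fun hadj => ?_, ?_⟩⟩
          · by_contra h
            exact hb2 _ (by omega) (by omega) hadj
          · rintro rfl
            simpa using hb1
        · rw [Ne, hpi.inj (by omega) (by omega) (by omega) (by omega),
            hpi.adj_iff (by omega) (by omega) (by omega) (by omega)]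
          omega
      · simpa using (hri.mono (a' := 0) (b' := l - 1) le_rfl (by omega)).reverse (l - 1)
    · intro s s' hss i j h1 h2 h3 h4
      have hi0 : i ≠ 0 := by omega
      have hj0 : j ≠ 0 := by omega
      fin_cases s <;> fin_cases s' <;> simp [hi0, hj0] at hss h2 h4 ⊢
      · rw [hpi.inj (by omega) (by omega) (by omega) (by omega),
          hpi.adj_iff (by omega) (by omega) (by omega) (by omega)]
        omega
      · exact ⟨(hr1 _ _ (by omega) (by omega) (by omega) (by omega)).symm, fun hadj =>
          hr2 _ _ (by omega) (by omega) (by omega) (by omega) hadj.symm⟩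
      · exact ⟨(hr1 _ _ (by omega) (by omega) (by omega) (by omega)).symm, fun hadj =>
          hr2 _ _ (by omega) (by omega) (by omega) (by omega) hadj.symm⟩
    · intro s
      fin_cases s <;> simp [hr0]
      · rw [if_neg (by omega), hp0]
      · rw [if_neg (by omega), hpk]

end SimpleGraph

/-! ### A hole with an attached tripod -/

namespace SimpleGraph

variable {V : Type*} {G : SimpleGraph V}

/-- Corner 0 will be the centre of the tripod and corners 1, 2, 3 vertices of the hole; the six
paths are three legs and three arcs. -/
lemma fin_four_lt_cases : ∀ u v : Fin 4, u < v →
    (∃ r : Fin 3, u = 0 ∧ v = r.succ) ∨ (u = 1 ∧ v = 2) ∨ (u = 1 ∧ v = 3) ∨ (u = 2 ∧ v = 3) := by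
  decide

/-- A hole together with a tripod whose three ends send one edge each to the hole. -/
lemma not_isk4Free_of_isTripod {L : ℤ} {c : ℤ → V} (hc : G.IsHole L c) {T : Set V}
    {f : Fin 3 → ℤ → V} {n : Fin 3 → ℤ} (hf : G.IsTripod T f n)
    (hdisj : ∀ i, c i ∉ T) (a : Fin 3 → ℤ) (h01 : a 0 < a 1) (h12 : a 1 < a 2)
    (h20 : a 2 < a 0 + L) (hadj : ∀ r, G.Adj (c (a r)) (f r (n r)))
    (honly : ∀ i, ∀ x ∈ T, G.Adj (c i) x → ∃ r, c i = c (a r) ∧ x = f r (n r)) :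
    ¬ G.ISK4Free := by
  classical
  have hL := hc.four_le
  have hn := hf.nonneg
  have ha0 : ∀ r, a 0 ≤ a r ∧ a r < a 0 + L := by
    intro r
    fin_cases r <;> simp <;> omega
  -- Each leg is prolonged by its neighbour on the hole, so its length is `n r + 1` and positive
  -- even when the end of the tripod is its centre.
  let leg : Fin 3 → ℤ → V := fun r i => if i ≤ n r then f r i else c (a r)
  let b : Fin 4 → V := Fin.cons (f 0 0) (fun r => c (a r))
  -- Only the entries with `u < v` matter; the others are fillers. The arc from corner 1 to corner 3
  -- is read backwards from `a 0`.
  let F : Fin 4 → Fin 4 → ℤ → V :=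
    ![Fin.cons c leg, ![c, c, fun i => c (a 0 + i), fun i => c (a 0 - i)],
      ![c, c, c, fun i => c (a 1 + i)], fun _ => c]
  let N : Fin 4 → Fin 4 → ℤ :=
    ![Fin.cons 0 (fun r => n r + 1), ![0, 0, a 1 - a 0, a 0 + L - a 2],
      ![0, 0, 0, a 2 - a 1], fun _ => 0]
  have hN : ∀ u v, 0 ≤ N u v := by
    intro u v
    rcases lt_or_ge u v with h | h
    · rcases fin_four_lt_cases u v h with ⟨r, rfl, rfl⟩ | ⟨rfl, rfl⟩ | ⟨rfl, rfl⟩ | ⟨rfl, rfl⟩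
      · have := hn r
        simp [N]
        omega
      all_goals simp [N]; omega
    · fin_cases u <;> fin_cases v <;> first | (simp [N]; done) | (exfalso; revert h; decide)
  have hb0 : b 0 = f 0 0 := rfl
  have hbs : ∀ r : Fin 3, b r.succ = c (a r) := fun r => rfl
  have hF0 : ∀ r : Fin 3, F 0 r.succ = leg r := fun r => rfl
  have hN0 : ∀ r : Fin 3, N 0 r.succ = n r + 1 := fun r => rfl
  have hF12 : F 1 2 = fun i => c (a 0 + i) := rfl
  have hF13 : F 1 3 = fun i => c (a 0 - i) := rfl
  have hF23 : F 2 3 = fun i => c (a 1 + i) := rfl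
  have hN12 : N 1 2 = a 1 - a 0 := rfl
  have hN13 : N 1 3 = a 0 + L - a 2 := rfl
  have hN23 : N 2 3 = a 2 - a 1 := rfl
  have hb1 : b 1 = c (a 0) := rfl
  have hb2 : b 2 = c (a 1) := rfl
  have hb3 : b 3 = c (a 2) := rfl
  have hcen : ∀ r, f r 0 = b 0 := fun r => hf.center r 0
  have hcT : ∀ r i j, 0 ≤ j → j ≤ n r → c i ≠ f r j := by
    intro r i j h1 h2 heq
    exact hdisj i (heq ▸ hf.mem r j h1 h2)
  have hleg1 : ∀ r i, i ≤ n r → leg r i = f r i := fun r i h => if_pos h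
  have hleg2 : ∀ r, leg r (n r + 1) = c (a r) := fun r => if_neg (by omega)
  clear_value leg F N b
  have hba : ∀ r s, c (a r) = c (a s) ↔ r = s := by
    intro r s
    rw [hc.inj_window (a 0) (ha0 r).1 (ha0 r).2 (ha0 s).1 (ha0 s).2]
    fin_cases r <;> fin_cases s <;> simp <;> omega
  have hb0c : ∀ i, b 0 ≠ c i := by
    intro i h
    rw [hb0] at h
    exact hcT 0 i 0 le_rfl (hn 0) h.symm
  -- the vertices of the union
  have hpt : ∀ u v, u < v → ∀ i : ℤ, 0 ≤ i → i ≤ N u v →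
      (∃ r, u = 0 ∧ v = r.succ ∧ i ≤ n r ∧ F u v i = f r i) ∨
      (∃ r, u = 0 ∧ v = r.succ ∧ i = n r + 1 ∧ F u v i = c (a r)) ∨
      (∃ s, F u v i = c s ∧ ((u = 1 ∧ v = 2 ∧ a 0 ≤ s ∧ s ≤ a 1 ∧ s = a 0 + i) ∨
        (u = 1 ∧ v = 3 ∧ a 2 ≤ s ∧ s ≤ a 0 + L ∧ s = a 0 + L - i) ∨
        (u = 2 ∧ v = 3 ∧ a 1 ≤ s ∧ s ≤ a 2 ∧ s = a 1 + i))) := by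
    intro u v huv i h1 h2
    rcases fin_four_lt_cases u v huv with ⟨r, rfl, rfl⟩ | ⟨rfl, rfl⟩ | ⟨rfl, rfl⟩ | ⟨rfl, rfl⟩
    · rw [hN0] at h2
      rcases lt_or_ge (n r) i with h | h
      · have : i = n r + 1 := by omega
        subst this
        exact .inr (.inl ⟨r, rfl, rfl, rfl, by rw [hF0, hleg2]⟩)
      · exact .inl ⟨r, rfl, rfl, h, by rw [hF0, hleg1 r i h]⟩
    · refine .inr (.inr ⟨a 0 + i, by rw [hF12], .inl ⟨rfl, rfl, ?_⟩⟩)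
      omega
    · refine .inr (.inr ⟨a 0 + L - i, ?_, .inr (.inl ⟨rfl, rfl, ?_⟩)⟩)
      · rw [hF13]
        exact (hc.eq_of_add (by ring)).symm
      · omega
    · refine .inr (.inr ⟨a 1 + i, by rw [hF23], .inr (.inr ⟨rfl, rfl, ?_⟩)⟩)
      omega
  have hFL : c (a 0 + L) = c (a 0) := hc.periodic _
  intro hfree
  refine not_isk4Free_of_seqs b F (fun u v => (N u v).toNat) ?_ ?_ ?_ ?_ ?_ ?_ ?_ ?_ hfree
  · intro u v huv
    induction u using Fin.cases with
    | zero =>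
      induction v using Fin.cases with
      | zero => rfl
      | succ s => rw [hbs] at huv; exact absurd huv (hb0c _)
    | succ r =>
      induction v using Fin.cases with
      | zero => rw [hbs] at huv; exact absurd huv.symm (hb0c _)
      | succ s =>
        rw [hbs, hbs, hba] at huv
        rw [huv]
  · intro u v huv
    rcases fin_four_lt_cases u v huv with ⟨r, rfl, rfl⟩ | ⟨rfl, rfl⟩ | ⟨rfl, rfl⟩ | ⟨rfl, rfl⟩
    · rw [hF0, hleg1 r 0 (hn r), hcen]
    · simp [hF12, hb1]
    · simp [hF13, hb1]
    · simp [hF23, hb2]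
  · intro u v huv
    rw [Int.toNat_of_nonneg (hN u v)]
    rcases fin_four_lt_cases u v huv with ⟨r, rfl, rfl⟩ | ⟨rfl, rfl⟩ | ⟨rfl, rfl⟩ | ⟨rfl, rfl⟩
    · rw [hF0, hN0, hleg2, hbs]
    · simp [hF12, hN12, hb2]
    · rw [hF13, hN13, hb3]
      exact (hc.eq_of_add (by ring)).symm
    · simp [hF23, hN23, hb3]
  · intro u v huv i h1 h2
    rw [Int.toNat_of_nonneg (hN u v)] at h2
    rcases fin_four_lt_cases u v huv with ⟨r, rfl, rfl⟩ | ⟨rfl, rfl⟩ | ⟨rfl, rfl⟩ | ⟨rfl, rfl⟩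
    · rw [hN0] at h2
      rw [hF0, hleg1 r i (by omega)]
      rcases lt_or_ge i (n r) with h | h
      · rw [hleg1 r _ (by omega)]
        exact (hf.ipath r).adj_succ h1 h
      · have : i = n r := by omega
        rw [this, hleg2]
        exact (hadj r).symm
    · rw [hF12]
      have := hc.adj_succ (a 0 + i)
      rwa [add_assoc] at this
    · rw [hF13]
      have := (hc.adj_succ (a 0 - (i + 1))).symm
      rwa [show a 0 - (i + 1) + 1 = a 0 - i by ring] at this
    · rw [hF23]
      have := hc.adj_succ (a 1 + i)
      rwa [add_assoc] at this
  · intro u v huv i j h1 h2 h3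
    rw [Int.toNat_of_nonneg (hN u v)] at h3
    rcases fin_four_lt_cases u v huv with ⟨r, rfl, rfl⟩ | ⟨rfl, rfl⟩ | ⟨rfl, rfl⟩ | ⟨rfl, rfl⟩
    · rw [hN0] at h3
      rw [hF0, hleg1 r i (by omega)]
      rcases lt_or_ge (n r) j with h | h
      · rw [show j = n r + 1 by omega, hleg2]
        exact (hcT _ _ _ h1 (by omega)).symm
      · rw [hleg1 r j h]
        exact (hf.ipath r i j h1 h2 h).1
    · rw [hF12]
      exact hc.ne _ _ (by omega) (by omega)
    · rw [hF13]
      exact (hc.ne _ _ (by omega) (by omega)).symm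
    · rw [hF23]
      exact hc.ne _ _ (by omega) (by omega)
  · intro u v huv i h1 h2 x hx
    rw [Int.toNat_of_nonneg (hN u v)] at h2
    rcases hpt u v huv i h1 h2 with ⟨r, rfl, rfl, h3, h4⟩ | ⟨r, rfl, rfl, h3, h4⟩ | ⟨s, h3, h4⟩
    · rw [h4] at hx
      induction x using Fin.cases with
      | zero => exact .inl rfl
      | succ s => rw [hbs] at hx; exact absurd hx (hcT _ _ _ h1 h3)
    · rw [h4] at hx
      induction x using Fin.cases with
      | zero => exact .inl rfl
      | succ s =>
        rw [hbs, hba] at hx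
        exact .inr (by rw [hx])
    · rw [h3] at hx
      induction x using Fin.cases with
      | zero => exact absurd hx (hb0c _)
      | succ r =>
        rw [hbs] at hx
        -- The arcs leave the window starting at `a 0` only at `a 0 + L`, which is corner 1 again.
        have hs : s = a 0 + L ∨ s < a 0 + L := by omega
        rcases hs with rfl | hs
        · rw [hFL, hba] at hx
          subst hx
          left
          have : u = 1 := by omega
          rw [this]
          rfl
        · rw [hc.inj_window (a 0) (ha0 r).1 (ha0 r).2 (by omega) hs] at hx
          rcases h4 with ⟨rfl, rfl, h4⟩ | ⟨rfl, rfl, h4⟩ | ⟨rfl, rfl, h4⟩ <;>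
            fin_cases r <;> simp at hx ⊢ <;> first | decide | omega
  · intro u v u' v' huv huv' hne i j h1 h2 h3 h4 heq
    rw [Int.toNat_of_nonneg (hN _ _)] at h2 h4
    rcases hpt u v huv i h1 h2 with ⟨r, rfl, rfl, h5, h6⟩ | ⟨r, rfl, rfl, h5, h6⟩ | ⟨s, h5, h6⟩
    · rcases hpt u' v' huv' j h3 h4 with
        ⟨r', rfl, rfl, h5', h6'⟩ | ⟨r', rfl, rfl, h5', h6'⟩ | ⟨s', h5', h6'⟩
      · by_cases hi : i = 0
        · exact ⟨0, by rw [h6, hi, hcen]⟩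
        · by_cases hj : j = 0
          · exact ⟨0, by rw [heq, h6', hj, hcen]⟩
          · rw [h6, h6'] at heq
            refine absurd heq (hf.ne r r' ?_ i j (by omega) h5 (by omega) h5')
            rintro rfl
            exact hne rfl
      · exact ⟨r'.succ, by rw [heq, h6', hbs]⟩
      · rw [h6, h5'] at heq
        exact absurd heq.symm (hcT _ _ _ h1 h5)
    · exact ⟨r.succ, by rw [h6, hbs]⟩
    · rcases hpt u' v' huv' j h3 h4 with
        ⟨r', rfl, rfl, h5', h6'⟩ | ⟨r', rfl, rfl, h5', h6'⟩ | ⟨s', h5', h6'⟩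
      · rw [h6', h5] at heq
        exact absurd heq (hcT _ _ _ h3 h5')
      · exact ⟨r'.succ, by rw [heq, h6', hbs]⟩
      · have e : s = a 0 + L ∨ s < a 0 + L := by omega
        rcases e with rfl | hs
        · exact ⟨1, by rw [h5, hFL, hb1]⟩
        · have e : s' = a 0 + L ∨ s' < a 0 + L := by omega
          rcases e with rfl | hs'
          · exact ⟨1, by rw [heq, h5', hFL, hb1]⟩
          · rw [h5, h5', hc.inj_window (a 0) (by omega) hs (by omega) hs'] at heq
            subst heq
            rw [h5]
            -- Within the window, different arcs share only their ends.
            have : s = a 0 ∨ s = a 1 ∨ s = a 2 := by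
              rcases h6 with ⟨rfl, rfl, h6⟩ | ⟨rfl, rfl, h6⟩ | ⟨rfl, rfl, h6⟩ <;>
                rcases h6' with ⟨rfl, rfl, h6'⟩ | ⟨rfl, rfl, h6'⟩ | ⟨rfl, rfl, h6'⟩ <;>
                first | exact absurd rfl hne | omega
            rcases this with rfl | rfl | rfl
            · exact ⟨1, hb1⟩
            · exact ⟨2, hb2⟩
            · exact ⟨3, hb3⟩
  · intro u v u' v' huv huv' i j h1 h2 h3 h4 hxy
    simp only [Int.toNat_of_nonneg (hN _ _)] at h2 h4 ⊢
    generalize hx : F u v i = x at *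
    generalize hy : F u' v' j = y at *
    have hsymm : ∀ x y : V, (∃ p q, p < q ∧ ∃ k, 0 ≤ k ∧ k < N p q ∧
        (F p q k = y ∧ F p q (k + 1) = x ∨ F p q k = x ∧ F p q (k + 1) = y)) →
        ∃ p q, p < q ∧ ∃ k, 0 ≤ k ∧ k < N p q ∧
        (F p q k = x ∧ F p q (k + 1) = y ∨ F p q k = y ∧ F p q (k + 1) = x) := by
      rintro x y ⟨p, q, hpq, k, hk, hk', h⟩
      exact ⟨p, q, hpq, k, hk, hk', h.symm⟩
    have hlegedge : ∀ r k, 0 ≤ k → k < n r + 1 → ∀ x y, leg r k = x → leg r (k + 1) = y →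
        ∃ p q, p < q ∧ ∃ k, 0 ≤ k ∧ k < N p q ∧
        (F p q k = x ∧ F p q (k + 1) = y ∨ F p q k = y ∧ F p q (k + 1) = x) := by
      intro r k hk hk' x y h5 h6
      refine ⟨0, r.succ, Fin.succ_pos r, k, hk, by rw [hN0]; exact hk', .inl ?_⟩
      rw [hF0]
      exact ⟨h5, h6⟩
    have hcross : ∀ s y, y ∈ T → G.Adj (c s) y →
        ∃ p q, p < q ∧ ∃ k, 0 ≤ k ∧ k < N p q ∧
        (F p q k = c s ∧ F p q (k + 1) = y ∨ F p q k = y ∧ F p q (k + 1) = c s) := by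
      intro s y hyT h5
      obtain ⟨r, h6, h7⟩ := honly s y hyT h5
      apply hsymm
      exact hlegedge r (n r) (hn r) (by omega) _ _ (by rw [hleg1 r _ le_rfl, h7])
        (by rw [hleg2, h6])
    have hTT : ∀ r r' i j, 0 ≤ i → i ≤ n r → 0 ≤ j → j ≤ n r' → G.Adj (f r i) (f r' j) →
        ∃ p q, p < q ∧ ∃ k, 0 ≤ k ∧ k < N p q ∧
        (F p q k = f r i ∧ F p q (k + 1) = f r' j ∨
          F p q k = f r' j ∧ F p q (k + 1) = f r i) := by
      have hsame : ∀ r i j, 0 ≤ i → i ≤ n r → 0 ≤ j → j ≤ n r → G.Adj (f r i) (f r j) →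
          ∃ p q, p < q ∧ ∃ k, 0 ≤ k ∧ k < N p q ∧
          (F p q k = f r i ∧ F p q (k + 1) = f r j ∨
            F p q k = f r j ∧ F p q (k + 1) = f r i) := by
        intro r i j a1 a2 a3 a4 a5
        rcases ((hf.ipath r).adj_iff a1 a2 a3 a4).1 a5 with rfl | rfl
        · exact hlegedge r i a1 (by omega) _ _ (hleg1 r _ a2) (hleg1 r _ a4)
        · exact hsymm _ _ (hlegedge r j a3 (by omega) _ _ (hleg1 r _ a4) (hleg1 r _ a2))
      intro r r' i j a1 a2 a3 a4 a5
      -- The centre lies on every leg, so an edge at the centre can be read on the leg of its other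
      -- end.
      by_cases hi : i = 0
      · subst hi
        rw [hf.center r r'] at a5 ⊢
        exact hsame r' 0 j le_rfl (hn r') a3 a4 a5
      · by_cases hj : j = 0
        · subst hj
          rw [hf.center r' r] at a5 ⊢
          exact hsame r i 0 a1 a2 le_rfl (hn r) a5
        · by_cases hr : r = r'
          · subst hr
            exact hsame r i j a1 a2 a3 a4 a5
          · exact absurd a5 (hf.not_adj r r' hr i j (by omega) a2 (by omega) a4)
    have hcc1 : ∀ s, a 0 ≤ s → s < a 0 + L →
        ∃ p q, p < q ∧ ∃ k, 0 ≤ k ∧ k < N p q ∧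
        (F p q k = c s ∧ F p q (k + 1) = c (s + 1) ∨
          F p q k = c (s + 1) ∧ F p q (k + 1) = c s) := by
      intro s a1 a2
      rcases lt_or_ge s (a 1) with a3 | a3
      · refine ⟨1, 2, by decide, s - a 0, by omega, by omega, .inl ?_⟩
        rw [hF12]
        exact ⟨congrArg c (by ring), congrArg c (by ring)⟩
      rcases lt_or_ge s (a 2) with a4 | a4
      · refine ⟨2, 3, by decide, s - a 1, by omega, by omega, .inl ?_⟩
        rw [hF23]
        exact ⟨congrArg c (by ring), congrArg c (by ring)⟩
      · refine ⟨1, 3, by decide, a 0 + L - (s + 1), by omega, by omega, .inr ?_⟩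
        rw [hF13]
        exact ⟨(hc.eq_of_add (by ring)).symm, (hc.eq_of_add (by ring)).symm⟩
    have hcc : ∀ s s', G.Adj (c s) (c s') →
        ∃ p q, p < q ∧ ∃ k, 0 ≤ k ∧ k < N p q ∧
        (F p q k = c s ∧ F p q (k + 1) = c s' ∨
          F p q k = c s' ∧ F p q (k + 1) = c s) := by
      intro s s' hss
      obtain ⟨z, z1, z2, z3, -⟩ := periodic_exists hc.periodic (by omega) s (a 0)
      obtain ⟨z', z1', z2', z3', -⟩ := periodic_exists hc.periodic (by omega) s' (a 0)
      rw [← z3, ← z3'] at hss ⊢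
      rcases (hc.adj_window (a 0) z1 z2 z1' z2').1 hss with h | h | h | h
      · rw [h]
        exact hcc1 z z1 z2
      · rw [h]
        exact hsymm _ _ (hcc1 z' z1' z2')
      · have e1 : z = a 0 := by omega
        have e2 : c z = c (z' + 1) := (hc.eq_of_add (by omega)).symm
        rw [e2]
        exact hsymm _ _ (hcc1 z' z1' z2')
      · have e2 : c z' = c (z + 1) := (hc.eq_of_add (by omega)).symm
        rw [e2]
        exact hcc1 z z1 z2
    have hclass : ∀ u v, u < v → ∀ i, 0 ≤ i → i ≤ N u v →
        (∃ r i', 0 ≤ i' ∧ i' ≤ n r ∧ F u v i = f r i') ∨ ∃ s, F u v i = c s := by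
      intro u v huv i h1 h2
      rcases hpt u v huv i h1 h2 with ⟨r, -, -, h5, h6⟩ | ⟨r, -, -, h5, h6⟩ | ⟨s, h5, h6⟩
      · exact .inl ⟨r, i, h1, h5, h6⟩
      · exact .inr ⟨_, h6⟩
      · exact .inr ⟨s, h5⟩
    rcases hclass u v huv i h1 h2 with ⟨r, i', b1, b2, b3⟩ | ⟨s, b3⟩ <;>
      rcases hclass u' v' huv' j h3 h4 with ⟨r', j', b1', b2', b3'⟩ | ⟨s', b3'⟩ <;>
      rw [hx] at b3 <;> rw [hy] at b3' <;> subst b3 b3'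
    · exact hTT r r' i' j' b1 b2 b1' b2' hxy
    · exact hsymm _ _ (hcross s' _ (hf.mem r i' b1 b2) hxy.symm)
    · exact hcross s _ (hf.mem r' j' b1' b2') hxy
    · exact hcc s s' hxy

end SimpleGraph

/-! ### The three-edge obstruction -/

namespace SimpleGraph

variable {V : Type*} {G : SimpleGraph V}

/-- A tripod inside `T` with ends `t₁`, `t₂`, `t₃` inherits from `T` that there are no further edges
to the hole. The `tᵢ` need not be distinct. Here the three ends on the hole come in cyclic order. -/
lemma no_three_edges_aux (h3 : G.CliqueFree 3) (hI : G.ISK4Free) {L : ℤ} {c : ℤ → V}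
    (hc : G.IsHole L c) {T : Set V} (hT : G.IsConnOn T) {a₁ a₂ a₃ : ℤ} {t₁ t₂ t₃ : V}
    (h12 : a₁ < a₂) (h23 : a₂ < a₃) (h31 : a₃ < a₁ + L) (m₁ : t₁ ∈ T) (m₂ : t₂ ∈ T)
    (m₃ : t₃ ∈ T) (e₁ : G.Adj (c a₁) t₁) (e₂ : G.Adj (c a₂) t₂) (e₃ : G.Adj (c a₃) t₃)
    (hdisj : ∀ i, c i ∉ T)
    (honly : ∀ i, ∀ t ∈ T, G.Adj (c i) t → (c i = c a₁ ∧ t = t₁) ∨ (c i = c a₂ ∧ t = t₂) ∨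
      (c i = c a₃ ∧ t = t₃)) : False := by
  obtain ⟨f, n, hf, hft⟩ := exists_isTripod h3 hT ![t₁, t₂, t₃] (by
    intro r
    fin_cases r <;> simpa)
  refine not_isk4Free_of_isTripod hc hf hdisj ![a₁, a₂, a₃] h12 h23 h31 ?_ ?_ hI
  · intro r
    rw [hft]
    fin_cases r <;> simpa
  · intro i x hx hadj
    rcases honly i x hx hadj with h | h | h
    · exact ⟨0, by rw [hft]; exact h⟩
    · exact ⟨1, by rw [hft]; exact h⟩
    · exact ⟨2, by rw [hft]; exact h⟩

/-- In a triangle-free graph without induced subdivision of `K₄`, a connected set cannot send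
exactly three edges to a hole, if these have distinct ends in the hole. -/
theorem no_three_edges (h3 : G.CliqueFree 3) (hI : G.ISK4Free) {H T : Set V}
    (hH : G.IsHoleSet H) (hT : G.IsConnOn T) {a₁ a₂ a₃ t₁ t₂ t₃ : V}
    (h12 : a₁ ≠ a₂) (h13 : a₁ ≠ a₃) (h23 : a₂ ≠ a₃) (l₁ : a₁ ∈ H) (l₂ : a₂ ∈ H) (l₃ : a₃ ∈ H)
    (m₁ : t₁ ∈ T) (m₂ : t₂ ∈ T) (m₃ : t₃ ∈ T) (e₁ : G.Adj a₁ t₁) (e₂ : G.Adj a₂ t₂)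
    (e₃ : G.Adj a₃ t₃) (hdisj : ∀ x ∈ H, x ∉ T)
    (honly : ∀ x ∈ H, ∀ t ∈ T, G.Adj x t →
      (x = a₁ ∧ t = t₁) ∨ (x = a₂ ∧ t = t₂) ∨ (x = a₃ ∧ t = t₃)) : False := by
  obtain ⟨L, c, hc, rfl⟩ := hH
  obtain ⟨i₁, rfl⟩ := l₁
  obtain ⟨i₂, p1, p2, rfl⟩ := hc.exists_window l₂ i₁
  obtain ⟨i₃, q1, q2, rfl⟩ := hc.exists_window l₃ i₁
  have n2 : i₂ ≠ i₁ := fun h => h12 (by rw [h])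
  have n3 : i₃ ≠ i₁ := fun h => h13 (by rw [h])
  have n23 : i₂ ≠ i₃ := fun h => h23 (by rw [h])
  -- The two possible cyclic orders differ by exchanging the roles of the second and third edge.
  rcases lt_or_gt_of_ne n23 with h | h
  · exact no_three_edges_aux h3 hI hc hT (by omega) h (by omega) m₁ m₂ m₃ e₁ e₂ e₃
      (fun i => hdisj _ ⟨i, rfl⟩) (fun i t ht hadj => honly _ ⟨i, rfl⟩ t ht hadj)
  · exact no_three_edges_aux h3 hI hc hT (by omega) h (by omega) m₁ m₃ m₂ e₁ e₃ e₂
      (fun i => hdisj _ ⟨i, rfl⟩) (fun i t ht hadj => by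
        have := honly _ ⟨i, rfl⟩ t ht hadj
        tauto)

/-- The connected set is a single vertex here. In particular a hub always has at least four
neighbours on its rim. -/
lemma ncard_neighborSet_ne_three (h3 : G.CliqueFree 3) (hI : G.ISK4Free) {H : Set V}
    (hH : G.IsHoleSet H) {v : V} (hv : v ∉ H) : (G.neighborSet v ∩ H).ncard ≠ 3 := by
  intro h
  obtain ⟨x, y, z, hxy, hxz, hyz, hs⟩ := Set.ncard_eq_three.1 h
  have hx : x ∈ G.neighborSet v ∩ H := by rw [hs]; simp
  have hy : y ∈ G.neighborSet v ∩ H := by rw [hs]; simp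
  have hz : z ∈ G.neighborSet v ∩ H := by rw [hs]; simp
  refine no_three_edges h3 hI hH (isConnOn_singleton v) hxy hxz hyz hx.2 hy.2 hz.2 rfl rfl rfl
    hx.1.symm hy.1.symm hz.1.symm ?_ ?_
  · rintro w hw rfl
    exact hv hw
  · rintro w hw t rfl hadj
    have : w ∈ ({x, y, z} : Set V) := hs ▸ ⟨hadj.symm, hw⟩
    simpa using this

lemma image_neg_sub (f : ℤ → V) (s a b : ℤ) :
    (fun i => f (s - i)) '' Set.Icc (s - b) (s - a) = f '' Set.Icc a b := by
  ext x
  constructor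
  · rintro ⟨i, ⟨h1, h2⟩, rfl⟩
    exact ⟨s - i, ⟨by omega, by omega⟩, rfl⟩
  · rintro ⟨i, ⟨h1, h2⟩, rfl⟩
    refine ⟨s - i, ⟨by omega, by omega⟩, ?_⟩
    beta_reduce
    congr 1
    ring

/-- Two induced paths, the first vertices joined by an edge as well as the last ones, form a
hole. -/
lemma isHoleSet_parallel {f g : ℤ → V} {a b d e : ℤ} (hf : G.IsIPath f a b)
    (hg : G.IsIPath g d e) (hab : a ≤ b) (hde : d ≤ e) (hlen : 2 ≤ (b - a) + (e - d))
    (hne : ∀ i j, a ≤ i → i ≤ b → d ≤ j → j ≤ e → f i ≠ g j)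
    (hadj : ∀ i j, a ≤ i → i ≤ b → d ≤ j → j ≤ e →
      (G.Adj (f i) (g j) ↔ (i = a ∧ j = d) ∨ (i = b ∧ j = e))) :
    G.IsHoleSet (f '' Set.Icc a b ∪ g '' Set.Icc d e) := by
  have := isHoleSet_glue (d := 0 - e) (e := 0 - d) hf (hg.reverse 0) hab (by omega) (by omega)
    (fun i j h1 h2 h3 h4 => hne _ _ h1 h2 (by omega) (by omega)) (by
      intro i j h1 h2 h3 h4
      rw [hadj _ _ h1 h2 (by omega) (by omega)]
      omega)
  rwa [image_neg_sub] at this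

/-- A path with a vertex adjacent to both ends and nothing else on the path. -/
lemma isHoleSet_insert {f : ℤ → V} {a b : ℤ} {v : V} (hf : G.IsIPath f a b) (hab : a + 2 ≤ b)
    (hne : ∀ i, a ≤ i → i ≤ b → f i ≠ v)
    (hadj : ∀ i, a ≤ i → i ≤ b → (G.Adj v (f i) ↔ i = a ∨ i = b)) :
    G.IsHoleSet (insert v (f '' Set.Icc a b)) := by
  have := isHoleSet_glue (g := fun _ => v) (d := 0) (e := 0) hf (isIPath_self _ _) (by omega)
    le_rfl (by omega) (fun i j h1 h2 _ _ => hne i h1 h2) (by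
      intro i j h1 h2 h3 h4
      rw [G.adj_comm, hadj i h1 h2]
      omega)
  convert this using 1
  ext x
  simp [eq_comm]

/-! ### Wheels -/

/-- The hole `c` of length `L` and a vertex `v` outside with at least three neighbours on it. -/
structure IsWheel (G : SimpleGraph V) (L : ℤ) (c : ℤ → V) (v : V) : Prop where
  hole : G.IsHole L c
  not_mem : v ∉ Set.range c
  three_le : 3 ≤ (G.neighborSet v ∩ Set.range c).ncard

section Wheel

variable {L : ℤ} {c : ℤ → V} {v : V}

lemma IsHole.isHoleSet (h : G.IsHole L c) : G.IsHoleSet (Set.range c) := ⟨L, c, h, rfl⟩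

lemma IsHole.finite_range (h : G.IsHole L c) : (Set.range c).Finite := by
  have := h.four_le
  rw [range_eq_image_window h.periodic (by omega) 0]
  exact (Set.finite_Ico _ _).image _

lemma three_le_ncard_of_mem {s : Set V} (hs : s.Finite) {x y z : V} (hx : x ∈ s) (hy : y ∈ s)
    (hz : z ∈ s) (hxy : x ≠ y) (hxz : x ≠ z) (hyz : y ≠ z) : 3 ≤ s.ncard := by
  have : ({x, y, z} : Set V).ncard = 3 := Set.ncard_eq_three.2 ⟨x, y, z, hxy, hxz, hyz, rfl⟩
  rw [← this]
  refine Set.ncard_le_ncard ?_ hs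
  rintro w (rfl | rfl | rfl) <;> assumption

lemma range_reflect (c : ℤ → V) (s : ℤ) : Set.range (fun i => c (s - i)) = Set.range c := by
  ext x
  constructor
  · rintro ⟨i, rfl⟩
    exact ⟨_, rfl⟩
  · rintro ⟨i, rfl⟩
    exact ⟨s - i, by simp⟩

lemma IsWheel.reflect (h : G.IsWheel L c v) (s : ℤ) : G.IsWheel L (fun i => c (s - i)) v := by
  refine ⟨h.hole.reflect s, ?_, ?_⟩ <;> rw [range_reflect]
  · exact h.not_mem
  · exact h.three_le

/-- Every turn around a wheel meets a spoke that is none of three given ones. -/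
lemma IsWheel.exists_spoke (h : G.IsWheel L c v) (h3 : G.CliqueFree 3) (hI : G.ISK4Free)
    (r w₁ w₂ w₃ : ℤ) :
    ∃ u, r ≤ u ∧ u < r + L ∧ G.Adj v (c u) ∧ u ≠ w₁ ∧ u ≠ w₂ ∧ u ≠ w₃ := by
  classical
  by_contra! hno
  -- There are at least four spokes, so three positions cannot account for all of them.
  have h4 := ncard_neighborSet_ne_three h3 hI h.hole.isHoleSet h.not_mem
  have h5 := h.three_le
  have : (G.neighborSet v ∩ Set.range c).ncard ≤ 3 := by
    have hsub : G.neighborSet v ∩ Set.range c ⊆ (({c w₁, c w₂, c w₃} : Finset V) : Set V) := by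
      rintro x ⟨hx1, hx2⟩
      obtain ⟨u, hu1, hu2, rfl⟩ := h.hole.exists_window hx2 r
      have := hno u hu1 hu2 hx1
      simp only [Finset.coe_insert, Finset.coe_singleton, Set.mem_insert_iff,
        Set.mem_singleton_iff]
      by_cases e1 : u = w₁
      · simp [e1]
      · by_cases e2 : u = w₂
        · simp [e2]
        · simp [this e1 e2]
    refine (Set.ncard_le_ncard hsub (Finset.finite_toSet _)).trans ?_
    rw [Set.ncard_coe_finset]
    exact Finset.card_le_three
  omega

lemma IsWheel.exists_next (h : G.IsWheel L c v) (h3 : G.CliqueFree 3) (hI : G.ISK4Free)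
    (r : ℤ) : ∃ e, r ≤ e ∧ e < r + L ∧ G.Adj v (c e) ∧ ∀ u, r ≤ u → u < e → ¬ G.Adj v (c u) := by
  -- The excluded positions are irrelevant here, and the zeros are arbitrary.
  obtain ⟨u, h1, h2, h4, -⟩ := h.exists_spoke h3 hI r 0 0 0
  obtain ⟨e, e1, e2, e3, e4⟩ := exists_least_int (p := fun u => G.Adj v (c u)) h1 h4
  exact ⟨e, e1, by omega, e3, e4⟩

lemma IsWheel.exists_prev (h : G.IsWheel L c v) (h3 : G.CliqueFree 3) (hI : G.ISK4Free)
    (r : ℤ) : ∃ e, r - L < e ∧ e ≤ r ∧ G.Adj v (c e) ∧ ∀ u, e < u → u ≤ r → ¬ G.Adj v (c u) := by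
  obtain ⟨u, h1, h2, h4, -⟩ := h.exists_spoke h3 hI (r - L + 1) 0 0 0
  obtain ⟨e, e1, e2, e3, e4⟩ := exists_greatest_int (p := fun u => G.Adj v (c u))
    (show u ≤ r by omega) h4
  exact ⟨e, by omega, e2, e3, e4⟩

/-- Consecutive rim vertices with a common neighbour would form a triangle. This gap provides most
of the strict inequalities on lengths and distances below. -/
lemma IsHole.spoke_gap (h : G.IsHole L c) (h3 : G.CliqueFree 3) {q : V} {i j : ℤ}
    (hi : G.Adj q (c i)) (hj : G.Adj q (c j)) (hij : i < j) : i + 2 ≤ j := by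
  by_contra hlt
  have : j = i + 1 := by omega
  subst this
  exact h3.not_triangle hi (h.adj_succ i) hj

lemma IsWheel.ne (h : G.IsWheel L c v) (i : ℤ) : c i ≠ v := fun h' => h.not_mem ⟨i, h'⟩

/-- The hub and a sector form a hole. -/
lemma IsWheel.isHoleSet_sector (h : G.IsWheel L c v) (h3 : G.CliqueFree 3) {s e : ℤ}
    (hs : G.Adj v (c s)) (he : G.Adj v (c e)) (hse : s < e) (hse' : e < s + L)
    (hno : ∀ u, s < u → u < e → ¬ G.Adj v (c u)) :
    G.IsHoleSet (insert v (c '' Set.Icc s e)) := by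
  have h4 := h.hole.spoke_gap h3 hs he hse
  have h5 := h.hole.spoke_gap h3 he (j := s + L) (by rwa [h.hole.periodic]) hse'
  refine isHoleSet_insert (h.hole.isIPath (by omega)) h4 (fun i _ _ => h.ne i) ?_
  intro i h1 h2
  constructor
  · intro hadj
    by_contra hne
    push Not at hne
    exact hno i (by omega) (by omega) hadj
  · rintro (rfl | rfl) <;> assumption

/-- A connected set attached to a sector by two edges from one vertex, and reaching another
spoke away from the sector. -/
lemma IsWheel.no_sector_two (h : G.IsWheel L c v) (h3 : G.CliqueFree 3) (hI : G.ISK4Free)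
    {s e i j z g : ℤ} {Q : Set V} {x y : V}
    (hs : G.Adj v (c s)) (he : G.Adj v (c e)) (hno : ∀ u, s < u → u < e → ¬ G.Adj v (c u))
    (hsi : s ≤ i) (hij : i < j) (hje : j ≤ e) (hez : e + 1 < z) (hzg : z ≤ g)
    (hgs : g < s + L) (hg : G.Adj v (c g)) (hg' : ∀ u, z ≤ u → u < g → ¬ G.Adj v (c u))
    (hQ : G.IsConnOn Q) (hx : x ∈ Q) (hy : y ∈ Q) (hxi : G.Adj x (c i)) (hxj : G.Adj x (c j))
    (hyz : G.Adj y (c z)) (hvQ : v ∉ Q) (hcQ : ∀ t, s ≤ t → t ≤ e → c t ∉ Q)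
    (hvadj : ∀ w ∈ Q, ¬ G.Adj v w)
    (honly : ∀ w ∈ Q, ∀ t, s ≤ t → t ≤ e → G.Adj w (c t) → w = x ∧ (t = i ∨ t = j)) :
    False := by
  have hc := h.hole
  have hgs' := hc.spoke_gap h3 hg (j := s + L) (by rwa [hc.periodic]) hgs
  -- The hole is the hub with the sector. `Q` is prolonged along the rim from `z` to the first spoke
  -- `g`, whose edge to the hub is the third edge. The gaps `e + 1 < z` and `g + 2 ≤ s + L` keep
  -- this arc away from the sector.
  refine no_three_edges h3 hI (h.isHoleSet_sector h3 hs he (by omega) (by omega) hno)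
    (hQ.union (hc.isConnOn_arc z g) hy ⟨z, ⟨le_rfl, hzg⟩, rfl⟩ hyz)
    (a₁ := c i) (a₂ := c j) (a₃ := v) (t₁ := x) (t₂ := x) (t₃ := c g)
    (hc.ne _ _ hij (by omega)) (h.ne _) (h.ne _)
    (.inr ⟨i, ⟨hsi, by omega⟩, rfl⟩) (.inr ⟨j, ⟨by omega, hje⟩, rfl⟩) (.inl rfl)
    (.inl hx) (.inl hx) (.inr ⟨g, ⟨hzg, le_rfl⟩, rfl⟩) hxi.symm hxj.symm hg ?_ ?_
  · rintro w (rfl | ⟨t, ⟨t1, t2⟩, rfl⟩) (hw | ⟨u, ⟨u1, u2⟩, hu⟩)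
    · exact hvQ hw
    · exact h.ne u hu
    · exact hcQ t t1 t2 hw
    · exact hc.ne t u (by omega) (by omega) hu.symm
  · rintro w (rfl | ⟨t, ⟨t1, t2⟩, rfl⟩) b (hb | ⟨u, ⟨u1, u2⟩, rfl⟩) hadj
    · exact absurd hadj (hvadj b hb)
    · rcases lt_or_eq_of_le u2 with hu | rfl
      · exact absurd hadj (hg' u u1 hu)
      · exact .inr (.inr ⟨rfl, rfl⟩)
    · rcases honly b hb t t1 t2 hadj.symm with ⟨rfl, rfl | rfl⟩
      · exact .inl ⟨rfl, rfl⟩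
      · exact .inr (.inl ⟨rfl, rfl⟩)
    · rw [hc.adj t u (by omega) (by omega)] at hadj
      omega

/-- A path closing an arc with exactly two spokes, none at its ends, and such that the next spoke
after the arc is not attached to the path. -/
lemma IsWheel.no_arc_two (h : G.IsWheel L c v) (h3 : G.CliqueFree 3) (hI : G.ISK4Free)
    {i j u₁ u₂ e k : ℤ} {p : ℤ → V} (hk : 0 ≤ k) (hp : G.IsIPath p 0 k)
    (hu : i < u₁) (huu : u₁ < u₂) (huj : u₂ < j) (hje : j < e) (hei : e + 1 < i + L)
    (hu₁ : G.Adj v (c u₁)) (hu₂ : G.Adj v (c u₂)) (he : G.Adj v (c e))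
    (hfeet : ∀ u, i ≤ u → u ≤ j → G.Adj v (c u) → u = u₁ ∨ u = u₂)
    (hpv : ∀ t, 0 ≤ t → t ≤ k → p t ≠ v ∧ ¬ G.Adj v (p t))
    (hpc : ∀ t s, 0 ≤ t → t ≤ k → i ≤ s → s ≤ e → p t ≠ c s)
    (hpa : ∀ t s, 0 ≤ t → t ≤ k → i ≤ s → s ≤ e →
      (G.Adj (p t) (c s) ↔ (t = 0 ∧ s = i) ∨ (t = k ∧ s = j))) : False := by
  have hc := h.hole
  -- The path closes the arc to a hole. The hub sends two edges to it, and the rim from `j + 1` to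
  -- the spoke `e`, which is connected to the hub, sends the edge at `c j`.
  have hH := isHoleSet_parallel hp (hc.isIPath (a := i) (b := j) (by omega)) hk (by omega)
    (by omega) (fun t s h1 h2 h4 h5 => hpc t s h1 h2 h4 (by omega))
    (fun t s h1 h2 h4 h5 => hpa t s h1 h2 h4 (by omega))
  refine no_three_edges h3 hI hH
    ((hc.isConnOn_arc (j + 1) e).insert (x := v) (y := c e) ⟨e, ⟨by omega, le_rfl⟩, rfl⟩ he)
    (a₁ := c u₁) (a₂ := c u₂) (a₃ := c j) (t₁ := v) (t₂ := v) (t₃ := c (j + 1))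
    (hc.ne _ _ huu (by omega)) (hc.ne _ _ (by omega) (by omega)) (hc.ne _ _ huj (by omega))
    (.inr ⟨u₁, ⟨by omega, by omega⟩, rfl⟩) (.inr ⟨u₂, ⟨by omega, by omega⟩, rfl⟩)
    (.inr ⟨j, ⟨by omega, by omega⟩, rfl⟩) (.inl rfl) (.inl rfl)
    (.inr ⟨j + 1, ⟨by omega, by omega⟩, rfl⟩) hu₁.symm hu₂.symm (hc.adj_succ j) ?_ ?_
  · rintro x (⟨t, ⟨t1, t2⟩, rfl⟩ | ⟨s, ⟨s1, s2⟩, rfl⟩) (hx | ⟨w, ⟨w1, w2⟩, hw⟩)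
    · exact (hpv t t1 t2).1 hx
    · exact hpc t w t1 t2 (by omega) w2 hw.symm
    · exact h.ne s hx
    · exact hc.ne s w (by omega) (by omega) hw.symm
  · rintro x (⟨t, ⟨t1, t2⟩, rfl⟩ | ⟨s, ⟨s1, s2⟩, rfl⟩) y (rfl | ⟨w, ⟨w1, w2⟩, rfl⟩) hadj
    · exact absurd hadj.symm (hpv t t1 t2).2
    · rw [hpa t w t1 t2 (by omega) w2] at hadj
      omega
    · rcases hfeet s s1 s2 hadj.symm with rfl | rfl
      · exact .inl ⟨rfl, rfl⟩
      · exact .inr (.inl ⟨rfl, rfl⟩)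
    · rw [hc.adj s w (by omega) (by omega)] at hadj
      obtain ⟨rfl, rfl⟩ : s = j ∧ w = j + 1 := by omega
      exact .inr (.inr ⟨rfl, rfl⟩)

/-- A vertex closing an arc with exactly one spoke in its interior, and not attached to the
rest of the two sectors involved. -/
lemma IsWheel.no_arc_one (h : G.IsWheel L c v) (h3 : G.CliqueFree 3) (hI : G.ISK4Free)
    {i j s w e : ℤ} {q : V} (hsi : s ≤ i) (hiw : i < w) (hwj : w < j) (hje : j ≤ e)
    (hes : e < s + L) (hs : G.Adj v (c s)) (hw : G.Adj v (c w)) (he : G.Adj v (c e))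
    (hsw : ∀ u, s < u → u < e → G.Adj v (c u) → u = w) (hqv : q ≠ v) (hqv' : ¬ G.Adj v q)
    (hqc : ∀ t, c t ≠ q) (hqa : ∀ t, s ≤ t → t ≤ e → (G.Adj q (c t) ↔ t = i ∨ t = j)) :
    False := by
  have hc := h.hole
  have hes' := hc.spoke_gap h3 he (j := s + L) (by rwa [hc.periodic]) hes
  -- `q` closes the arc to a hole. The connected set is the hub with the remains of the two sectors;
  -- it sends one edge to each end of the arc and the spoke at `w`.
  have hH := isHoleSet_insert (hc.isIPath (a := i) (b := j) (by omega)) (by omega)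
    (fun t _ _ => hqc t) (fun t h1 h2 => hqa t (by omega) (by omega))
  have hsw1 := hc.spoke_gap h3 hs hw (by omega)
  have hsw2 := hc.spoke_gap h3 hw he (by omega)
  -- the connected sets attached to the two ends of the arc
  obtain ⟨A, t₁, hA, hvA, ht₁, hAi, hA'⟩ : ∃ A t₁, G.IsConnOn A ∧ v ∈ A ∧ t₁ ∈ A ∧
      G.Adj (c i) t₁ ∧ ∀ x ∈ A, (x = v ∧ (t₁ = v ↔ s = i)) ∨ ∃ t, s ≤ t ∧ t < i ∧ x = c t ∧
        t₁ = c (i - 1) := by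
    -- If the arc starts at the spoke `s`, nothing remains of the sector on this side, and the hub
    -- itself sends the edge to `c i`.
    rcases lt_or_eq_of_le hsi with hlt | rfl
    · refine ⟨insert v (c '' Set.Icc s (i - 1)), c (i - 1), (hc.isConnOn_arc s (i - 1)).insert
        ⟨s, ⟨le_rfl, by omega⟩, rfl⟩ hs, .inl rfl, .inr ⟨i - 1, ⟨by omega, le_rfl⟩, rfl⟩, ?_, ?_⟩
      · have := (hc.adj_succ (i - 1)).symm
        rwa [sub_add_cancel] at this
      · rintro x (rfl | ⟨t, ⟨t1, t2⟩, rfl⟩)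
        · exact .inl ⟨rfl, ⟨fun h' => absurd h' (h.ne _), fun h' => by omega⟩⟩
        · exact .inr ⟨t, t1, by omega, rfl, rfl⟩
    · exact ⟨{v}, v, isConnOn_singleton v, rfl, rfl, hs.symm, fun x hx => .inl ⟨hx, by simp⟩⟩
  obtain ⟨B, t₂, hB, hvB, ht₂, hBj, hB'⟩ : ∃ B t₂, G.IsConnOn B ∧ v ∈ B ∧ t₂ ∈ B ∧
      G.Adj (c j) t₂ ∧ ∀ x ∈ B, (x = v ∧ (t₂ = v ↔ e = j)) ∨ ∃ t, j < t ∧ t ≤ e ∧ x = c t ∧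
        t₂ = c (j + 1) := by
    rcases lt_or_eq_of_le hje with hlt | rfl
    · refine ⟨insert v (c '' Set.Icc (j + 1) e), c (j + 1),
        (hc.isConnOn_arc (j + 1) e).insert ⟨e, ⟨by omega, le_rfl⟩, rfl⟩ he, .inl rfl,
        .inr ⟨j + 1, ⟨le_rfl, by omega⟩, rfl⟩, hc.adj_succ j, ?_⟩
      rintro x (rfl | ⟨t, ⟨t1, t2⟩, rfl⟩)
      · exact .inl ⟨rfl, ⟨fun h' => absurd h' (h.ne _), fun h' => by omega⟩⟩
      · exact .inr ⟨t, by omega, t2, rfl, rfl⟩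
    · exact ⟨{v}, v, isConnOn_singleton v, rfl, rfl, he.symm, fun x hx => .inl ⟨hx, by simp⟩⟩
  have hvadj : ∀ t, i ≤ t → t ≤ j → G.Adj (c t) v →
      (t = i ∧ t₁ = v) ∨ (t = j ∧ t₂ = v) ∨ t = w := by
    intro t h1 h2 hadj
    rcases hA' v hvA with ⟨-, hi⟩ | ⟨_, -, -, h5, -⟩
    swap
    · exact absurd h5.symm (h.ne _)
    rcases hB' v hvB with ⟨-, hj⟩ | ⟨_, -, -, h5, -⟩
    swap
    · exact absurd h5.symm (h.ne _)
    by_cases e1 : t = s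
    · exact .inl ⟨by omega, hi.2 (by omega)⟩
    by_cases e2 : t = e
    · exact .inr (.inl ⟨by omega, hj.2 (by omega)⟩)
    exact .inr (.inr (hsw t (by omega) (by omega) hadj.symm))
  refine no_three_edges h3 hI hH (hA.union_of_mem hB hvA hvB)
    (a₁ := c i) (a₂ := c j) (a₃ := c w) (t₁ := t₁) (t₂ := t₂) (t₃ := v)
    (hc.ne _ _ (by omega) (by omega)) (hc.ne _ _ (by omega) (by omega))
    (hc.ne _ _ hwj (by omega)).symm
    (.inr ⟨i, ⟨by omega, by omega⟩, rfl⟩) (.inr ⟨j, ⟨by omega, by omega⟩, rfl⟩)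
    (.inr ⟨w, ⟨by omega, by omega⟩, rfl⟩) (.inl ht₁) (.inr ht₂) (.inl hvA) hAi hBj hw.symm ?_ ?_
  · rintro x (rfl | ⟨t, ⟨t1, t2⟩, rfl⟩) (hx | hx)
    · rcases hA' _ hx with ⟨h1, -⟩ | ⟨t, -, -, h1, -⟩
      · exact hqv h1
      · exact hqc t h1.symm
    · rcases hB' _ hx with ⟨h1, -⟩ | ⟨t, -, -, h1, -⟩
      · exact hqv h1
      · exact hqc t h1.symm
    · rcases hA' _ hx with ⟨h1, -⟩ | ⟨u, u1, u2, h1, -⟩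
      · exact h.ne _ h1
      · exact hc.ne u t (by omega) (by omega) h1.symm
    · rcases hB' _ hx with ⟨h1, -⟩ | ⟨u, u1, u2, h1, -⟩
      · exact h.ne _ h1
      · exact hc.ne t u (by omega) (by omega) h1
  · rintro x (rfl | ⟨t, ⟨t1, t2⟩, rfl⟩) y (hy | hy) hadj
    · rcases hA' _ hy with ⟨rfl, -⟩ | ⟨u, u1, u2, rfl, -⟩
      · exact absurd hadj.symm hqv'
      · rw [hqa u (by omega) (by omega)] at hadj
        omega
    · rcases hB' _ hy with ⟨rfl, -⟩ | ⟨u, u1, u2, rfl, -⟩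
      · exact absurd hadj.symm hqv'
      · rw [hqa u (by omega) (by omega)] at hadj
        omega
    · rcases hA' _ hy with ⟨rfl, -⟩ | ⟨u, u1, u2, rfl, h6⟩
      · rcases hvadj t t1 t2 hadj with ⟨rfl, h5⟩ | ⟨rfl, h5⟩ | rfl
        · exact .inl ⟨rfl, h5.symm⟩
        · exact .inr (.inl ⟨rfl, h5.symm⟩)
        · exact .inr (.inr ⟨rfl, rfl⟩)
      · rw [G.adj_comm, hc.adj u t (by omega) (by omega)] at hadj
        obtain ⟨rfl, rfl⟩ : u = i - 1 ∧ t = i := by omega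
        exact .inl ⟨rfl, h6.symm⟩
    · rcases hB' _ hy with ⟨rfl, -⟩ | ⟨u, u1, u2, rfl, h6⟩
      · rcases hvadj t t1 t2 hadj with ⟨rfl, h5⟩ | ⟨rfl, h5⟩ | rfl
        · exact .inl ⟨rfl, h5.symm⟩
        · exact .inr (.inl ⟨rfl, h5.symm⟩)
        · exact .inr (.inr ⟨rfl, rfl⟩)
      · rw [hc.adj t u (by omega) (by omega)] at hadj
        obtain ⟨rfl, rfl⟩ : u = j + 1 ∧ t = j := by omega
        exact .inr (.inl ⟨rfl, h6.symm⟩)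

end Wheel

end SimpleGraph

/-! ### Wheels of minimum length are proper -/

namespace SimpleGraph

variable {V : Type*} {G : SimpleGraph V}

section Wheel

variable {L : ℤ} {c : ℤ → V} {v : V}

/-- No sector of the wheel with hub `v` contains both `c i` and `c j`. -/
def Far (G : SimpleGraph V) (L : ℤ) (c : ℤ → V) (v : V) (i j : ℤ) : Prop :=
  (∃ u, i < u ∧ u < j ∧ G.Adj v (c u)) ∧ ∃ u, j < u ∧ u < i + L ∧ G.Adj v (c u)

/-- A wheel is proper if every vertex outside that is not adjacent to the hub has at most two
neighbours on the rim, and these belong to one sector. -/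
def IsProper (G : SimpleGraph V) (L : ℤ) (c : ℤ → V) (v : V) : Prop :=
  ∀ q, q ≠ v → ¬ G.Adj v q → q ∉ Set.range c →
    (∀ i j, i < j → j < i + L → G.Adj q (c i) → G.Adj q (c j) → ¬ Far G L c v i j) ∧
    (G.neighborSet q ∩ Set.range c).ncard ≤ 2

lemma IsHole.exists_eq_add_mul (hc : G.IsHole L c) {i j : ℤ} (h : c i = c j) :
    ∃ k, i = j + k * L := by
  have := hc.four_le
  obtain ⟨z, z1, z2, z3, k, z4⟩ := periodic_exists hc.periodic (by omega) i j
  refine ⟨-k, ?_⟩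
  have : z = j := (hc.inj_window j z1 z2 le_rfl (by omega)).1 (by rw [z3, h])
  linarith

lemma IsHole.far_shift (hc : G.IsHole L c) {i j : ℤ} (k : ℤ) (h : Far G L c v i j) :
    Far G L c v (i + k * L) (j + k * L) := by
  obtain ⟨⟨u, u1, u2, u3⟩, w, w1, w2, w3⟩ := h
  exact ⟨⟨u + k * L, by omega, by omega, by rwa [periodic_add_mul hc.periodic]⟩,
    w + k * L, by omega, by omega, by rwa [periodic_add_mul hc.periodic]⟩

lemma IsHole.far_swap (hc : G.IsHole L c) {i j : ℤ} (h : Far G L c v i j) :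
    Far G L c v j (i + L) := by
  obtain ⟨⟨u, u1, u2, u3⟩, w, w1, w2, w3⟩ := h
  exact ⟨⟨w, by omega, by omega, w3⟩, u + L, by omega, by omega, by rwa [hc.periodic]⟩

lemma IsHole.far_congr_aux (hc : G.IsHole L c) {i j i' j' : ℤ} (hij : i < j) (hji : j < i + L)
    (hij' : i' < j') (hji' : j' < i' + L) (hi : c i' = c i) (hj : c j' = c j)
    (h : Far G L c v i' j') : Far G L c v i j := by
  obtain ⟨k, rfl⟩ := hc.exists_eq_add_mul hi
  have h' := hc.far_shift (-k) h
  have e1 : i + k * L + -k * L = i := by ring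
  have e2 : j' + -k * L = j := by
    have h2 : c (j' + -k * L) = c j := by rw [periodic_add_mul hc.periodic, hj]
    have h5 : -k * L = -(k * L) := by ring
    exact (hc.inj_window i (by omega) (by omega) hij.le hji).1 h2
  rwa [e1, e2] at h'

/-- Being far depends on the two rim vertices only, neither on their order nor on the integers
representing them. -/
lemma IsHole.far_congr (hc : G.IsHole L c) {i j i' j' : ℤ} (hij : i < j) (hji : j < i + L)
    (hij' : i' < j') (hji' : j' < i' + L)
    (h : (c i' = c i ∧ c j' = c j) ∨ (c i' = c j ∧ c j' = c i))
    (hf : Far G L c v i' j') : Far G L c v i j := by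
  rcases h with ⟨h1, h2⟩ | ⟨h1, h2⟩
  · exact hc.far_congr_aux hij hji hij' hji' h1 h2 hf
  · exact hc.far_congr_aux hij hji (i' := j') (j' := i' + L) (by omega) (by omega) h2
      (by rw [hc.periodic, h1]) (hc.far_swap hf)

/-- In a wheel of minimum length, a vertex nonadjacent to the hub has at most two neighbours in
each sector. -/
lemma IsWheel.no_three_in_sector (h : G.IsWheel L c v) (h3 : G.CliqueFree 3) (hI : G.ISK4Free)
    (hmin : ∀ L' c' v', G.IsWheel L' c' v' → L ≤ L') {q : V} (hqv : q ≠ v)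
    (hqc : ∀ t, c t ≠ q) {s e i j l : ℤ} (hs : G.Adj v (c s))
    (he : G.Adj v (c e)) (hse : s < e) (hse' : e < s + L)
    (hno : ∀ u, s < u → u < e → ¬ G.Adj v (c u)) (hsi : s ≤ i) (hij : i < j) (hjl : j < l)
    (hle : l ≤ e) (hi : G.Adj q (c i)) (hj : G.Adj q (c j)) (hl : G.Adj q (c l)) : False := by
  have hc := h.hole
  have g1 := hc.spoke_gap h3 hs he hse
  have g2 := hc.spoke_gap h3 he (j := s + L) (by rwa [hc.periodic]) hse'
  -- The sector with the hub is the rim of a wheel with hub `q`; a further spoke outside the sector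
  -- makes it shorter than `L`.
  obtain ⟨u, u1, u2, u3, u4, u5, -⟩ := h.exists_spoke h3 hI s s e e
  have hue : e < u := by
    by_contra hue
    exact hno u (by omega) (by omega) u3
  have g3 := hc.spoke_gap h3 he u3 hue
  have g4 := hc.spoke_gap h3 u3 (j := s + L) (by rwa [hc.periodic]) (by omega)
  obtain ⟨c', hc', -, -, hr⟩ := exists_isHole_glue (g := fun _ => v) (d := 0) (e := 0)
    (hc.isIPath (a := s) (b := e) (by omega)) (isIPath_self _ _) hse.le le_rfl (by omega)
    (fun t _ _ _ _ _ => h.ne t) (by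
      intro t t' h1 h2 h4 h5
      rw [G.adj_comm]
      constructor
      · intro hadj
        by_contra hne
        exact hno t (by omega) (by omega) hadj
      · rintro (⟨rfl, -⟩ | ⟨rfl, -⟩) <;> assumption)
  have hmem : ∀ t, s ≤ t → t ≤ e → c t ∈ Set.range c' := by
    intro t h1 h2
    rw [hr]
    exact .inl ⟨t, ⟨h1, h2⟩, rfl⟩
  have hw : G.IsWheel (e - s + (0 - 0) + 2) c' q := by
    refine ⟨hc', ?_, three_le_ncard_of_mem (hc'.finite_range.inter_of_right _)
      ⟨hi, hmem i hsi (by omega)⟩ ⟨hj, hmem j (by omega) (by omega)⟩ ⟨hl, hmem l (by omega) hle⟩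
      (hc.ne _ _ hij (by omega)) (hc.ne _ _ (by omega) (by omega)) (hc.ne _ _ hjl (by omega))⟩
    rw [hr]
    rintro (⟨t, -, ht⟩ | ⟨t, -, ht⟩)
    · exact hqc t ht
    · exact hqv ht.symm
  have := hmin _ _ _ hw
  omega

/-- In a wheel of minimum length, the neighbours of a vertex nonadjacent to the hub that are
beyond a sector containing two neighbours are next to the ends of that sector. -/
lemma IsWheel.eq_of_sector_two (h : G.IsWheel L c v) (h3 : G.CliqueFree 3) (hI : G.ISK4Free)
    {q : V} (hqv : q ≠ v) (hqv' : ¬ G.Adj v q) (hqc : ∀ t, c t ≠ q) {s e i j z g : ℤ}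
    (hs : G.Adj v (c s)) (he : G.Adj v (c e)) (hno : ∀ u, s < u → u < e → ¬ G.Adj v (c u))
    (hsi : s ≤ i) (hij : i < j) (hje : j ≤ e) (hi : G.Adj q (c i)) (hj : G.Adj q (c j))
    (honly : ∀ t, s ≤ t → t ≤ e → G.Adj q (c t) → t = i ∨ t = j)
    (hz : G.Adj q (c z)) (hez : e + 1 < z) (hzg : z ≤ g) (hgs : g < s + L)
    (hg : G.Adj v (c g)) : False := by
  -- From `c z` the rim is followed to the first spoke, as `no_sector_two` requires; its connected
  -- set is `q` alone.
  obtain ⟨g', g1, g2, g3, g4⟩ := exists_least_int (p := fun u => G.Adj v (c u)) hzg hg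
  exact h.no_sector_two h3 hI hs he hno hsi hij hje hez g1 (by omega) g3 g4
    (isConnOn_singleton q) rfl rfl hi hj hz (by rintro rfl; exact hqv rfl)
    (fun t _ _ ht => hqc t ht) (by rintro w rfl; exact hqv')
    (by rintro w rfl t h1 h2 hadj; exact ⟨rfl, honly t h1 h2 hadj⟩)

/-- By `eq_of_sector_two`, used in both directions around the rim, any other neighbour of `q` is at
`e + 1` or `s + L - 1`. Exactly three neighbours are impossible, so both occur. Then `q` closes the
arc between them to a hole shorter than `L`. If it has three spokes, it is the rim of a shorter
wheel; if it has two, the hub and `c e` send exactly three edges to it. -/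
lemma IsWheel.eq_of_two_in_sector (h : G.IsWheel L c v) (h3 : G.CliqueFree 3)
    (hI : G.ISK4Free) (hmin : ∀ L' c' v', G.IsWheel L' c' v' → L ≤ L') {q : V} (hqv : q ≠ v)
    (hqv' : ¬ G.Adj v q) (hqc : ∀ t, c t ≠ q) {s e i j : ℤ} (hs : G.Adj v (c s))
    (he : G.Adj v (c e)) (hse' : e < s + L)
    (hno : ∀ u, s < u → u < e → ¬ G.Adj v (c u)) (hsi : s ≤ i) (hij : i < j)
    (hje : j ≤ e) (hi : G.Adj q (c i)) (hj : G.Adj q (c j)) :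
    ∀ z, s ≤ z → z < s + L → G.Adj q (c z) → z = i ∨ z = j := by
  classical
  have hc := h.hole
  have honly : ∀ t, s ≤ t → t ≤ e → G.Adj q (c t) → t = i ∨ t = j := by
    intro t h1 h2 hadj
    by_contra hne
    push Not at hne
    have hse : s < e := by omega
    rcases lt_or_gt_of_ne hne.1 with h4 | h4
    · exact h.no_three_in_sector h3 hI hmin hqv hqc hs he hse hse' hno h1 h4 hij hje hadj hi hj
    · rcases lt_or_gt_of_ne hne.2 with h5 | h5
      · exact h.no_three_in_sector h3 hI hmin hqv hqc hs he hse hse' hno hsi h4 h5 hje hi hadj hj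
      · exact h.no_three_in_sector h3 hI hmin hqv hqc hs he hse hse' hno hsi hij h5 h2 hi hj hadj
  have hsL : G.Adj v (c (s + L)) := by rwa [hc.periodic]
  have g1 := hc.spoke_gap h3 hs he (by omega)
  have g2 := hc.spoke_gap h3 he hsL hse'
  -- two further spokes
  obtain ⟨u₁, a1, a2, a3, a4, a5, -⟩ := h.exists_spoke h3 hI s s e e
  obtain ⟨u₂, b1, b2, b3, b4, b5, b6⟩ := h.exists_spoke h3 hI s s e u₁
  have c1 : e < u₁ := by
    by_contra hlt
    exact hno _ (by omega) (by omega) a3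
  have c2 : e < u₂ := by
    by_contra hlt
    exact hno _ (by omega) (by omega) b3
  wlog hu : u₁ < u₂ generalizing u₁ u₂
  · exact this u₂ b1 b2 b3 b4 b5 u₁ a1 a2 a3 a4 a5 (Ne.symm b6) c2 c1 (by omega)
  have hup : ∀ z, e + 1 < z → z ≤ u₂ → ¬ G.Adj q (c z) := fun z z1 z2 hz =>
    h.eq_of_sector_two h3 hI hqv hqv' hqc hs he hno hsi hij hje hi hj honly hz z1 z2 b2 b3
  have hdown : ∀ z, u₁ ≤ z → z < s + L - 1 → ¬ G.Adj q (c z) := by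
    intro z z1 z2 hz
    -- The reflection exchanges the ends of the sector; subtracting `L` moves `z` and `u₁` to the
    -- side that becomes the far one.
    refine (h.reflect (s + e)).eq_of_sector_two h3 hI (s := s) (e := e) (i := s + e - j)
      (j := s + e - i) (z := s + e - (z - L)) (g := s + e - (u₁ - L)) hqv hqv'
      (fun t => hqc _) ?_ ?_ ?_ (by omega) (by omega) (by omega) ?_ ?_ ?_ ?_ (by omega)
      (by omega) (by omega) ?_
    · rwa [show s + e - s = e by ring]
    · rwa [show s + e - e = s by ring]
    · intro u d1 d2
      exact hno _ (by omega) (by omega)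
    · rwa [show s + e - (s + e - j) = j by ring]
    · rwa [show s + e - (s + e - i) = i by ring]
    · intro t d1 d2 d3
      have := honly _ (by omega) (by omega) d3
      omega
    · rw [show s + e - (s + e - (z - L)) = z - L by ring, ← hc.periodic]
      rwa [sub_add_cancel]
    · rw [show s + e - (s + e - (u₁ - L)) = u₁ - L by ring, ← hc.periodic]
      rwa [sub_add_cancel]
  have hcand : ∀ z, s ≤ z → z < s + L → G.Adj q (c z) →
      z = i ∨ z = j ∨ z = e + 1 ∨ z = s + L - 1 := by
    intro z z1 z2 hz
    by_cases hze : z ≤ e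
    · have := honly z z1 hze hz
      omega
    · by_contra hne
      rcases le_or_gt z u₂ with d | d
      · exact hup z (by omega) d hz
      · exact hdown z (by omega) (by omega) hz
  have g3 := hc.spoke_gap h3 he a3 c1
  have g4 := hc.spoke_gap h3 a3 b3 hu
  have g5 := hc.spoke_gap h3 b3 hsL b2
  have hthree : ∀ z, s ≤ z → z < s + L → z ≠ i → z ≠ j → G.Adj q (c z) →
      ¬ ∀ t, s ≤ t → t < s + L → G.Adj q (c t) → t = i ∨ t = j ∨ t = z := by
    intro z z1 z2 z3 z4 z5 hall
    refine ncard_neighborSet_ne_three h3 hI hc.isHoleSet (v := q) (fun ⟨t, ht⟩ => hqc t ht)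
      (Set.ncard_eq_three.2 ⟨c i, c j, c z, hc.ne _ _ hij (by omega), ?_, ?_, ?_⟩)
    · rw [Ne, hc.inj_window s (by omega) (by omega) z1 z2]
      exact fun h' => z3 h'.symm
    · rw [Ne, hc.inj_window s (by omega) (by omega) z1 z2]
      exact fun h' => z4 h'.symm
    · ext x
      constructor
      · rintro ⟨d1, d2⟩
        obtain ⟨t, t1, t2, rfl⟩ := hc.exists_window d2 s
        rcases hall t t1 t2 d1 with rfl | rfl | rfl <;> simp
      · rintro (rfl | rfl | rfl)
        · exact ⟨hi, _, rfl⟩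
        · exact ⟨hj, _, rfl⟩
        · exact ⟨z5, _, rfl⟩
  by_contra! hex
  -- A single neighbour besides `c i` and `c j` would give exactly three.
  have hboth : G.Adj q (c (e + 1)) ∧ G.Adj q (c (s + L - 1)) := by
    obtain ⟨z, z1, z2, z3, z4, z5⟩ := hex
    have hz' := hthree z z1 z2 z4 z5 z3
    push Not at hz'
    obtain ⟨t, t1, t2, t3, t4, t5, t6⟩ := hz'
    rcases hcand z z1 z2 z3 with e1 | e1 | e1 | e1 <;>
      rcases hcand t t1 t2 t3 with e2 | e2 | e2 | e2 <;> try omega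
    · exact ⟨e1 ▸ z3, e2 ▸ t3⟩
    · exact ⟨e2 ▸ t3, e1 ▸ z3⟩
  obtain ⟨hq1, hq2⟩ := hboth
  have hqe : ¬ G.Adj q (c e) := fun h' => h3.not_triangle h' (hc.adj_succ e) hq1
  have hqarc : ∀ t, e + 1 ≤ t → t ≤ s + L - 1 → (G.Adj q (c t) ↔ t = e + 1 ∨ t = s + L - 1) := by
    intro t t1 t2
    constructor
    · intro hadj
      have := hcand t (by omega) (by omega) hadj
      omega
    · rintro (rfl | rfl) <;> assumption
  obtain ⟨c', hc', -, -, hr⟩ := exists_isHole_glue (g := fun _ => q) (d := 0) (e := 0)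
    (hc.isIPath (a := e + 1) (b := s + L - 1) (by omega)) (isIPath_self _ _) (by omega) le_rfl
    (by omega) (fun t _ _ _ _ _ => hqc t) (by
      intro t t' d1 d2 d3 d4
      rw [G.adj_comm, hqarc t d1 d2]
      omega)
  have hmem : ∀ t, e + 1 ≤ t → t ≤ s + L - 1 → c t ∈ Set.range c' := by
    intro t d1 d2
    rw [hr]
    exact .inl ⟨t, ⟨d1, d2⟩, rfl⟩
  by_cases hthird : ∃ u, e + 1 ≤ u ∧ u ≤ s + L - 1 ∧ G.Adj v (c u) ∧ u ≠ u₁ ∧ u ≠ u₂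
  · obtain ⟨u, d1, d2, d3, d4, d5⟩ := hthird
    have hw : G.IsWheel ((s + L - 1) - (e + 1) + (0 - 0) + 2) c' v := by
      refine ⟨hc', ?_, three_le_ncard_of_mem (hc'.finite_range.inter_of_right _)
        ⟨a3, hmem u₁ (by omega) (by omega)⟩ ⟨b3, hmem u₂ (by omega) (by omega)⟩
        ⟨d3, hmem u d1 d2⟩
        (hc.ne _ _ hu (by omega)) ?_ ?_⟩
      · rw [hr]
        rintro (⟨t, -, ht⟩ | ⟨t, -, ht⟩)
        · exact h.ne t ht
        · exact hqv ht
      · rw [Ne, hc.inj_window s a1 a2 (by omega) (by omega)]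
        exact fun h' => d4 h'.symm
      · rw [Ne, hc.inj_window s b1 b2 (by omega) (by omega)]
        exact fun h' => d5 h'.symm
    have := hmin _ _ _ hw
    omega
  · push Not at hthird
    -- The vertex `c e` is not adjacent to `q`, since `q` is adjacent to `c (e + 1)`.
    refine no_three_edges h3 hI hc'.isHoleSet (isConnOn_pair he) (a₁ := c u₁) (a₂ := c u₂)
      (a₃ := c (e + 1)) (t₁ := v) (t₂ := v) (t₃ := c e) (hc.ne _ _ hu (by omega))
      (hc.ne _ _ (by omega) (by omega)).symm (hc.ne _ _ (by omega) (by omega)).symm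
      (hmem _ (by omega) (by omega)) (hmem _ (by omega) (by omega)) (hmem _ (by omega) (by omega))
      (by simp) (by simp) (by simp) a3.symm b3.symm (hc.adj_succ e).symm ?_ ?_
    · rw [hr]
      rintro x (⟨t, ⟨t1, t2⟩, rfl⟩ | ⟨t, -, rfl⟩) (hx | hx)
      · exact h.ne t hx
      · exact hc.ne e t (by omega) (by omega) hx.symm
      · exact hqv hx
      · exact hqc e hx.symm
    · rw [hr]
      rintro x (⟨t, ⟨t1, t2⟩, rfl⟩ | ⟨t, -, rfl⟩) y (rfl | rfl) hadj
      · by_cases e1 : t = u₁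
        · exact .inl ⟨by rw [e1], rfl⟩
        · exact .inr (.inl ⟨by rw [hthird t t1 t2 hadj.symm e1], rfl⟩)
      · rw [G.adj_comm, hc.adj e t (by omega) (by omega)] at hadj
        obtain rfl : t = e + 1 := by omega
        exact .inr (.inr ⟨rfl, rfl⟩)
      · exact absurd hadj.symm hqv'
      · exact absurd hadj hqe

/-- If no sector of a wheel of minimum length contains two neighbours of `q`, then consecutive
neighbours of `q` on the rim are separated by at least two spokes. -/
lemma IsWheel.exists_two_spokes (h : G.IsWheel L c v) (h3 : G.CliqueFree 3) (hI : G.ISK4Free)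
    {q : V} (hqv : q ≠ v) (hqv' : ¬ G.Adj v q) (hqc : ∀ t, c t ≠ q)
    (hsec : ∀ s e i j, G.Adj v (c s) → G.Adj v (c e) → e < s + L →
      (∀ u, s < u → u < e → ¬ G.Adj v (c u)) → s ≤ i → i < j → j ≤ e → G.Adj q (c i) →
      ¬ G.Adj q (c j)) {i j : ℤ} (hij : i < j) (hi : G.Adj q (c i))
    (hj : G.Adj q (c j)) : ∃ u₁ u₂, i < u₁ ∧ u₁ < u₂ ∧ u₂ < j ∧ G.Adj v (c u₁) ∧
      G.Adj v (c u₂) := by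
  have hc := h.hole
  by_contra! hno
  -- It suffices to treat consecutive neighbours of `q`: the first one after `i` may replace `j`.
  wlog hcons : ∀ t, i < t → t < j → ¬ G.Adj q (c t) generalizing j
  · push Not at hcons
    obtain ⟨t, t1, t2, t3⟩ := hcons
    obtain ⟨t', a1, a2, a3, a4⟩ := exists_least_int (p := fun t => G.Adj q (c t))
      (show i + 1 ≤ t by omega) t3
    exact this (by omega) a3 (fun u₁ u₂ b1 b2 b3 => hno u₁ u₂ b1 b2 (by omega))
      (fun t b1 b2 => a4 t (by omega) b2)
  obtain ⟨s, s1, s2, s3, s4⟩ := h.exists_prev h3 hI i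
  obtain ⟨e, e1, e2, e3, e4⟩ := h.exists_next h3 hI j
  by_cases hfoot : ∃ w, i < w ∧ w < j ∧ G.Adj v (c w)
  · obtain ⟨w, w1, w2, w3⟩ := hfoot
    have hsw : ∀ u, s < u → u < e → G.Adj v (c u) → u = w := by
      intro u u1 u2 u3
      by_contra hne
      by_cases d1 : u ≤ i
      · exact s4 u u1 d1 u3
      by_cases d2 : j ≤ u
      · exact e4 u d2 u2 u3
      rcases lt_or_gt_of_ne hne with h' | h'
      · exact hno u w (by omega) h' w2 u3 w3
      · exact hno w u w1 h' (by omega) w3 u3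
    -- A fourth spoke shows that the two sectors around `w` do not fill the whole rim.
    obtain ⟨x, x1, x2, x3, x4, x5, x6⟩ := h.exists_spoke h3 hI s s e w
    have hes : e < s + L := by
      by_contra hlt
      exact x6 (hsw x (by omega) (by omega) x3)
    refine h.no_arc_one h3 hI s2 w1 w2 e1 hes s3 w3 e3 hsw hqv hqv' hqc ?_
    intro t t1 t2
    constructor
    · intro hadj
      by_contra hne
      by_cases d1 : t < i
      · exact hsec s w t i s3 w3 (by omega)
          (fun u u1 u2 u3 => by have := hsw u u1 (by omega) u3; omega) t1 d1 w1.le hadj hi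
      by_cases d2 : j < t
      · exact hsec w e j t w3 e3 (by omega)
          (fun u u1 u2 u3 => by have := hsw u (by omega) u2 u3; omega) w2.le d2 t2 hj hadj
      exact hcons t (by omega) (by omega) hadj
    · rintro (rfl | rfl) <;> assumption
  · push Not at hfoot
    have hse : ∀ u, s < u → u < e → ¬ G.Adj v (c u) := by
      intro u u1 u2 u3
      by_cases d1 : u ≤ i
      · exact s4 u u1 d1 u3
      by_cases d2 : j ≤ u
      · exact e4 u d2 u2 u3
      exact hfoot u (by omega) (by omega) u3
    obtain ⟨x, x1, x2, x3, x4, x5, x6⟩ := h.exists_spoke h3 hI s s e e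
    have hes : e < s + L := by
      by_contra hlt
      exact hse x (by omega) (by omega) x3
    exact hsec s e i j s3 e3 hes hse s2 hij e1 hi hj

/-- A wheel of minimum length is proper. -/
theorem IsWheel.isProper (h : G.IsWheel L c v) (h3 : G.CliqueFree 3) (hI : G.ISK4Free)
    (hmin : ∀ L' c' v', G.IsWheel L' c' v' → L ≤ L') : IsProper G L c v := by
  classical
  have hc := h.hole
  have hL := hc.four_le
  intro q hqv hqv' hqr
  have hqc : ∀ t, c t ≠ q := fun t ht => hqr ⟨t, ht⟩
  by_cases hsec : ∀ s e i j, G.Adj v (c s) → G.Adj v (c e) → e < s + L →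
      (∀ u, s < u → u < e → ¬ G.Adj v (c u)) → s ≤ i → i < j → j ≤ e → G.Adj q (c i) →
      ¬ G.Adj q (c j)
  -- If no sector contains two neighbours of `q`, then `q` has at most one neighbour on the rim.
  · have hone : ∀ i j, i < j → j < i + L → G.Adj q (c i) → ¬ G.Adj q (c j) := by
      intro i j hij hji hi hj
      obtain ⟨j', a1, a2, a3, a4⟩ := exists_least_int (p := fun t => G.Adj q (c t))
        (show i + 1 ≤ j by omega) hj
      have hiL : G.Adj q (c (i + L)) := by rwa [hc.periodic]
      -- `l` is the next neighbour after `j'`, and equals `i + L` if `q` has no others. The arcs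
      -- from `i` to `j'` and from `j'` to `l` contain two spokes each.
      obtain ⟨l, b1, b2, b3, b4⟩ := exists_least_int (p := fun t => G.Adj q (c t))
        (show j' + 1 ≤ i + L by omega) hiL
      obtain ⟨u₁, u₂, d1, d2, d3, d4, d5⟩ := h.exists_two_spokes h3 hI hqv hqv' hqc hsec
        (show i < j' by omega) hi a3
      obtain ⟨w₁, w₂, f1, f2, f3, f4, f5⟩ := h.exists_two_spokes h3 hI hqv hqv' hqc hsec
        (show j' < l by omega) a3 b3
      have hqarc : ∀ t, i ≤ t → t ≤ j' → (G.Adj q (c t) ↔ t = i ∨ t = j') := by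
        intro t t1 t2
        constructor
        · intro hadj
          by_contra hne
          exact a4 t (by omega) (by omega) hadj
        · rintro (rfl | rfl) <;> assumption
      -- With three spokes, the arc closed by `q` is the rim of a shorter wheel with the same hub;
      -- with two, `no_arc_two` applies.
      by_cases hthird : ∃ u, i ≤ u ∧ u ≤ j' ∧ G.Adj v (c u) ∧ u ≠ u₁ ∧ u ≠ u₂
      · obtain ⟨u, g1, g2, g3, g4, g5⟩ := hthird
        obtain ⟨c', hc', -, -, hr⟩ := exists_isHole_glue (g := fun _ => q) (d := 0) (e := 0)
          (hc.isIPath (a := i) (b := j') (by omega)) (isIPath_self _ _) (by omega) le_rfl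
          (by omega) (fun t _ _ _ _ _ => hqc t) (by
            intro t t' d1 d2 d3 d4
            rw [G.adj_comm, hqarc t d1 d2]
            omega)
        have hmem : ∀ t, i ≤ t → t ≤ j' → c t ∈ Set.range c' := by
          intro t d1 d2
          rw [hr]
          exact .inl ⟨t, ⟨d1, d2⟩, rfl⟩
        have hw : G.IsWheel (j' - i + (0 - 0) + 2) c' v := by
          refine ⟨hc', ?_, three_le_ncard_of_mem (hc'.finite_range.inter_of_right _)
            ⟨d4, hmem u₁ (by omega) (by omega)⟩ ⟨d5, hmem u₂ (by omega) (by omega)⟩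
            ⟨g3, hmem u g1 g2⟩
            (hc.ne _ _ d2 (by omega)) ?_ ?_⟩
          · rw [hr]
            rintro (⟨t, -, ht⟩ | ⟨t, -, ht⟩)
            · exact h.ne t ht
            · exact hqv ht
          · rw [Ne, hc.inj_window i (by omega) (by omega) (by omega) (by omega)]
            exact fun h' => g4 h'.symm
          · rw [Ne, hc.inj_window i (by omega) (by omega) (by omega) (by omega)]
            exact fun h' => g5 h'.symm
        have := hmin _ _ _ hw
        omega
      · push Not at hthird
        obtain ⟨e, e1, e2, e3, e4⟩ := exists_least_int (p := fun u => G.Adj v (c u))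
          f1.le f4
        have hej : e ≠ j' := by
          rintro rfl
          have := hthird e (by omega) le_rfl e3 (by omega)
          omega
        -- The path consists of `q` alone, and `e` is the first spoke after the arc.
        refine h.no_arc_two h3 hI (k := 0) (p := fun _ => q) (i := i) (j := j') (e := e) le_rfl
          (isIPath_self _ _) d1 d2 d3
          (by omega) (by omega) d4 d5 e3 ?_ ?_ ?_ ?_
        · intro u g1 g2 g3
          by_contra hne
          push Not at hne
          exact hne.2 (hthird u g1 g2 g3 hne.1)
        · exact fun t _ _ => ⟨hqv, hqv'⟩
        · exact fun t s _ _ _ _ => (hqc s).symm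
        · intro t s t1 t2 s1 s2
          by_cases hs : s ≤ j'
          · rw [hqarc s s1 hs]
            omega
          · constructor
            · intro hadj
              exact absurd hadj (b4 s (by omega) (by omega))
            · omega
    refine ⟨fun i j h1 h2 hi hj => absurd hj (hone i j h1 h2 hi), ?_⟩
    refine (Set.ncard_le_one (hc.finite_range.inter_of_right _)).2 ?_ |>.trans (by norm_num)
    rintro x ⟨hx, hx'⟩ y ⟨hy, hy'⟩
    obtain ⟨i, i1, i2, rfl⟩ := hc.exists_window hx' 0
    obtain ⟨j, j1, j2, rfl⟩ := hc.exists_window hy' 0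
    rcases lt_trichotomy i j with h' | h' | h'
    · exact absurd hy (hone i j h' (by omega) hx)
    · rw [h']
    · exact absurd hx (hone j i h' (by omega) hy)
  · push Not at hsec
    obtain ⟨s, e, i, j, hs, he, hse, hno, hsi, hij, hje, hi, hj⟩ := hsec
    have hall := h.eq_of_two_in_sector h3 hI hmin hqv hqv' hqc hs he hse hno hsi hij hje hi hj
    have hmem : ∀ t, G.Adj q (c t) → c t = c i ∨ c t = c j := by
      intro t ht
      obtain ⟨t', t1, t2, t3⟩ := hc.exists_window ⟨t, rfl⟩ s
      rw [← t3] at ht ⊢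
      rcases hall t' t1 t2 ht with rfl | rfl <;> simp
    refine ⟨?_, ?_⟩
    · intro i' j' h1 h2 hi' hj' hfar
      have hne := hc.ne i' j' h1 h2
      have : (c i' = c i ∧ c j' = c j) ∨ (c i' = c j ∧ c j' = c i) := by
        rcases hmem i' hi' with a1 | a1 <;> rcases hmem j' hj' with a2 | a2
        · exact absurd (a1.trans a2.symm) hne
        · exact .inl ⟨a1, a2⟩
        · exact .inr ⟨a1, a2⟩
        · exact absurd (a1.trans a2.symm) hne
      obtain ⟨⟨u, u1, u2, u3⟩, -⟩ := hc.far_congr hij (by omega) h1 h2 this hfar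
      exact hno u (by omega) (by omega) u3
    · have hsub : G.neighborSet q ∩ Set.range c ⊆ (({c i, c j} : Finset V) : Set V) := by
        rintro x ⟨hx, t, rfl⟩
        simpa using hmem t hx
      refine (Set.ncard_le_ncard hsub (Finset.finite_toSet _)).trans ?_
      rw [Set.ncard_coe_finset]
      exact Finset.card_le_two

end Wheel

end SimpleGraph

/-! ### Bad paths and rerouting the rim -/

namespace SimpleGraph

variable {V : Type*} {G : SimpleGraph V}

section Wheel

variable {L : ℤ} {c : ℤ → V} {v : V}

/-- The vertices outside a wheel that are not adjacent to its hub. -/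
def offWheel (G : SimpleGraph V) (c : ℤ → V) (v : V) : Set V :=
  {w | w ≠ v ∧ ¬ G.Adj v w ∧ w ∉ Set.range c}

/-- `x` and `y` have neighbours on the rim that are not in a common sector. -/
def BadRel (G : SimpleGraph V) (L : ℤ) (c : ℤ → V) (v x y : V) : Prop :=
  ∃ s t, s < t ∧ t < s + L ∧ Far G L c v s t ∧ G.Adj x (c s) ∧ G.Adj y (c t)

lemma BadRel.symm (hc : G.IsHole L c) {x y : V} (h : BadRel G L c v x y) :
    BadRel G L c v y x := by
  obtain ⟨s, t, h1, h2, h3, h4, h5⟩ := h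
  exact ⟨t, s + L, by omega, by omega, hc.far_swap h3, h5, by rwa [hc.periodic]⟩

/-- A shortest path off the wheel whose ends have neighbours on the rim that are not in a common
sector. -/
structure IsBadPath (G : SimpleGraph V) (L : ℤ) (c : ℤ → V) (v : V) (p : ℤ → V) (k : ℤ) :
    Prop where
  seq : G.IsSeq (offWheel G c v) p k
  ipath : G.IsIPath p 0 k
  rel : BadRel G L c v (p 0) (p k)
  min : ∀ g m, G.IsSeq (offWheel G c v) g m → BadRel G L c v (g 0) (g m) → k ≤ m

variable {p : ℤ → V} {k : ℤ}

/-- Otherwise the subpath between `p a` and `p b` would be a shorter candidate. -/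
lemma IsBadPath.not_rel (h : IsBadPath G L c v p k) (hc : G.IsHole L c) {a b : ℤ} (ha : 0 ≤ a)
    (hak : a ≤ k) (hb : 0 ≤ b) (hbk : b ≤ k) (hab : b - a < k) (hba : a - b < k) :
    ¬ BadRel G L c v (p a) (p b) := by
  wlog hle : a ≤ b generalizing a b
  · exact fun h' => this hb hbk ha hak hba hab (by omega) (h'.symm hc)
  intro hrel
  have := h.min _ _ (h.seq.sub ha hle hbk) (by simpa using hrel)
  omega

/-- Otherwise the subpath from `p a` to `p b`, followed by `q`, would be a shorter candidate. -/
lemma IsBadPath.not_rel_of_adj (h : IsBadPath G L c v p k) {q : V} (hq : q ∈ offWheel G c v)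
    {a b : ℤ} (ha : 0 ≤ a) (hak : a ≤ k) (hb : 0 ≤ b) (hbk : b ≤ k)
    (hqb : G.Adj q (p b)) (hab : b - a + 1 < k) (hba : a - b + 1 < k) :
    ¬ BadRel G L c v (p a) q := by
  intro hrel
  rcases le_total a b with hle | hle
  · have := h.min _ _ ((h.seq.sub ha hle hbk).snoc hq (by simpa using hqb.symm)) (by
      simpa [hle] using hrel)
    omega
  · have := h.min _ _ ((h.seq.sub hb hle hak).reverse.snoc hq (by simpa using hqb.symm)) (by
      simpa [hle] using hrel)
    omega

/-- Going from `p a` to `p b` through `q` may not shorten the path, so `b ≤ a + 2`; and `b = a + 1`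
would give a triangle. -/
lemma IsBadPath.adj_gap (h : IsBadPath G L c v p k) (h3 : G.CliqueFree 3) {q : V}
    (hq : q ∈ offWheel G c v) {a b : ℤ} (ha : 0 ≤ a) (hbk : b ≤ k) (hab : a < b)
    (hqa : G.Adj q (p a)) (hqb : G.Adj q (p b)) : b = a + 2 := by
  have h1 : b ≠ a + 1 := by
    rintro rfl
    exact h3.not_triangle hqa (h.ipath.adj_succ ha (by omega)) hqb
  by_contra hne
  obtain ⟨f, hf, f0, f1⟩ : ∃ f, G.IsSeq (offWheel G c v) f (a - 0 + 1) ∧ f 0 = p 0 ∧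
      f (a - 0 + 1) = q :=
    ⟨_, (h.seq.sub le_rfl ha (show a ≤ k by omega)).snoc hq (by simpa using hqa.symm),
      by simp [ha], by simp⟩
  -- The path `p 0, …, p a, q, p b, …, p k`.
  have s2 : G.IsSeq (offWheel G c v) (glueSeq f (a - 0 + 1) p b) (a - 0 + 1 + 1 + (k - b)) := by
    refine ⟨by omega, fun i i1 i2 => ?_, fun i i1 i2 => ?_⟩
    · unfold glueSeq
      split_ifs
      · exact hf.mem _ (by omega) (by omega)
      · exact h.seq.mem _ (by omega) (by omega)
    · rcases lt_trichotomy i (a - 0 + 1) with h' | h' | h'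
      · simpa only [glueSeq, if_pos h'.le, if_pos (show i + 1 ≤ a - 0 + 1 by omega)]
          using hf.adj i i1 h'
      · subst h'
        simp only [glueSeq]
        rw [if_pos le_rfl, if_neg (by omega), f1]
        convert hqb using 2
        ring
      · have := h.seq.adj (i - (a - 0 + 1) - 1 + b) (by omega) (by omega)
        simp only [glueSeq]
        rw [if_neg (by omega), if_neg (by omega)]
        convert this using 2
        ring
  have := h.min _ _ s2 (by
    have e0 : glueSeq f (a - 0 + 1) p b 0 = p 0 := by
      simp only [glueSeq]
      rw [if_pos (by omega), f0]
    have e1 : glueSeq f (a - 0 + 1) p b (a - 0 + 1 + 1 + (k - b)) = p k := by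
      simp only [glueSeq]
      rw [if_neg (by omega)]
      congr 1
      ring
    rw [e0, e1]
    exact h.rel)
  omega

/-- In a proper wheel with the least number of spokes at its hub, an arc of the rim cannot be
replaced by a bad path. -/
lemma IsWheel.no_reroute [Finite V] (h : G.IsWheel L c v) (h3 : G.CliqueFree 3)
    (hI : G.ISK4Free) (hprop : IsProper G L c v)
    (hmin : ∀ L' c', G.IsWheel L' c' v → IsProper G L' c' v →
      (G.neighborSet v ∩ Set.range c).ncard ≤ (G.neighborSet v ∩ Set.range c').ncard)
    (hb : IsBadPath G L c v p k) {i j : ℤ} (hij : i < j) (hji : j < i + L)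
    (hi : G.Adj (p 0) (c i)) (hj : G.Adj (p k) (c j)) (hfar : Far G L c v i j)
    (hadj : ∀ t s, 0 ≤ t → t ≤ k → j ≤ s → s ≤ i + L → G.Adj (p t) (c s) →
      (t = 0 ∧ s = i + L) ∨ (t = k ∧ s = j))
    (hqz : ∀ q a z, q ∈ offWheel G c v → 0 ≤ a → a ≤ k → G.Adj q (p a) →
      (∀ b, 0 ≤ b → b ≤ k → G.Adj q (p b) → b = a) → (∀ b, 0 ≤ b → b ≤ k → p b ≠ q) →
      j ≤ z → z ≤ i + L → G.Adj q (c z) →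
      (∀ z', j ≤ z' → z' ≤ i + L → G.Adj q (c z') → z' = z) →
      (∃ u, j ≤ u ∧ u < z ∧ G.Adj v (c u)) → (∃ u, z < u ∧ u ≤ i + L ∧ G.Adj v (c u)) → False)
    (harc : ∀ s, i < s → s < j → ¬ G.Adj v (c s) → ∀ a b, 0 ≤ a → a ≤ k → 0 ≤ b → b ≤ k →
      G.Adj (p a) (c s) → G.Adj (p b) (c s) → a = b)
    (hthree : 3 ≤ (G.neighborSet v ∩ c '' Set.Icc j (i + L)).ncard) : False := by
  classical
  have hc := h.hole
  have hk := hb.seq.nonneg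
  obtain ⟨⟨u₀, hu₀, hu₀', hu₀v⟩, u₁, hu₁, hu₁', hu₁v⟩ := hfar
  have hpc : ∀ t s, 0 ≤ t → t ≤ k → c s ≠ p t := fun t s h1 h2 h' =>
    (hb.seq.mem t h1 h2).2.2 ⟨s, h'⟩
  have hpv : ∀ t, 0 ≤ t → t ≤ k → ¬ G.Adj v (p t) := fun t h1 h2 => (hb.seq.mem t h1 h2).2.1
  obtain ⟨c', hc', hc1, hc2, hr⟩ := exists_isHole_glue
    (hc.isIPath (a := j) (b := i + L) (by omega)) hb.ipath (by omega) hk (by omega)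
    (fun s t _ _ h4 h5 => hpc t s h4 h5) (by
      intro s t h1 h2 h4 h5
      rw [G.adj_comm]
      constructor
      · intro h'
        have := hadj t s h4 h5 h1 h2 h'
        omega
      · rintro (⟨rfl, rfl⟩ | ⟨rfl, rfl⟩)
        · rwa [hc.periodic]
        · exact hj)
  have hv' : v ∉ Set.range c' := by
    rw [hr]
    rintro (⟨t, -, ht⟩ | ⟨t, ⟨t1, t2⟩, ht⟩)
    · exact h.ne t ht
    · exact (hb.seq.mem t t1 t2).1 ht
  have hspokes : G.neighborSet v ∩ Set.range c' = G.neighborSet v ∩ c '' Set.Icc j (i + L) := by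
    rw [hr]
    ext x
    constructor
    · rintro ⟨hx, hx' | ⟨t, ⟨t1, t2⟩, rfl⟩⟩
      · exact ⟨hx, hx'⟩
      · exact absurd hx (hpv t t1 t2)
    · exact fun ⟨hx, hx'⟩ => ⟨hx, .inl hx'⟩
  have hw' : G.IsWheel (i + L - j + (k - 0) + 2) c' v := ⟨hc', hv', by rwa [hspokes]⟩
  -- The path carries no spokes, and the spoke `u₀` on the replaced arc is lost.
  have hless : (G.neighborSet v ∩ Set.range c').ncard <
      (G.neighborSet v ∩ Set.range c).ncard := by
    apply Set.ncard_lt_ncard _ (Set.toFinite _)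
    rw [hspokes]
    refine ⟨fun x ⟨hx, t, _, ht⟩ => ⟨hx, t, ht⟩, fun hsub => ?_⟩
    obtain ⟨-, t, ⟨t1, t2⟩, ht⟩ := hsub ⟨hu₀v, u₀, rfl⟩
    exact hc.ne u₀ t (by omega) (by omega) ht.symm
  -- By the choice of the wheel it remains to see that the new one is proper.
  suffices hprop' : IsProper G (i + L - j + (k - 0) + 2) c' v by
    have := hmin _ _ hw' hprop'
    omega
  have hcfoot : ∀ t, 0 ≤ t → t < i + L - j + (k - 0) + 2 → G.Adj v (c' t) →
      t ≤ i + L - j ∧ G.Adj v (c (j + t)) := by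
    intro t t1 t2 ht
    by_cases h' : t ≤ i + L - j
    · rw [hc1 t t1 h'] at ht
      exact ⟨h', ht⟩
    · have := hc2 (t - (i + L - j + 1)) (by omega) (by omega)
      rw [add_sub_cancel] at this
      rw [this] at ht
      exact absurd ht (hpv _ (by omega) (by omega))
  intro q hqv hqv' hqr
  rw [hr] at hqr
  have hqp : ∀ b, 0 ≤ b → b ≤ k → p b ≠ q := fun b b1 b2 h' => hqr (.inr ⟨b, ⟨b1, b2⟩, h'⟩)
  by_cases hqc : q ∈ Set.range c
  · obtain ⟨s, s1, s2, rfl⟩ := hc.exists_window hqc (i + 1)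
    have hsj : s < j := by
      by_contra hlt
      exact hqr (.inl ⟨s, ⟨by omega, by omega⟩, rfl⟩)
    have hz : ∀ z, j ≤ z → z ≤ i + L → G.Adj (c s) (c z) →
        (z = j ∧ s = j - 1) ∨ (z = i + L ∧ s = i + 1) := by
      intro z z1 z2 z3
      have := (hc.adj s z (by omega) (by omega)).1 z3
      omega
    -- If a vertex of the removed arc were adjacent to both ends of the retained arc, it would be
    -- the only vertex removed, hence the one at the spoke `u₀`.
    have hnotboth : ¬ (s = j - 1 ∧ s = i + 1) := by
      rintro ⟨e1, e2⟩
      have : u₀ = s := by omega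
      rw [this] at hu₀v
      exact hqv' hu₀v
    have hone : ∀ a b, 0 ≤ a → a ≤ k → 0 ≤ b → b ≤ k → G.Adj (c s) (p a) → G.Adj (c s) (p b) →
        a = b := fun a b a1 a2 b1 b2 a3 b3 =>
      harc s (by omega) hsj hqv' a b a1 a2 b1 b2 a3.symm b3.symm
    constructor
    · intro x y hxy hyx hx hy hfar'
      obtain ⟨x', x1, x2, x3⟩ := hc'.exists_window ⟨x, rfl⟩ 0
      obtain ⟨y', y1, y2, y3⟩ := hc'.exists_window ⟨y, rfl⟩ 0
      have hne : x' ≠ y' := by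
        rintro rfl
        exact hc'.ne x y hxy hyx (x3.symm.trans y3)
      rw [← x3] at hx
      rw [← y3] at hy
      wlog hlt : x' < y' generalizing x y x' y'
      · exact this y (x + (i + L - j + (k - 0) + 2)) (by omega) (by omega) (hc'.far_swap hfar')
          y' hy y1 y2 y3 x' hx x1 x2 (by rw [hc'.periodic, x3]) hne.symm (by omega)
      have hf := hc'.far_congr hlt (by omega) hxy hyx (.inl ⟨x3.symm, y3.symm⟩) hfar'
      obtain ⟨⟨u, f1, f2, f3⟩, w, g1, g2, g3⟩ := hf
      obtain ⟨f4, f5⟩ := hcfoot u (by omega) (by omega) f3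
      by_cases hym : y' ≤ i + L - j
      · rw [hc1 _ x1 (by omega)] at hx
        rw [hc1 _ y1 hym] at hy
        have := hz _ (by omega) (by omega) hx
        have := hz _ (by omega) (by omega) hy
        omega
      · rw [hc1 _ x1 (by omega)] at hx
        have := hz _ (by omega) (by omega) hx
        rcases lt_or_ge w (i + L - j + (k - 0) + 2) with hwl | hwl
        · have := hcfoot w (by omega) hwl g3
          omega
        · rw [← sub_add_cancel w (i + L - j + (k - 0) + 2), hc'.periodic] at g3
          have := hcfoot _ (by omega) (by omega) g3
          omega
    · rw [hr, Set.inter_union_distrib_left]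
      refine (Set.ncard_union_le _ _).trans ?_
      have e1 : (G.neighborSet (c s) ∩ c '' Set.Icc j (i + L)).ncard ≤ 1 := by
        refine (Set.ncard_le_one (Set.toFinite _)).2 ?_
        rintro x ⟨hx, z, ⟨z1, z2⟩, rfl⟩ y ⟨hy, w, ⟨w1, w2⟩, rfl⟩
        have := hz z z1 z2 hx
        have := hz w w1 w2 hy
        congr 1
        omega
      have e2 : (G.neighborSet (c s) ∩ p '' Set.Icc 0 k).ncard ≤ 1 := by
        refine (Set.ncard_le_one (Set.toFinite _)).2 ?_
        rintro x ⟨hx, z, ⟨z1, z2⟩, rfl⟩ y ⟨hy, w, ⟨w1, w2⟩, rfl⟩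
        rw [hone z w z1 z2 w1 w2 hx hy]
      omega
  · have hqo : q ∈ offWheel G c v := ⟨hqv, hqv', hqc⟩
    obtain ⟨hp1, hp2⟩ := hprop q hqv hqv' hqc
    have hgap : ∀ a b, 0 ≤ a → a ≤ k → 0 ≤ b → b ≤ k → a ≠ b → G.Adj q (p a) → G.Adj q (p b) →
        b = a + 2 ∨ a = b + 2 := by
      intro a b a1 a2 b1 b2 hne ha' hb'
      rcases lt_or_gt_of_ne hne with hlt | hlt
      · exact .inl (hb.adj_gap h3 hqo a1 b2 hlt ha' hb')
      · exact .inr (hb.adj_gap h3 hqo b1 a2 hlt hb' ha')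
    -- Any two neighbours on the path are at distance two along it, which three cannot be.
    have hX : (G.neighborSet q ∩ p '' Set.Icc 0 k).ncard ≤ 2 := by
      by_contra hlt
      obtain ⟨x, y, z, hx, hy, hz, hxy, hxz, hyz⟩ :=
        (Set.two_lt_ncard_iff (Set.toFinite _)).1 (not_le.1 hlt)
      obtain ⟨hx, x', ⟨x1, x2⟩, rfl⟩ := hx
      obtain ⟨hy, y', ⟨y1, y2⟩, rfl⟩ := hy
      obtain ⟨hz, z', ⟨z1, z2⟩, rfl⟩ := hz
      have n1 : x' ≠ y' := fun h' => hxy (by rw [h'])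
      have n2 : x' ≠ z' := fun h' => hxz (by rw [h'])
      have n3 : y' ≠ z' := fun h' => hyz (by rw [h'])
      have := hgap x' y' x1 x2 y1 y2 n1 hx hy
      have := hgap x' z' x1 x2 z1 z2 n2 hx hz
      have := hgap y' z' y1 y2 z1 z2 n3 hy hz
      omega
    have hY : (G.neighborSet q ∩ c '' Set.Icc j (i + L)).ncard ≤ 2 := by
      refine (Set.ncard_le_ncard ?_ (Set.toFinite _)).trans hp2
      rintro x ⟨hx, t, -, ht⟩
      exact ⟨hx, t, ht⟩
    have hXY : ¬ ((G.neighborSet q ∩ p '' Set.Icc 0 k).ncard = 2 ∧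
        (G.neighborSet q ∩ c '' Set.Icc j (i + L)).ncard = 2) := by
      rintro ⟨hX2, hY2⟩
      obtain ⟨x, y, hxy, hs⟩ := Set.ncard_eq_two.1 hX2
      obtain ⟨z, z', hzz, hs'⟩ := Set.ncard_eq_two.1 hY2
      obtain ⟨hx, a, ⟨a1, a2⟩, rfl⟩ : x ∈ G.neighborSet q ∩ p '' Set.Icc 0 k := by rw [hs]; simp
      obtain ⟨hy, b, ⟨b1, b2⟩, rfl⟩ : y ∈ G.neighborSet q ∩ p '' Set.Icc 0 k := by rw [hs]; simp
      obtain ⟨hz, w, ⟨w1, w2⟩, rfl⟩ : z ∈ G.neighborSet q ∩ c '' Set.Icc j (i + L) := by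
        rw [hs']; simp
      obtain ⟨hz', w', ⟨w1', w2'⟩, rfl⟩ : z' ∈ G.neighborSet q ∩ c '' Set.Icc j (i + L) := by
        rw [hs']; simp
      clear hs hs'
      have n1 : a ≠ b := fun h' => hxy (by rw [h'])
      wlog hab : a < b generalizing a b
      · exact this b b1 b2 hy a a1 a2 hxy.symm hx n1.symm (by omega)
      have hba := hb.adj_gap h3 hqo a1 b2 hab hx hy
      -- With two neighbours on the path, any neighbour of `q` on the retained arc other than `c u₁`
      -- would give a shorter candidate, through `q` from the end of the path on the other side of
      -- `u₁`.
      have key : ∀ z, j ≤ z → z ≤ i + L → G.Adj q (c z) → z = u₁ := by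
        intro z z1 z2 z3
        by_contra hne
        rcases lt_or_gt_of_ne hne with hlt | hlt
        · refine hb.not_rel_of_adj hqo le_rfl hk a1 a2 hx (by omega) (by omega)
            ⟨i, z, by omega, by omega, ⟨⟨u₀, hu₀, by omega, hu₀v⟩, u₁, hlt, hu₁', hu₁v⟩, hi, z3⟩
        · refine hb.not_rel_of_adj hqo hk le_rfl b1 b2 hy (by omega) (by omega)
            ⟨j, z, by omega, by omega, ⟨⟨u₁, hu₁, hlt, hu₁v⟩, u₀ + L, by omega, by omega, ?_⟩,
              hj, z3⟩
          rwa [hc.periodic]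
      have e1 := key w w1 w2 hz
      have e2 := key w' w1' w2' hz'
      exact hzz (by rw [e1, e2])
    have hcard : (G.neighborSet q ∩ Set.range c').ncard ≤ 2 := by
      -- There are at most two neighbours on each part and not two on both, so excluding three
      -- leaves at most two.
      have e1 : (G.neighborSet q ∩ Set.range c').ncard ≠ 3 :=
        ncard_neighborSet_ne_three h3 hI hc'.isHoleSet (by rw [hr]; exact hqr)
      have e2 : (G.neighborSet q ∩ Set.range c').ncard ≤
          (G.neighborSet q ∩ c '' Set.Icc j (i + L)).ncard +
            (G.neighborSet q ∩ p '' Set.Icc 0 k).ncard := by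
        rw [hr, Set.inter_union_distrib_left]
        exact Set.ncard_union_le _ _
      omega
    refine ⟨?_, hcard⟩
    intro x y hxy hyx hx hy hfar'
    obtain ⟨x', x1, x2, x3⟩ := hc'.exists_window ⟨x, rfl⟩ 0
    obtain ⟨y', y1, y2, y3⟩ := hc'.exists_window ⟨y, rfl⟩ 0
    have hne : x' ≠ y' := by
      rintro rfl
      exact hc'.ne x y hxy hyx (x3.symm.trans y3)
    rw [← x3] at hx
    rw [← y3] at hy
    wlog hlt : x' < y' generalizing x y x' y'
    · exact this y (x + (i + L - j + (k - 0) + 2)) (by omega) (by omega) (hc'.far_swap hfar')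
        y' hy y1 y2 y3 x' hx x1 x2 (by rw [hc'.periodic, x3]) hne.symm (by omega)
    have hf := hc'.far_congr hlt (by omega) hxy hyx (.inl ⟨x3.symm, y3.symm⟩) hfar'
    obtain ⟨⟨u, f1, f2, f3⟩, w, g1, g2, g3⟩ := hf
    obtain ⟨f4, f5⟩ := hcfoot u (by omega) (by omega) f3
    have hw : (y' < w ∧ w ≤ i + L - j ∧ G.Adj v (c (j + w))) ∨
        ∃ w', 0 ≤ w' ∧ w' < x' ∧ G.Adj v (c (j + w')) := by
      rcases lt_or_ge w (i + L - j + (k - 0) + 2) with hwl | hwl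
      · have := hcfoot w (by omega) hwl g3
        exact .inl ⟨g1, this⟩
      · rw [← sub_add_cancel w (i + L - j + (k - 0) + 2), hc'.periodic] at g3
        have := hcfoot _ (by omega) (by omega) g3
        exact .inr ⟨_, by omega, by omega, this.2⟩
    by_cases hym : y' ≤ i + L - j
    · rw [hc1 _ x1 (by omega)] at hx
      rw [hc1 _ y1 hym] at hy
      refine hp1 (j + x') (j + y') (by omega) (by omega) hx hy
        ⟨⟨j + u, by omega, by omega, f5⟩, ?_⟩
      rcases hw with ⟨w1, w2, w3⟩ | ⟨w', w1, w2, w3⟩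
      · exact ⟨j + w, by omega, by omega, w3⟩
      · exact ⟨j + w' + L, by omega, by omega, by rwa [hc.periodic]⟩
    · have hcx := hc1 _ x1 (by omega)
      have hcy := hc2 (y' - (i + L - j + 1)) (by omega) (by omega)
      rw [add_sub_cancel] at hcy
      have huniq : ∀ w ∈ Set.range c', G.Adj q w → w = c' x' ∨ w = c' y' := by
        intro w hw hqw
        by_contra hn
        push Not at hn
        have := three_le_ncard_of_mem (Set.toFinite (G.neighborSet q ∩ Set.range c'))
          ⟨hx, x', rfl⟩ ⟨hy, y', rfl⟩ ⟨hqw, hw⟩ (hc'.ne x' y' hlt (by omega)) hn.1.symm hn.2.symm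
        omega
      rcases hw with ⟨w1, w2, w3⟩ | ⟨w', w1, w2, w3⟩
      · omega
      · rw [hcx] at hx huniq
        rw [hcy] at hy huniq
        -- All spokes lie on the retained arc, so two far neighbours are not both on the path; both
        -- on the arc would contradict properness of the old wheel. One on each part is what `hqz`
        -- excludes.
        refine hqz q (0 + (y' - (i + L - j + 1))) (j + x') hqo (by omega) (by omega) hy ?_ hqp
          (by omega) (by omega) hx ?_ ⟨j + w', by omega, by omega, w3⟩
          ⟨j + u, by omega, by omega, f5⟩
        · intro b b1 b2 b3
          rcases huniq (p b) (by rw [hr]; exact .inr ⟨b, ⟨b1, b2⟩, rfl⟩) b3 with e | e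
          · exact absurd e.symm (hpc b _ b1 b2)
          · exact (hb.ipath.inj b1 b2 (by omega) (by omega)).1 e
        · intro z z1 z2 z3
          rcases huniq (c z) (by rw [hr]; exact .inl ⟨z, ⟨z1, z2⟩, rfl⟩) z3 with e | e
          · exact (hc.inj_window j z1 (by omega) (by omega) (by omega)).1 e
          · exact absurd e (hpc _ _ (by omega) (by omega))

end Wheel

end SimpleGraph

/-! ### Bad paths with two spokes on either side -/

namespace SimpleGraph

variable {V : Type*} {G : SimpleGraph V}

section Wheel

variable {L : ℤ} {c : ℤ → V} {v : V} {p : ℤ → V} {k : ℤ}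

lemma IsBadPath.reverse (h : IsBadPath G L c v p k) (hc : G.IsHole L c) :
    IsBadPath G L c v (fun t => p (k - t)) k := by
  refine ⟨h.seq.reverse, ?_, ?_, h.min⟩
  · have := h.ipath.reverse k
    rwa [sub_self, sub_zero] at this
  · have := h.rel.symm hc
    simpa using this

lemma IsBadPath.not_far (h : IsBadPath G L c v p k) {a b s t : ℤ} (hc : G.IsHole L c)
    (ha : 0 ≤ a) (hak : a ≤ k) (hb : 0 ≤ b) (hbk : b ≤ k) (hab : b - a < k) (hba : a - b < k)
    (hst : s < t) (hts : t < s + L) (hs : G.Adj (p a) (c s)) (ht : G.Adj (p b) (c t)) :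
    ¬ Far G L c v s t :=
  fun hf => h.not_rel hc ha hak hb hbk hab hba ⟨s, t, hst, hts, hf, hs, ht⟩

/-- A single vertex with far neighbours on the rim contradicts properness. -/
lemma IsBadPath.one_le (h : IsBadPath G L c v p k) (hprop : IsProper G L c v) : 1 ≤ k := by
  by_contra hlt
  have hk : k = 0 := by
    have := h.seq.nonneg
    omega
  obtain ⟨s, t, h1, h2, h4, h5, h6⟩ := h.rel
  obtain ⟨m1, m2, m3⟩ := h.seq.mem 0 le_rfl h.seq.nonneg
  rw [hk] at h6
  exact (hprop _ m1 m2 m3).1 s t h1 h2 h5 h6 h4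

/-- If an end of a bad path has two neighbours on the rim, then one of the arcs between the ends
has at most one spoke. -/
lemma IsWheel.no_two_attachments (h : G.IsWheel L c v) (h3 : G.CliqueFree 3)
    (hI : G.ISK4Free) (hprop : IsProper G L c v) (hb : IsBadPath G L c v p k) {i j : ℤ}
    (hj : G.Adj (p k) (c j)) {u₁ u₂ w₁ w₂ : ℤ} (hiu : i < u₁) (huu : u₁ < u₂) (huj : u₂ < j)
    (hjw : j < w₁) (hww : w₁ < w₂) (hwi : w₂ < i + L) (hu₁ : G.Adj v (c u₁))
    (hu₂ : G.Adj v (c u₂)) (hw₁ : G.Adj v (c w₁)) (hw₂ : G.Adj v (c w₂))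
    (hmid : ∀ a s, 0 < a → a < k → ¬ G.Adj (p a) (c s)) {x y : ℤ} (hxy : x < y)
    (hxyi : i = x ∨ i = y) (hx : G.Adj (p 0) (c x)) (hy : G.Adj (p 0) (c y))
    (hno : ∀ u, x < u → u < y → ¬ G.Adj v (c u)) : False := by
  have hc := h.hole
  have hk := hb.one_le hprop
  have per : ∀ t, G.Adj v (c (t + L)) ↔ G.Adj v (c t) := fun t => by rw [hc.periodic]
  have hw₂' : G.Adj v (c (w₂ - L)) := by rwa [← per, sub_add_cancel]
  have hx' : w₂ - L ≤ x := by
    by_contra hlt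
    exact hno _ (not_le.1 hlt) (by omega) hw₂'
  have hy' : y ≤ u₁ := by
    by_contra hlt
    exact hno _ (by omega) (not_le.1 hlt) hu₁
  obtain ⟨s, s1, s2, s3, s4⟩ := exists_greatest_int (p := fun u => G.Adj v (c u)) hx' hw₂'
  obtain ⟨e, e1, e2, e3, e4⟩ := exists_least_int (p := fun u => G.Adj v (c u)) hy' hu₁
  have hse : ∀ u, s < u → u < e → ¬ G.Adj v (c u) := by
    intro u a1 a2 a3
    by_cases b1 : u ≤ x
    · exact s4 u a1 b1 a3
    · by_cases b2 : y ≤ u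
      · exact e4 u b2 a2 a3
      · exact hno u (by omega) (by omega) a3
  obtain ⟨g, g1, g2, g3, g4⟩ := exists_least_int (p := fun u => G.Adj v (c u)) hjw.le hw₁
  obtain ⟨m1, m2, m3⟩ := hb.seq.mem 0 le_rfl (by omega)
  obtain ⟨n1, n2, n3⟩ := hb.seq.mem k (by omega) le_rfl
  -- The two neighbours of `p 0` lie in the sector from `s` to `e`. The path leads from there to `c
  -- j`, which lies beyond the sector since `e ≤ u₁ < u₂ < j`.
  refine h.no_sector_two h3 hI (Q := p '' Set.Icc 0 k) (x := p 0) (y := p k) s3 e3 hse s2 hxy e1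
    (z := j) (g := g) (by omega) g1 (by omega) g3 g4 hb.ipath.isConnOn ⟨0, ⟨le_rfl, by omega⟩, rfl⟩
    ⟨k, ⟨by omega, le_rfl⟩, rfl⟩ hx hy hj ?_ ?_ ?_ ?_
  · rintro ⟨t, ⟨t1, t2⟩, ht⟩
    exact (hb.seq.mem t t1 t2).1 ht
  · rintro t - - ⟨a, ⟨a1, a2⟩, ha⟩
    exact (hb.seq.mem a a1 a2).2.2 ⟨t, ha.symm⟩
  · rintro _ ⟨t, ⟨t1, t2⟩, rfl⟩
    exact (hb.seq.mem t t1 t2).2.1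
  · rintro _ ⟨a, ⟨a1, a2⟩, rfl⟩ t t1 t2 hadj
    rcases lt_trichotomy a 0 with ha | rfl | ha
    · omega
    · refine ⟨rfl, ?_⟩
      by_contra hne
      push Not at hne
      have := three_le_ncard_of_mem (s := G.neighborSet (p 0) ∩ Set.range c)
        (hc.finite_range.inter_of_right _) ⟨hx, x, rfl⟩ ⟨hy, y, rfl⟩ ⟨hadj, t, rfl⟩ (hc.ne x y hxy (by omega)) ?_ ?_
      · have := (hprop _ m1 m2 m3).2
        omega
      · rw [Ne, hc.inj_window s (by omega) (by omega) (by omega) (by omega)]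
        exact fun h' => hne.1 h'.symm
      · rw [Ne, hc.inj_window s (by omega) (by omega) (by omega) (by omega)]
        exact fun h' => hne.2 h'.symm
    · rcases lt_or_eq_of_le a2 with ha' | rfl
      · exact absurd hadj (hmid a t ha ha')
      -- A neighbour of `p k` in the sector would be far from `j`: the spoke `u₂` separates them on
      -- one side and `w₁` on the other.
      · refine absurd ?_ ((hprop _ n1 n2 n3).1 t j (by omega) (by omega) hadj hj)
        exact ⟨⟨u₂, by omega, huj, hu₂⟩, w₁, hjw, by omega, hw₁⟩

/-- An end of a bad path has only one neighbour on the rim if both arcs between the ends have two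
spokes. -/
lemma IsWheel.attachment_unique (h : G.IsWheel L c v) (h3 : G.CliqueFree 3)
    (hI : G.ISK4Free) (hprop : IsProper G L c v) (hb : IsBadPath G L c v p k) {i j : ℤ}
    (hi : G.Adj (p 0) (c i))
    (hj : G.Adj (p k) (c j)) {u₁ u₂ w₁ w₂ : ℤ} (hiu : i < u₁) (huu : u₁ < u₂) (huj : u₂ < j)
    (hjw : j < w₁) (hww : w₁ < w₂) (hwi : w₂ < i + L) (hu₁ : G.Adj v (c u₁))
    (hu₂ : G.Adj v (c u₂)) (hw₁ : G.Adj v (c w₁)) (hw₂ : G.Adj v (c w₂))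
    (hmid : ∀ a s, 0 < a → a < k → ¬ G.Adj (p a) (c s)) {t : ℤ} (hit : i < t) (hti : t < i + L) :
    ¬ G.Adj (p 0) (c t) := by
  intro ht
  have hc := h.hole
  obtain ⟨m1, m2, m3⟩ := hb.seq.mem 0 le_rfl hb.seq.nonneg
  have hf := (hprop _ m1 m2 m3).1 i t hit hti hi ht
  -- By properness one of the two arcs between `i` and `t` has no spoke; in the first case it is the
  -- arc from `t - L` to `i`.
  by_cases h1 : ∃ u, i < u ∧ u < t ∧ G.Adj v (c u)
  · refine h.no_two_attachments h3 hI hprop hb hj hiu huu huj hjw hww hwi hu₁ hu₂ hw₁ hw₂ hmid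
      (x := t - L) (y := i) (by omega) (.inr rfl) ?_ hi ?_
    · rwa [← hc.periodic, sub_add_cancel]
    · intro u a1 a2 a3
      exact hf ⟨h1, u + L, by omega, by omega, by rwa [hc.periodic]⟩
  · push Not at h1
    exact h.no_two_attachments h3 hI hprop hb hj hiu huu huj hjw hww hwi hu₁ hu₂ hw₁ hw₂ hmid
      hit (.inl rfl) hi ht h1

/-- No bad path has ends separated by two spokes on both sides. -/
lemma IsWheel.not_isBadPath_of_two_spokes [Finite V] (h : G.IsWheel L c v) (h3 : G.CliqueFree 3)
    (hI : G.ISK4Free) (hprop : IsProper G L c v)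
    (hmin : ∀ L' c', G.IsWheel L' c' v → IsProper G L' c' v →
      (G.neighborSet v ∩ Set.range c).ncard ≤ (G.neighborSet v ∩ Set.range c').ncard)
    (hb : IsBadPath G L c v p k) {i j : ℤ}
    (hi : G.Adj (p 0) (c i))
    (hj : G.Adj (p k) (c j)) {u₁ u₂ w₁ w₂ : ℤ} (hiu : i < u₁) (huu : u₁ < u₂) (huj : u₂ < j)
    (hjw : j < w₁) (hww : w₁ < w₂) (hwi : w₂ < i + L) (hu₁ : G.Adj v (c u₁))
    (hu₂ : G.Adj v (c u₂)) (hw₁ : G.Adj v (c w₁)) (hw₂ : G.Adj v (c w₂)) : False := by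
  have hc := h.hole
  have hk := hb.one_le hprop
  have hfar : Far G L c v i j := ⟨⟨u₁, by omega, by omega, hu₁⟩, w₁, by omega, by omega, hw₁⟩
  -- An attachment of an inner vertex is far neither from `i` nor from `j`, so it cannot lie beyond
  -- the first spoke of an arc nor before the second one.
  have hmid : ∀ a s, 0 < a → a < k → ¬ G.Adj (p a) (c s) := by
    intro a s a1 a2 hadj
    obtain ⟨t, t1, t2, t3, -⟩ := periodic_exists hc.periodic (by have := hc.four_le; omega) s i
    rw [← t3] at hadj
    rcases lt_trichotomy t j with hlt | rfl | hlt
    · rcases lt_or_eq_of_le t1 with t1 | rfl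
      · have f1 := hb.not_far hc le_rfl (by omega) a1.le a2.le (by omega) (by omega) t1 t2 hi hadj
        have f2 := hb.not_far hc a1.le a2.le (by omega) le_rfl (by omega) (by omega) hlt (by omega)
          hadj hj
        have n1 : ¬ u₁ < t := fun h' =>
          f1 ⟨⟨u₁, hiu, h', hu₁⟩, w₁, by omega, by omega, hw₁⟩
        have n2 : ¬ t < u₂ := fun h' =>
          f2 ⟨⟨u₂, h', huj, hu₂⟩, w₁, by omega, by omega, hw₁⟩
        omega
      · exact hb.not_far hc a1.le a2.le (by omega) le_rfl (by omega) (by omega) hlt (by omega)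
          hadj hj hfar
    · exact hb.not_far hc le_rfl (by omega) a1.le a2.le (by omega) (by omega) (by omega) t2 hi hadj hfar
    · have f1 := hb.not_far hc le_rfl (by omega) a1.le a2.le (by omega) (by omega) (by omega) t2 hi hadj
      have f2 := hb.not_far hc (by omega) le_rfl a1.le a2.le (by omega) (by omega) hlt (by omega)
        hj hadj
      have n1 : ¬ t < w₂ := fun h' =>
        f1 ⟨⟨u₁, hiu, by omega, hu₁⟩, w₂, by omega, by omega, hw₂⟩
      have n2 : ¬ w₁ < t := fun h' =>
        f2 ⟨⟨w₁, by omega, h', hw₁⟩, u₁ + L, by omega, by omega, by rwa [hc.periodic]⟩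
      omega
  have hp0 : ∀ t, i < t → t < i + L → ¬ G.Adj (p 0) (c t) := fun t t1 t2 =>
    h.attachment_unique h3 hI hprop hb hi hj hiu huu huj hjw hww hwi hu₁ hu₂ hw₁ hw₂ hmid t1 t2
  have hpk : ∀ t, j < t → t < j + L → ¬ G.Adj (p k) (c t) := by
    intro t t1 t2 t3
    refine h.attachment_unique h3 hI hprop (hb.reverse hc) (i := j) (j := i + L)
      (by simpa using hj) (by simpa [hc.periodic] using hi) hjw hww hwi
      (w₁ := u₁ + L) (w₂ := u₂ + L) (by omega) (by omega) (by omega) hw₁ hw₂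
      (by rwa [hc.periodic]) (by rwa [hc.periodic])
      (fun a s a1 a2 => hmid _ s (by omega) (by omega)) t1 t2 (by simpa using t3)
  have hatt : ∀ t s, 0 ≤ t → t ≤ k → G.Adj (p t) (c s) →
      (t = 0 ∧ c s = c i) ∨ (t = k ∧ c s = c j) := by
    intro t s t1 t2 hadj
    rcases lt_or_eq_of_le t1 with t1 | rfl
    · rcases lt_or_eq_of_le t2 with t2 | rfl
      · exact absurd hadj (hmid t s t1 t2)
      · obtain ⟨s', s1, s2, s3⟩ := hc.exists_window ⟨s, rfl⟩ j
        rw [← s3] at hadj ⊢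
        rcases lt_or_eq_of_le s1 with s1 | rfl
        · exact absurd hadj (hpk s' s1 s2)
        · exact .inr ⟨rfl, rfl⟩
    · obtain ⟨s', s1, s2, s3⟩ := hc.exists_window ⟨s, rfl⟩ i
      rw [← s3] at hadj ⊢
      rcases lt_or_eq_of_le s1 with s1 | rfl
      · exact absurd hadj (hp0 s' s1 s2)
      · exact .inl ⟨rfl, rfl⟩
  have hwin : ∀ s, j ≤ s → s ≤ i + L → (c s = c i → s = i + L) ∧ (c s = c j → s = j) := by
    intro s s1 s2
    refine ⟨fun hs => ?_, fun hs => (hc.inj_window j s1 (by omega) le_rfl (by omega)).1 hs⟩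
    rw [← hc.periodic i] at hs
    exact (hc.inj_window j s1 (by omega) (by omega) (by omega)).1 hs
  have hpc : ∀ t s, 0 ≤ t → t ≤ k → p t ≠ c s := fun t s t1 t2 h' =>
    (hb.seq.mem t t1 t2).2.2 ⟨s, h'.symm⟩
  refine h.no_reroute h3 hI hprop hmin hb (i := i) (j := j) (by omega) (by omega) hi hj hfar
    ?_ ?_ ?_ ?_
  · intro t s t1 t2 s1 s2 hadj
    rcases hatt t s t1 t2 hadj with ⟨e1, e2⟩ | ⟨e1, e2⟩
    · exact .inl ⟨e1, (hwin s s1 s2).1 e2⟩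
    · exact .inr ⟨e1, (hwin s s1 s2).2 e2⟩
  · rintro q a z hq a1 a2 ha hb' hpq z1 z2 hz hz' ⟨x, x1, x2, x3⟩ ⟨y, y1, y2, y3⟩
    obtain ⟨q1, q2, q3⟩ := hq
    have hqC : ∀ s, G.Adj q (c s) → c s = c z := by
      intro s hs
      obtain ⟨s', s1, s2, s3⟩ := hc.exists_window ⟨s, rfl⟩ i
      rw [← s3] at hs ⊢
      rcases eq_or_ne s' i with rfl | hne
      · rw [← hc.periodic] at hs ⊢
        rw [hz' _ (by omega) le_rfl hs]
      rcases lt_or_ge s' j with hlt | hlt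
      · exact absurd ⟨⟨x, by omega, by omega, x3⟩, y, by omega, by omega, y3⟩
          ((hprop q q1 q2 q3).1 s' z (by omega) (by omega) hs hz)
      · rw [hz' s' hlt (by omega) hs]
    -- The path with `q` would send exactly three edges to the original rim.
    refine no_three_edges h3 hI hc.isHoleSet
      (hb.ipath.isConnOn.insert (x := q) ⟨a, ⟨a1, a2⟩, rfl⟩ ha)
      (a₁ := c i) (a₂ := c j) (a₃ := c z) (t₁ := p 0) (t₂ := p k) (t₃ := q)
      (hc.ne _ _ (by omega) (by omega)) (hc.ne _ _ (by omega) (by omega))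
      (hc.ne _ _ (by omega) (by omega)) ⟨_, rfl⟩ ⟨_, rfl⟩ ⟨_, rfl⟩
      (.inr ⟨0, ⟨le_rfl, by omega⟩, rfl⟩) (.inr ⟨k, ⟨by omega, le_rfl⟩, rfl⟩) (.inl rfl)
      hi.symm hj.symm hz.symm ?_ ?_
    · rintro _ ⟨s, rfl⟩ (hs | ⟨t, ⟨t1, t2⟩, ht⟩)
      · exact q3 ⟨s, hs⟩
      · exact hpc t s t1 t2 ht
    · rintro _ ⟨s, rfl⟩ _ (rfl | ⟨t, ⟨t1, t2⟩, rfl⟩) hadj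
      · exact .inr (.inr ⟨hqC s hadj.symm, rfl⟩)
      · rcases hatt t s t1 t2 hadj.symm with ⟨rfl, e2⟩ | ⟨rfl, e2⟩
        · exact .inl ⟨e2, rfl⟩
        · exact .inr (.inl ⟨e2, rfl⟩)
  · intro s s1 s2 _ a b a1 a2 _ _ ha _
    rcases hatt a s a1 a2 ha with ⟨-, e⟩ | ⟨-, e⟩
    · exact absurd e.symm (hc.ne _ _ s1 (by omega))
    · exact absurd e (hc.ne _ _ s2 (by omega))
  · by_contra hlt
    have honly : ∀ u, j ≤ u → u ≤ i + L → G.Adj v (c u) → u = w₁ ∨ u = w₂ := by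
      intro u a1 a2 a3
      by_contra hne
      push Not at hne
      refine hlt (three_le_ncard_of_mem ((Set.finite_Icc _ _).image _ |>.inter_of_right _)
        ⟨hw₁, w₁, ⟨by omega, by omega⟩, rfl⟩ ⟨hw₂, w₂, ⟨by omega, by omega⟩, rfl⟩
        ⟨a3, u, ⟨a1, a2⟩, rfl⟩ (hc.ne _ _ hww (by omega)) ?_ ?_)
      · rw [Ne, hc.inj_window j (by omega) (by omega) a1 (by omega)]
        exact fun h' => hne.1 h'.symm
      · rw [Ne, hc.inj_window j (by omega) (by omega) a1 (by omega)]
        exact fun h' => hne.2 h'.symm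
    have hg := hc.spoke_gap h3 hu₁ hu₂ huu
    -- If `w₁` and `w₂` are the only spokes retained, the reversed path closes the arc from `j` to
    -- `i + L`; the spoke after this arc is `u₁ + L` or earlier spokes are not needed.
    refine h.no_arc_two h3 hI (i := j) (j := i + L) (e := u₁ + L) (by omega : 0 ≤ k)
      (hb.reverse hc).ipath hjw hww hwi (by omega) (by omega) hw₁ hw₂ (by rwa [hc.periodic]) honly
      ?_ ?_ ?_
    · intro t t1 t2
      obtain ⟨m1, m2, m3⟩ := hb.seq.mem (k - t) (by omega) (by omega)
      exact ⟨m1, m2⟩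
    · intro t s t1 t2 _ _
      exact hpc _ s (by omega) (by omega)
    · intro t s t1 t2 s1 s2
      constructor
      · intro hadj
        rcases hatt (k - t) s (by omega) (by omega) hadj with ⟨e1, e2⟩ | ⟨e1, e2⟩
        · refine .inr ⟨by omega, ?_⟩
          rw [← hc.periodic i] at e2
          exact (hc.inj_window j s1 (by omega) (by omega) (by omega)).1 e2
        · exact .inl ⟨by omega, (hc.inj_window j s1 (by omega) le_rfl (by omega)).1 e2⟩
      · rintro (⟨rfl, rfl⟩ | ⟨rfl, rfl⟩)
        · simpa using hj
        · simpa [hc.periodic] using hi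

end Wheel

end SimpleGraph

/-! ### Bad paths with a single spoke on one side -/

namespace SimpleGraph

variable {V : Type*} {G : SimpleGraph V}

section Wheel

variable {L : ℤ} {c : ℤ → V} {v : V} {p : ℤ → V} {k : ℤ}

/-- The last vertex before `w` attached to one of two adjacent vertices. -/
lemma exists_last_attached (h3 : G.CliqueFree 3) {i w : ℤ} {y z : V} (hyz : G.Adj y z)
    (hiw : i < w) (hy : G.Adj (c (i + 1)) y) :
    ∃ l x, i < l ∧ l ≤ w ∧ (x = y ∨ x = z) ∧ G.Adj (c l) x ∧
      ∀ t, l ≤ t → t ≤ w → ∀ x', (x' = y ∨ x' = z) → G.Adj (c t) x' → t = l ∧ x' = x := by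
  obtain ⟨l, l1, l2, l3, l4⟩ := exists_greatest_int
    (p := fun t => G.Adj (c t) y ∨ G.Adj (c t) z) (show i + 1 ≤ w by omega) (.inl hy)
  have hl : ∀ t, l ≤ t → t ≤ w → (G.Adj (c t) y ∨ G.Adj (c t) z) → t = l := by
    intro t t1 t2 t3
    by_contra hne
    exact l4 t (by omega) t2 t3
  rcases l3 with l3 | l3
  · refine ⟨l, y, by omega, l2, .inl rfl, l3, fun t t1 t2 x' hx' hadj => ?_⟩
    rcases hx' with rfl | rfl
    · exact ⟨hl t t1 t2 (.inl hadj), rfl⟩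
    · obtain rfl := hl t t1 t2 (.inr hadj)
      -- The vertices `y` and `z` are adjacent, so they have no common neighbour; hence a single
      -- edge is found at `l`.
      exact (h3.not_triangle l3 hyz hadj).elim
  · refine ⟨l, z, by omega, l2, .inr rfl, l3, fun t t1 t2 x' hx' hadj => ?_⟩
    rcases hx' with rfl | rfl
    · obtain rfl := hl t t1 t2 (.inl hadj)
      exact (h3.not_triangle hadj hyz l3).elim
    · exact ⟨hl t t1 t2 (.inr hadj), rfl⟩

/-- A path along two consecutive sectors that avoids their common spoke is attached to that
spoke. -/
lemma IsWheel.exists_attached_spoke (h : G.IsWheel L c v) (h3 : G.CliqueFree 3) (hI : G.ISK4Free)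
    (hp : G.IsIPath p 0 k) (hk : 1 ≤ k) (hpo : ∀ t, 0 ≤ t → t ≤ k → p t ∈ offWheel G c v)
    {e₁ i w j e₂ : ℤ} (hei : e₁ ≤ i) (hiw : i < w) (hwj : w < j) (hje : j ≤ e₂)
    (hee : e₂ + 2 ≤ e₁ + L) (he₁ : G.Adj v (c e₁)) (hw : G.Adj v (c w)) (he₂ : G.Adj v (c e₂))
    (hfeet : ∀ u, e₁ ≤ u → u ≤ e₂ → G.Adj v (c u) → u = e₁ ∨ u = w ∨ u = e₂)
    (hp0 : G.Adj (p 0) (c i)) (hpk : G.Adj (p k) (c j))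
    (hp0' : ∀ s, e₁ ≤ s → s ≤ e₂ → G.Adj (p 0) (c s) → i ≤ s ∧ s ≤ w)
    (hpk' : ∀ s, e₁ ≤ s → s ≤ e₂ → G.Adj (p k) (c s) → w ≤ s ∧ s ≤ j)
    (hmid : ∀ t s, 0 < t → t < k → e₁ ≤ s → s ≤ e₂ → ¬ G.Adj (p t) (c s)) : False := by
  have hc := h.hole
  have hpc : ∀ t s, 0 ≤ t → t ≤ k → c s ≠ p t := fun t s h1 h2 h' => (hpo t h1 h2).2.2 ⟨s, h'⟩
  have hpv : ∀ t, 0 ≤ t → t ≤ k → p t ≠ v := fun t h1 h2 => (hpo t h1 h2).1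
  have hpv' : ∀ t, 0 ≤ t → t ≤ k → ¬ G.Adj v (p t) := fun t h1 h2 => (hpo t h1 h2).2.1
  have hatt : ∀ t s, 0 ≤ t → t ≤ k → e₁ ≤ s → s ≤ e₂ → G.Adj (p t) (c s) →
      (t = 0 ∧ i ≤ s ∧ s ≤ w) ∨ (t = k ∧ w ≤ s ∧ s ≤ j) := by
    intro t s t1 t2 s1 s2 hadj
    rcases eq_or_ne t 0 with rfl | n1
    · exact .inl ⟨rfl, hp0' s s1 s2 hadj⟩
    rcases eq_or_ne t k with rfl | n2
    · exact .inr ⟨rfl, hpk' s s1 s2 hadj⟩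
    · exact absurd hadj (hmid t s (by omega) (by omega) s1 s2)
  -- The hole consists of the rim from `e₁` to `i`, the path `p`, the rim from `j` to `e₂`, and the
  -- hub.
  have hA : G.IsIPath (glueSeq c i p 0) e₁ (i + 1 + (k - 0)) := by
    refine (hc.isIPath (by omega)).glue hp (fun s t _ _ t1 t2 => hpc t s t1 t2) ?_
    intro s t s1 s2 t1 t2
    rw [G.adj_comm]
    constructor
    · intro hadj
      have := hatt t s t1 t2 s1 (by omega) hadj
      omega
    · rintro ⟨rfl, rfl⟩
      exact hp0
  have hB : G.IsIPath (glueSeq c e₂ (fun _ => v) 0) j (e₂ + 1 + (0 - 0)) := by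
    refine (hc.isIPath (by omega)).glue (isIPath_self _ _) (fun s t _ _ _ _ => h.ne s) ?_
    intro s t s1 s2 t1 t2
    rw [G.adj_comm]
    constructor
    · intro hadj
      have := hfeet s (by omega) s2 hadj
      omega
    · rintro ⟨rfl, rfl⟩
      exact he₂
  have hH := isHoleSet_glue hA hB (by omega) (by omega) (by omega) (by
    intro s t s1 s2 t1 t2
    unfold glueSeq
    split_ifs
    · exact hc.ne _ _ (by omega) (by omega)
    · exact h.ne _
    · exact (hpc _ _ (by omega) (by omega)).symm
    · exact hpv _ (by omega) (by omega)) (by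
    intro s t s1 s2 t1 t2
    unfold glueSeq
    split_ifs with h1 h2 h2
    · rw [hc.adj _ _ (by omega) (by omega)]
      omega
    · rw [G.adj_comm]
      constructor
      · intro hadj
        have := hfeet s (by omega) (by omega) hadj
        omega
      · intro hst
        obtain rfl : s = e₁ := by omega
        exact he₁
    · constructor
      · intro hadj
        have := hatt _ _ (by omega) (by omega) (by omega) h2 hadj
        omega
      · intro hst
        obtain ⟨e1, e2⟩ : s - i - 1 + 0 = k ∧ t = j := by omega
        rw [e1, e2]
        exact hpk
    · constructor
      · intro hadj
        exact absurd hadj.symm (hpv' _ (by omega) (by omega))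
      · omega)
  rw [image_glueSeq _ _ _ _ _ _ hei (by omega), image_glueSeq _ _ _ _ _ _ hje le_rfl] at hH
  -- The arc from `l` to `r` around the spoke `w` starts at the last vertex adjacent to `c i` or `p
  -- 0` and ends at the first one adjacent to `c j` or `p k`. Thus it sends three edges to the hole:
  -- one at each end, and the spoke at `w`.
  obtain ⟨l, x, l1, l2, l3, l4, l5⟩ := exists_last_attached (c := c) h3 hp0.symm hiw
    (hc.adj_succ i).symm
  -- The other side is handled by the same lemma on the reflected rim.
  obtain ⟨r, y, r1, r2, r3, r4, r5⟩ := exists_last_attached (c := fun t => c (-t)) (i := -j)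
    (w := -w) h3 hpk.symm (by omega) (by
      have := hc.adj_succ (j - 1)
      rw [sub_add_cancel] at this
      rwa [show -(-j + 1) = j - 1 by ring])
  obtain ⟨r, rfl⟩ : ∃ r', r = -r' := ⟨-r, by ring⟩
  rw [neg_neg] at r4
  have r5' : ∀ t, w ≤ t → t ≤ r → ∀ x', (x' = c j ∨ x' = p k) → G.Adj (c t) x' →
      t = r ∧ x' = y := by
    intro t t1 t2 x' hx' hadj
    have := r5 (-t) (by omega) (by omega) x' hx' (by rwa [neg_neg])
    exact ⟨by omega, this.2⟩
  refine no_three_edges h3 hI hH (hc.isConnOn_arc l r) (a₁ := v) (a₂ := x) (a₃ := y)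
    (t₁ := c w) (t₂ := c l) (t₃ := c r) ?_ ?_ ?_ (.inr (.inr ⟨0, ⟨le_rfl, le_rfl⟩, rfl⟩)) ?_ ?_
    ⟨w, ⟨by omega, by omega⟩, rfl⟩ ⟨l, ⟨by omega, by omega⟩, rfl⟩
    ⟨r, ⟨by omega, by omega⟩, rfl⟩ hw l4.symm r4.symm ?_ ?_
  · rcases l3 with rfl | rfl
    · exact (h.ne _).symm
    · exact (hpv 0 le_rfl (by omega)).symm
  · rcases r3 with rfl | rfl
    · exact (h.ne _).symm
    · exact (hpv k (by omega) le_rfl).symm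
  · rcases l3 with rfl | rfl <;> rcases r3 with rfl | rfl
    · exact hc.ne _ _ (by omega) (by omega)
    · exact hpc _ _ (by omega) le_rfl
    · exact (hpc _ _ le_rfl (by omega)).symm
    · exact (hp 0 k le_rfl (by omega) le_rfl).1
  · rcases l3 with rfl | rfl
    · exact .inl (.inl ⟨i, ⟨hei, le_rfl⟩, rfl⟩)
    · exact .inl (.inr ⟨0, ⟨le_rfl, by omega⟩, rfl⟩)
  · rcases r3 with rfl | rfl
    · exact .inr (.inl ⟨j, ⟨le_rfl, hje⟩, rfl⟩)
    · exact .inl (.inr ⟨k, ⟨by omega, le_rfl⟩, rfl⟩)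
  · rintro _ ((⟨s, ⟨s1, s2⟩, rfl⟩ | ⟨t, ⟨t1, t2⟩, rfl⟩) | ⟨s, ⟨s1, s2⟩, rfl⟩ | ⟨t, -, rfl⟩)
      ⟨u, ⟨u1, u2⟩, hu⟩
    · exact hc.ne s u (by omega) (by omega) hu.symm
    · exact hpc t u t1 t2 hu
    · exact hc.ne u s (by omega) (by omega) hu
    · exact h.ne u hu
  · rintro _ ((⟨s, ⟨s1, s2⟩, rfl⟩ | ⟨t, ⟨t1, t2⟩, rfl⟩) | ⟨s, ⟨s1, s2⟩, rfl⟩ | ⟨t, -, rfl⟩)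
      _ ⟨u, ⟨u1, u2⟩, rfl⟩ hadj
    · have := (hc.adj s u (by omega) (by omega)).1 hadj
      obtain rfl : s = i := by omega
      obtain ⟨e1, e2⟩ := l5 u u1 (by omega) _ (.inl rfl) hadj.symm
      exact .inr (.inl ⟨e2, by rw [e1]⟩)
    · rcases hatt t u t1 t2 (by omega) (by omega) hadj with ⟨rfl, b1, b2⟩ | ⟨rfl, b1, b2⟩
      · obtain ⟨e1, e2⟩ := l5 u u1 b2 _ (.inr rfl) hadj.symm
        exact .inr (.inl ⟨e2, by rw [e1]⟩)
      · obtain ⟨e1, e2⟩ := r5' u b1 u2 _ (.inr rfl) hadj.symm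
        exact .inr (.inr ⟨e2, by rw [e1]⟩)
    · have := (hc.adj u s (by omega) (by omega)).1 hadj.symm
      obtain rfl : s = j := by omega
      obtain ⟨e1, e2⟩ := r5' u (by omega) u2 _ (.inl rfl) hadj.symm
      exact .inr (.inr ⟨e2, by rw [e1]⟩)
    · have := hfeet u (by omega) (by omega) hadj
      obtain rfl : u = w := by omega
      exact .inl ⟨rfl, rfl⟩

/-- A path between the ends of an arc of the rim whose first vertex has a neighbour attached to
the last sector of the arc. -/
lemma IsWheel.no_detour (h : G.IsWheel L c v) (h3 : G.CliqueFree 3) (hI : G.ISK4Free)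
    (hp : G.IsIPath p 0 k) (hk : 1 ≤ k) (hpo : ∀ t, 0 ≤ t → t ≤ k → p t ∈ offWheel G c v)
    {q : V} (hqo : q ∈ offWheel G c v) (hpq : ∀ t, 0 ≤ t → t ≤ k → p t ≠ q)
    {i j e g z : ℤ} (hij : i + 2 ≤ j) (hje : j ≤ e) (heg : e < g) (hgz : g ≤ z) (hzi : z < i + L)
    (hi : G.Adj v (c i)) (he : G.Adj v (c e)) (hg : G.Adj v (c g))
    (hgi : ∀ u, g < u → u < i + L → ¬ G.Adj v (c u))
    (hq : ∀ t, 0 ≤ t → t ≤ k → (G.Adj q (p t) ↔ t = 0))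
    (hqc : ∀ s, j ≤ s → s ≤ i + L → (G.Adj q (c s) ↔ s = z))
    (hp0 : ∀ s, j ≤ s → s ≤ i + L → (G.Adj (p 0) (c s) ↔ s = i + L))
    (hpt : ∀ t s, 0 < t → t ≤ k → z ≤ s → s ≤ i + L → ¬ G.Adj (p t) (c s))
    (hpk : G.Adj (p k) (c j)) : False := by
  have hc := h.hole
  have hpc : ∀ t s, 0 ≤ t → t ≤ k → c s ≠ p t := fun t s h1 h2 h' => (hpo t h1 h2).2.2 ⟨s, h'⟩
  have hpv : ∀ t, 0 ≤ t → t ≤ k → p t ≠ v := fun t h1 h2 => (hpo t h1 h2).1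
  have hpv' : ∀ t, 0 ≤ t → t ≤ k → ¬ G.Adj v (p t) := fun t h1 h2 => (hpo t h1 h2).2.1
  obtain ⟨q1, q2, q3⟩ := hqo
  have hcq : ∀ s, c s ≠ q := fun s hs => q3 ⟨s, hs⟩
  have hi' : G.Adj v (c (i + L)) := by rwa [hc.periodic]
  have hge := hc.spoke_gap h3 he hg heg
  have hB : G.IsIPath (glueSeq (fun _ => p 0) 0 (fun _ => q) 0) 0 (0 + 1 + (0 - 0)) := by
    refine (isIPath_self _ 0).glue (isIPath_self _ 0)
      (fun _ _ _ _ _ _ => hpq 0 le_rfl (by omega)) ?_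
    intro s t s1 s2 t1 t2
    refine iff_of_true ((hq 0 le_rfl (by omega)).2 rfl).symm (by omega)
  -- The hole consists of the rim from `z` to `i + L`, then `p 0` and `q`.
  have hH := isHoleSet_glue (hc.isIPath (a := z) (b := i + L) (by omega)) hB (by omega) (by omega)
    (by omega) (by
      intro s t s1 s2 t1 t2
      unfold glueSeq
      split_ifs
      · exact hpc _ _ le_rfl (by omega)
      · exact hcq s) (by
      intro s t s1 s2 t1 t2
      unfold glueSeq
      split_ifs
      · rw [G.adj_comm, hp0 s (by omega) s2]
        omega
      · rw [G.adj_comm, hqc s (by omega) s2]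
        omega)
  rw [image_glueSeq _ _ _ _ _ _ le_rfl le_rfl] at hH
  -- the piece of the rim between the hub and the hole
  obtain ⟨A, t₃, hA, hvA, ht₃, hzt, hA'⟩ : ∃ A t₃, G.IsConnOn A ∧ v ∈ A ∧ t₃ ∈ A ∧
      G.Adj (c z) t₃ ∧ ∀ x ∈ A, (x = v ∧ (G.Adj v (c z) → t₃ = v)) ∨
        ∃ t, g ≤ t ∧ t < z ∧ x = c t ∧ (t = z - 1 → t₃ = x) := by
    rcases lt_or_eq_of_le hgz with hlt | rfl
    · refine ⟨_, c (z - 1), (hc.isConnOn_arc g (z - 1)).insert (x := v)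
        ⟨g, ⟨le_rfl, by omega⟩, rfl⟩ hg, .inl rfl, .inr ⟨z - 1, ⟨by omega, le_rfl⟩, rfl⟩, ?_, ?_⟩
      · have := hc.adj_succ (z - 1)
        rw [sub_add_cancel] at this
        exact this.symm
      · rintro x (rfl | ⟨t, ⟨t1, t2⟩, rfl⟩)
        · exact .inl ⟨rfl, fun h' => absurd h' (hgi z hlt hzi)⟩
        · exact .inr ⟨t, t1, by omega, rfl, fun h' => by rw [h']⟩
    · exact ⟨{v}, v, isConnOn_singleton v, rfl, rfl, hg.symm, fun x hx => .inl ⟨hx, fun _ => rfl⟩⟩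
  -- The connected set runs from the hub along the spoke `e` and the rim to `c j`, then back along
  -- `p` to `p 1`, and also contains the rim from `g` to just before `z`. Its edges to the hole end
  -- at `p 0`, `c (i + L)` and `c z`.
  have hT := (hA.union (hc.isConnOn_arc j e) hvA ⟨e, ⟨hje, le_rfl⟩, rfl⟩ he).union
    (hp.mono (show (0 : ℤ) ≤ 1 by omega) le_rfl).isConnOn (.inr ⟨j, ⟨le_rfl, hje⟩, rfl⟩)
    ⟨k, ⟨hk, le_rfl⟩, rfl⟩ hpk.symm
  refine no_three_edges h3 hI hH hT (a₁ := p 0) (a₂ := c (i + L)) (a₃ := c z) (t₁ := p 1)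
    (t₂ := v) (t₃ := t₃) (hpc _ _ le_rfl (by omega)).symm (hpc _ _ le_rfl (by omega)).symm
    (hc.ne _ _ hzi (by omega)).symm (.inr (.inl ⟨0, ⟨le_rfl, le_rfl⟩, rfl⟩))
    (.inl ⟨i + L, ⟨by omega, le_rfl⟩, rfl⟩) (.inl ⟨z, ⟨le_rfl, by omega⟩, rfl⟩)
    (.inr ⟨1, ⟨le_rfl, hk⟩, rfl⟩) (.inl (.inl hvA)) (.inl (.inl ht₃))
    (hp.adj_succ le_rfl (by omega)) hi'.symm hzt ?_ ?_
  · rintro _ (⟨s, ⟨s1, s2⟩, rfl⟩ | ⟨t, -, rfl⟩ | ⟨t, -, rfl⟩)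
      ((hx | ⟨u, ⟨u1, u2⟩, hu⟩) | ⟨u, ⟨u1, u2⟩, hu⟩)
    · rcases hA' _ hx with ⟨h', -⟩ | ⟨u, u1, u2, h', -⟩
      · exact h.ne s h'
      · exact hc.ne u s (by omega) (by omega) h'.symm
    · exact hc.ne u s (by omega) (by omega) hu
    · exact hpc u s (by omega) u2 hu.symm
    · rcases hA' _ hx with ⟨h', -⟩ | ⟨u, u1, u2, h', -⟩
      · exact hpv 0 le_rfl (by omega) h'
      · exact hpc 0 u le_rfl (by omega) h'.symm
    · exact hpc 0 u le_rfl (by omega) hu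
    · exact (hp 0 u le_rfl (by omega) u2).1 hu.symm
    · rcases hA' _ hx with ⟨h', -⟩ | ⟨u, u1, u2, h', -⟩
      · exact q1 h'
      · exact hcq u h'.symm
    · exact hcq u hu
    · exact hpq u (by omega) u2 hu
  · rintro _ (⟨s, ⟨s1, s2⟩, rfl⟩ | ⟨t, -, rfl⟩ | ⟨t, -, rfl⟩)
      y ((hx | ⟨u, ⟨u1, u2⟩, rfl⟩) | ⟨u, ⟨u1, u2⟩, rfl⟩) hadj
    · rcases hA' _ hx with ⟨rfl, h'⟩ | ⟨u, u1, u2, rfl, h'⟩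
      · rcases lt_or_eq_of_le s1 with s1 | rfl
        · rcases lt_or_eq_of_le s2 with s2 | rfl
          · exact absurd hadj.symm (hgi s (by omega) s2)
          · exact .inr (.inl ⟨rfl, rfl⟩)
        · exact .inr (.inr ⟨rfl, (h' hadj.symm).symm⟩)
      · have := (hc.adj u s (by omega) (by omega)).1 hadj.symm
        obtain rfl : s = z := by omega
        exact .inr (.inr ⟨rfl, (h' (by omega)).symm⟩)
    · have := (hc.adj u s (by omega) (by omega)).1 hadj.symm
      omega
    · exact absurd hadj.symm (hpt u s (by omega) u2 s1 s2)
    · rcases hA' _ hx with ⟨rfl, -⟩ | ⟨u, u1, u2, rfl, -⟩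
      · exact absurd hadj.symm (hpv' 0 le_rfl (by omega))
      · have := (hp0 u (by omega) (by omega)).1 hadj
        omega
    · have := (hp0 u (by omega) (by omega)).1 hadj
      omega
    · have := (hp 0 u le_rfl (by omega) u2).2.1 hadj
      exact .inl ⟨rfl, by rw [this, zero_add]⟩
    · rcases hA' _ hx with ⟨rfl, -⟩ | ⟨u, u1, u2, rfl, -⟩
      · exact absurd hadj.symm q2
      · have := (hqc u (by omega) (by omega)).1 hadj
        omega
    · have := (hqc u (by omega) (by omega)).1 hadj
      omega
    · have := (hq u (by omega) u2).1 hadj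
      omega

end Wheel

end SimpleGraph

namespace SimpleGraph

variable {V : Type*} {G : SimpleGraph V}

section Wheel

variable {L : ℤ} {c : ℤ → V} {v : V} {p : ℤ → V} {k : ℤ}

/-- No bad path has ends separated by only one spoke on one side. -/
lemma IsWheel.not_isBadPath_of_one_spoke [Finite V] (h : G.IsWheel L c v) (h3 : G.CliqueFree 3)
    (hI : G.ISK4Free) (hprop : IsProper G L c v)
    (hmin : ∀ L' c', G.IsWheel L' c' v → IsProper G L' c' v →
      (G.neighborSet v ∩ Set.range c).ncard ≤ (G.neighborSet v ∩ Set.range c').ncard)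
    (hb : IsBadPath G L c v p k) {i w j f : ℤ} (hiw : i < w) (hwj : w < j) (hjf : j < f)
    (hfi : f < i + L) (hi : G.Adj (p 0) (c i)) (hj : G.Adj (p k) (c j)) (hw : G.Adj v (c w))
    (hw' : ∀ u, i < u → u < j → G.Adj v (c u) → u = w) (hf : G.Adj v (c f)) : False := by
  have hc := h.hole
  have hk := hb.one_le hprop
  -- The spokes `e₁`, `w`, `e₂` are consecutive; `f'` below is a fourth one outside the two sectors.
  obtain ⟨e₁, a1, a2, he₁, a4⟩ := exists_greatest_int (p := fun u => G.Adj v (c u))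
    (show f - L ≤ i by omega) (by rwa [← hc.periodic, sub_add_cancel])
  obtain ⟨e₂, b1, b2, he₂, b4⟩ := exists_least_int (p := fun u => G.Adj v (c u)) hjf.le hf
  have he₁L : G.Adj v (c (e₁ + L)) := by rwa [hc.periodic]
  have hfeet : ∀ u, e₁ ≤ u → u ≤ e₂ → G.Adj v (c u) → u = e₁ ∨ u = w ∨ u = e₂ := by
    intro u u1 u2 u3
    by_contra! hne
    by_cases d1 : u ≤ i
    · exact a4 u (by omega) d1 u3
    by_cases d2 : j ≤ u
    · exact b4 u d2 (by omega) u3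
    · exact hne.2.1 (hw' u (by omega) (by omega) u3)
  obtain ⟨f', f1, f2, hf', f4, f5, f6⟩ := h.exists_spoke h3 hI e₁ e₁ w e₂
  have hef : e₂ < f' := by
    by_contra hlt
    have := hfeet f' f1 (by omega) hf'
    omega
  have hg1 := hc.spoke_gap h3 he₂ hf' hef
  have hg2 := hc.spoke_gap h3 hf' he₁L f2
  clear hjf hfi hf b2 a1
  -- `i` and `j` are moved outwards to the extreme attachments of the path's ends within these
  -- sectors, so the arc to be replaced contains all attachments there.
  obtain ⟨i', c1, c2, hi', c4⟩ := exists_least_int (p := fun s => G.Adj (p 0) (c s)) a2 hi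
  obtain ⟨j', d1, d2, hj', d4⟩ := exists_greatest_int (p := fun s => G.Adj (p k) (c s)) b1 hj
  clear hw' hi hj a4 b4
  replace hiw : i' < w := by omega
  replace hwj : w < j' := by omega
  clear a2 b1 c2 d1
  clear i j
  rename' i' => i, j' => j
  have hfar : Far G L c v i j := ⟨⟨w, hiw, hwj, hw⟩, f', by omega, by omega, hf'⟩
  have hp0' : ∀ s, e₁ ≤ s → s ≤ e₂ → G.Adj (p 0) (c s) → i ≤ s ∧ s ≤ w := by
    intro s s1 s2 hs
    have n1 : i ≤ s := by
      by_contra hlt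
      exact c4 s s1 (by omega) hs
    refine ⟨n1, ?_⟩
    by_contra hlt
    exact hb.not_far hc le_rfl (by omega) le_rfl (by omega) (by omega) (by omega) (s := i) (t := s)
      (by omega) (by omega) hi' hs ⟨⟨w, hiw, by omega, hw⟩, f', by omega, by omega, hf'⟩
  have hpk' : ∀ s, e₁ ≤ s → s ≤ e₂ → G.Adj (p k) (c s) → w ≤ s ∧ s ≤ j := by
    intro s s1 s2 hs
    have n1 : s ≤ j := by
      by_contra hlt
      exact d4 s (by omega) s2 hs
    refine ⟨?_, n1⟩
    by_contra hlt
    exact hb.not_far hc (by omega) le_rfl (by omega) le_rfl (by omega) (by omega) (s := s) (t := j)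
      (by omega) (by omega) hs hj' ⟨⟨w, by omega, hwj, hw⟩, f', by omega, by omega, hf'⟩
  -- In the two sectors an inner vertex can be attached to `c w` only: any other place is far from
  -- `i` or from `j`.
  have hmid : ∀ a s, 0 < a → a < k → e₁ ≤ s → s ≤ e₂ → G.Adj (p a) (c s) → s = w := by
    intro a s ha hak s1 s2 hs
    rcases lt_trichotomy s w with hlt | rfl | hlt
    · exact absurd ⟨⟨w, hlt, hwj, hw⟩, f', by omega, by omega, hf'⟩
        (hb.not_far hc ha.le hak.le (by omega) le_rfl (by omega) (by omega) (s := s) (t := j)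
          (by omega) (by omega) hs hj')
    · rfl
    · exact absurd ⟨⟨w, hiw, hlt, hw⟩, f', by omega, by omega, hf'⟩
        (hb.not_far hc le_rfl (by omega) ha.le hak.le (by omega) (by omega) (s := i) (t := s)
          (by omega) (by omega) hi' hs)
  obtain ⟨a, ha, hak, haw⟩ : ∃ a, 0 < a ∧ a < k ∧ G.Adj (p a) (c w) := by
    by_contra! hno
    refine h.exists_attached_spoke h3 hI hb.ipath hk hb.seq.mem c1 hiw hwj d2 (by omega) he₁ hw he₂
      hfeet hi' hj' hp0' hpk' ?_
    intro t s t1 t2 s1 s2 hs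
    obtain rfl := hmid t s t1 t2 s1 s2 hs
    exact hno t t1 t2 hs
  -- The inner vertex `p a` is less than `k` away from every vertex of the path, so no attachment
  -- can be far from `w`.
  have hout : ∀ b s, 0 ≤ b → b ≤ k → e₂ < s → s < e₁ + L → ¬ G.Adj (p b) (c s) := by
    intro b s b1 b2 s1 s2 hs
    exact hb.not_far hc ha.le hak.le b1 b2 (by omega) (by omega) (s := w) (t := s) (by omega)
      (by omega) haw hs ⟨⟨e₂, by omega, s1, he₂⟩, e₁ + L, s2, by omega, he₁L⟩
  have hadj : ∀ t s, 0 ≤ t → t ≤ k → j ≤ s → s ≤ i + L → G.Adj (p t) (c s) →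
      (t = 0 ∧ s = i + L) ∨ (t = k ∧ s = j) := by
    intro t s t1 t2 s1 s2 hs
    obtain ⟨s', hs', n1, n2, n3⟩ : ∃ s', G.Adj (p t) (c s') ∧ e₁ ≤ s' ∧ s' ≤ e₂ ∧
        (s' = s ∨ s' = s - L) := by
      by_cases m1 : s ≤ e₂
      · exact ⟨s, hs, by omega, m1, .inl rfl⟩
      by_cases m2 : s < e₁ + L
      · exact absurd hs (hout t s t1 t2 (by omega) m2)
      · exact ⟨s - L, by rwa [← hc.periodic, sub_add_cancel], by omega, by omega, .inr rfl⟩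
    rcases eq_or_ne t 0 with rfl | m1
    · have := hp0' s' n1 n2 hs'
      omega
    rcases eq_or_ne t k with rfl | m2
    · have := hpk' s' n1 n2 hs'
      omega
    · have := hmid t s' (by omega) (by omega) n1 n2 hs'
      omega
  refine h.no_reroute h3 hI hprop hmin hb (by omega) (by omega) hi' hj' hfar hadj ?_ ?_ ?_
  · rintro q b z hq b1 b2 hqb hqb' hpq z1 z2 hz hz' ⟨x, x1, x2, x3⟩ ⟨y, y1, y2, y3⟩
    have hez : e₂ < z := by
      by_contra hlt
      have := hfeet x (by omega) (by omega) x3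
      omega
    have hze : z < e₁ + L := by
      by_contra hlt
      have := hfeet (y - L) (by omega) (by omega) (by rwa [← hc.periodic, sub_add_cancel])
      omega
    have hqp : ∀ t, 0 ≤ t → t ≤ k → (G.Adj q (p t) ↔ t = b) :=
      fun t t1 t2 => ⟨hqb' t t1 t2, fun h' => h' ▸ hqb⟩
    have hqc : ∀ s, j ≤ s → s ≤ i + L → (G.Adj q (c s) ↔ s = z) :=
      fun s s1 s2 => ⟨hz' s s1 s2, fun h' => h' ▸ hz⟩
    rcases eq_or_ne b 0 with rfl | m1
    -- Here `q` hangs on `p 0`. A spoke between `z` and `i + L` would make `p 0, q` a shorter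
    -- candidate; hence `i = e₁`, and `no_detour` applies.
    · have hnf : ∀ u, z < u → u < i + L → ¬ G.Adj v (c u) := fun u u1 u2 u3 =>
        hb.not_rel_of_adj hq le_rfl (by omega) le_rfl (by omega) hqb (by omega) (by omega)
          ⟨i, z, by omega, by omega, ⟨⟨w, hiw, by omega, hw⟩, u, u1, u2, u3⟩, hi', hz⟩
      have hie : i = e₁ := by
        by_contra hne
        exact hnf (e₁ + L) hze (by omega) he₁L
      subst hie
      have hfz : f' ≤ z := by
        by_contra hlt
        exact hnf f' (by omega) f2 hf'
      obtain ⟨g, g1, g2, hg, g4⟩ := exists_greatest_int (p := fun u => G.Adj v (c u)) hfz hf'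
      refine h.no_detour h3 hI hb.ipath hk hb.seq.mem hq hpq (i := i) (j := j) (e := e₂) (g := g)
        (z := z) (by omega) d2 (by omega) g2 hze he₁ he₂ hg ?_ hqp hqc ?_ ?_ hj'
      · intro u u1 u2
        by_cases hu : u ≤ z
        · exact g4 u u1 hu
        · exact hnf u (by omega) u2
      · intro s s1 s2
        constructor
        · intro hs
          have := hadj 0 s le_rfl (by omega) s1 s2 hs
          omega
        · rintro rfl
          rwa [hc.periodic]
      · intro t s t1 t2 s1 s2 hs
        have := hadj t s t1.le t2 (by omega) s2 hs
        omega
    rcases eq_or_ne b k with rfl | m2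
    · have hnf : ∀ u, j < u → u < z → ¬ G.Adj v (c u) := fun u u1 u2 u3 =>
        hb.not_rel_of_adj hq (by omega) le_rfl (by omega) le_rfl hqb (by omega) (by omega)
          ⟨j, z, by omega, by omega, ⟨⟨u, u1, u2, u3⟩, w + L, by omega, by omega,
            by rwa [hc.periodic]⟩, hj', hz⟩
      have hje : j = e₂ := by
        by_contra hne
        exact hnf e₂ (by omega) hez he₂
      subst hje
      have hfz : z ≤ f' := by
        by_contra hlt
        exact hnf f' hef (by omega) hf'
      obtain ⟨g, g1, g2, hg, g4⟩ := exists_least_int (p := fun u => G.Adj v (c u)) hfz hf'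
      have hpk : ∀ s, j ≤ s → s ≤ i + L → (G.Adj (p b) (c s) ↔ s = j) := by
        intro s s1 s2
        constructor
        · intro hs
          have := hadj b s b1 le_rfl s1 s2 hs
          omega
        · rintro rfl
          exact hj'
      -- The case of `q` at the other end is the mirror image: rim and path are both reversed.
      refine (h.reflect 0).no_detour h3 hI (hb.reverse hc).ipath hk
        (fun t t1 t2 => ?_) ?_ (fun t t1 t2 => hpq _ (by omega) (by omega)) (i := -j - L)
        (j := -(i + L)) (e := -(e₁ + L)) (g := -g) (z := -z) (by omega) (by omega) (by omega)
        (by omega) (by omega) ?_ ?_ ?_ ?_ ?_ ?_ ?_ ?_ ?_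
      · obtain ⟨m1, m2, m3⟩ := hb.seq.mem (b - t) (by omega) (by omega)
        exact ⟨m1, m2, by rwa [range_reflect]⟩
      · obtain ⟨m1, m2, m3⟩ := hq
        exact ⟨m1, m2, by rwa [range_reflect]⟩
      · rwa [show 0 - (-j - L) = j + L by ring, hc.periodic]
      · rwa [show 0 - -(e₁ + L) = e₁ + L by ring]
      · rwa [show 0 - -g = g by ring]
      · intro u u1 u2
        by_cases hu : z ≤ 0 - u
        · exact g4 _ hu (by omega)
        · exact hnf _ (by omega) (by omega)
      · intro t t1 t2
        rw [hqp _ (by omega) (by omega)]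
        omega
      · intro s s1 s2
        rw [hqc _ (by omega) (by omega)]
        omega
      · intro s s1 s2
        rw [sub_zero, hpk _ (by omega) (by omega)]
        omega
      · intro t s t1 t2 s1 s2 hs
        have := hadj _ _ (by omega) (by omega) (by omega) (by omega) hs
        omega
      · rwa [sub_self, show 0 - -(i + L) = i + L by ring, hc.periodic]
    -- If `q` hangs on an inner vertex, the path from `p a` through it to `q` is shorter and joins
    -- attachments far from each other, at `w` and `z`.
    · exact hb.not_rel_of_adj hq ha.le hak.le b1 b2 hqb (by omega) (by omega)
        ⟨w, z, by omega, by omega, ⟨⟨e₂, by omega, hez, he₂⟩, e₁ + L, hze, by omega, he₁L⟩, haw, hz⟩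
  · intro s s1 s2 hs a b a1 a2 b1 b2 hsa hsb
    have key : ∀ a, 0 ≤ a → a ≤ k → G.Adj (p a) (c s) → (a = 0 ∧ s < w) ∨ (a = k ∧ w < s) := by
      intro a a1 a2 hsa
      have hsw : s ≠ w := by
        rintro rfl
        exact hs hw
      rcases eq_or_ne a 0 with rfl | m1
      · have := hp0' s (by omega) (by omega) hsa
        omega
      rcases eq_or_ne a k with rfl | m2
      · have := hpk' s (by omega) (by omega) hsa
        omega
      · exact absurd (hmid a s (by omega) (by omega) (by omega) (by omega) hsa) hsw
    have := key a a1 a2 hsa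
    have := key b b1 b2 hsb
    omega
  · exact three_le_ncard_of_mem ((Set.finite_Icc _ _).image _ |>.inter_of_right _)
      ⟨he₂, e₂, ⟨d2, by omega⟩, rfl⟩ ⟨hf', f', ⟨by omega, by omega⟩, rfl⟩
      ⟨he₁L, e₁ + L, ⟨by omega, by omega⟩, rfl⟩ (hc.ne _ _ hef (by omega))
      (hc.ne _ _ (by omega) (by omega)) (hc.ne _ _ f2 (by omega))

/-- A proper wheel with the least number of spokes at its hub has no bad path. -/
lemma IsWheel.not_isBadPath [Finite V] (h : G.IsWheel L c v) (h3 : G.CliqueFree 3)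
    (hI : G.ISK4Free) (hprop : IsProper G L c v)
    (hmin : ∀ L' c', G.IsWheel L' c' v → IsProper G L' c' v →
      (G.neighborSet v ∩ Set.range c).ncard ≤ (G.neighborSet v ∩ Set.range c').ncard) :
    ¬ IsBadPath G L c v p k := by
  intro hb
  have hc := h.hole
  obtain ⟨i, j, hij, hji, ⟨⟨w, w1, w2, hw⟩, f, f1, f2, hf⟩, hi, hj⟩ := hb.rel
  by_cases h1 : ∃ u, i < u ∧ u < j ∧ G.Adj v (c u) ∧ u ≠ w
  · by_cases h2 : ∃ u, j < u ∧ u < i + L ∧ G.Adj v (c u) ∧ u ≠ f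
    · obtain ⟨u₁, u₂, a1, a2, a3, hu₁, hu₂⟩ : ∃ u₁ u₂, i < u₁ ∧ u₁ < u₂ ∧ u₂ < j ∧
          G.Adj v (c u₁) ∧ G.Adj v (c u₂) := by
        obtain ⟨u, b1, b2, b3, b4⟩ := h1
        rcases lt_or_gt_of_ne b4 with b4 | b4
        · exact ⟨u, w, b1, b4, w2, b3, hw⟩
        · exact ⟨w, u, w1, b4, b2, hw, b3⟩
      obtain ⟨w₁, w₂, b1, b2, b3, hw₁, hw₂⟩ : ∃ u₁ u₂, j < u₁ ∧ u₁ < u₂ ∧ u₂ < i + L ∧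
          G.Adj v (c u₁) ∧ G.Adj v (c u₂) := by
        obtain ⟨u, b1, b2, b3, b4⟩ := h2
        rcases lt_or_gt_of_ne b4 with b4 | b4
        · exact ⟨u, f, b1, b4, f2, b3, hf⟩
        · exact ⟨f, u, f1, b4, b2, hf, b3⟩
      exact h.not_isBadPath_of_two_spokes h3 hI hprop hmin hb hi hj a1 a2 a3 b1 b2 b3 hu₁ hu₂
        hw₁ hw₂
    · push Not at h2
      exact h.not_isBadPath_of_one_spoke h3 hI hprop hmin (hb.reverse hc) (i := j) (w := f)
        (j := i + L) (f := w + L) f1 f2 (by omega) (by omega) (by simpa using hj)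
        (by simpa [hc.periodic] using hi) hf h2 (by rwa [hc.periodic])
  · push Not at h1
    exact h.not_isBadPath_of_one_spoke h3 hI hprop hmin hb w1 w2 f1 f2 hi hj hw h1 hf

end Wheel

end SimpleGraph

/-! ### The star cutset of a wheel -/

namespace SimpleGraph

variable {V : Type*} {G : SimpleGraph V}

lemma isConnOn_of_preconnected {T : Set V} (h : (G.induce T).Preconnected) : G.IsConnOn T := by
  intro x hx y hy
  have h1 := (reachable_iff_reflTransGen _ _).1 (h ⟨x, hx⟩ ⟨y, hy⟩)
  exact Relation.ReflTransGen.lift (p := fun a b => G.Adj a b ∧ b ∈ T) Subtype.val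
    (fun a b hab => ⟨hab, b.2⟩) _ _ h1

section Wheel

variable {L : ℤ} {c : ℤ → V} {v : V}

/-- If deleting the closed neighbourhood of the hub leaves a connected graph, then there is a bad
path. -/
lemma IsWheel.exists_isBadPath (h : G.IsWheel L c v) (h3 : G.CliqueFree 3) (hI : G.ISK4Free)
    (hconn : G.IsConnOn {x | x ≠ v ∧ ¬ G.Adj v x}) : ∃ p k, IsBadPath G L c v p k := by
  have hc := h.hole
  obtain ⟨e, -, -, he, -⟩ := h.exists_next h3 hI 0
  obtain ⟨e', e1, e2, he', e3, -⟩ := h.exists_spoke h3 hI e e e e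
  have heL : G.Adj v (c (e + L)) := by rwa [hc.periodic]
  have hg1 := hc.spoke_gap h3 he he' (by omega)
  have hg2 := hc.spoke_gap h3 he' heL e2
  have hD : ∀ u, G.Adj v (c u) → c (u + 1) ∈ {x | x ≠ v ∧ ¬ G.Adj v x} := fun u hu =>
    ⟨h.ne _, fun h' => h3.not_triangle hu (hc.adj_succ u) h'⟩
  -- First a shortest walk is taken between far vertices of the rim itself; its interior will be off
  -- the wheel.
  let R : V → V → Prop := fun x y =>
    ∃ s t, s < t ∧ t < s + L ∧ Far G L c v s t ∧ x = c s ∧ y = c t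
  obtain ⟨f, n, hf, ⟨s, t, hst, hts, ⟨⟨x, x1, x2, x3⟩, y, y1, y2, y3⟩, hs, ht⟩, hfi, hmin⟩ :
      ∃ f n, G.IsSeq {x | x ≠ v ∧ ¬ G.Adj v x} f n ∧ R (f 0) (f n) ∧ G.IsIPath f 0 n ∧
        ∀ g m, G.IsSeq {x | x ≠ v ∧ ¬ G.Adj v x} g m → R (g 0) (g m) → n ≤ m := by
    apply exists_min_seq
    obtain ⟨f, n, hf, hf0, hfn⟩ := hconn.exists_isSeq (hD e he) (hD e' he')
    exact ⟨f, n, hf, e + 1, e' + 1, by omega, by omega,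
      ⟨⟨e', by omega, by omega, he'⟩, e + L, by omega, by omega, heL⟩, hf0, hfn⟩
  have hn := hf.nonneg
  -- An inner vertex on the rim is not at a spoke, hence lies in the interior of a sector and is far
  -- from one of the ends, which would shorten the walk.
  have hav : ∀ a, 0 < a → a < n → f a ∉ Set.range c := by
    rintro a a1 a2 hr
    obtain ⟨u, u1, u2, hu⟩ := hc.exists_window hr s
    have hfoot : ¬ G.Adj v (c u) := hu ▸ (hf.mem a a1.le a2.le).2
    have hxu : x ≠ u := fun h' => hfoot (h' ▸ x3)
    have hyu : y ≠ u := fun h' => hfoot (h' ▸ y3)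
    have hus : u ≠ s := by
      rintro rfl
      exact (hfi 0 a le_rfl a1 a2.le).1 (hs.trans hu)
    have hut : u ≠ t := by
      rintro rfl
      exact (hfi a n a1.le a2 le_rfl).1 (hu.symm.trans ht.symm)
    have k1 : ¬ R (f 0) (f a) := by
      intro hR
      have := hmin _ _ (hf.sub le_rfl a1.le a2.le) (by simpa using hR)
      omega
    have k2 : ¬ R (f a) (f n) := by
      intro hR
      have := hmin _ _ (hf.sub a1.le a2.le le_rfl) (by simpa using hR)
      omega
    rcases lt_or_gt_of_ne hut with hlt | hlt
    · rcases lt_or_gt_of_ne hxu with h' | h'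
      · exact k1 ⟨s, u, by omega, by omega, ⟨⟨x, x1, h', x3⟩, y, by omega, y2, y3⟩, hs, hu.symm⟩
      · exact k2 ⟨u, t, by omega, by omega, ⟨⟨x, h', x2, x3⟩, y, y1, by omega, y3⟩, hu.symm, ht⟩
    · rcases lt_or_gt_of_ne hyu with h' | h'
      · exact k2 ⟨u, t + L, by omega, by omega, ⟨⟨x + L, by omega, by omega, by rwa [hc.periodic]⟩,
          y + L, by omega, by omega, by rwa [hc.periodic]⟩, hu.symm, by rw [hc.periodic, ht]⟩
      · exact k1 ⟨s, u, by omega, by omega, ⟨⟨x, x1, by omega, x3⟩, y, h', by omega, y3⟩, hs,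
          hu.symm⟩
  -- Far vertices are distinct and nonadjacent, so the interior of the walk is nonempty.
  have hn2 : 2 ≤ n := by
    by_contra hlt
    rcases lt_or_eq_of_le hn with h' | h'
    · have hadj := hfi.adj_succ le_rfl h'
      rw [show (0 : ℤ) + 1 = n by omega, hs, ht, hc.adj s t hst hts] at hadj
      omega
    · rw [← h', hs] at ht
      exact hc.ne s t hst hts ht
  have hseq : G.IsSeq (offWheel G c v) (fun i => f (1 + i)) (n - 1 - 1) := by
    have := hf.sub (a := 1) (b := n - 1) (by omega) (by omega) (by omega)
    refine ⟨this.nonneg, fun i i1 i2 => ?_, this.adj⟩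
    obtain ⟨m1, m2⟩ := this.mem i i1 i2
    exact ⟨m1, m2, hav _ (by omega) (by omega)⟩
  obtain ⟨p, k, hp, hR, hpi, hpmin⟩ := exists_min_seq (T := offWheel G c v)
    (R := BadRel G L c v) ⟨_, _, hseq, s, t, hst, hts, ⟨⟨x, x1, x2, x3⟩, y, y1, y2, y3⟩, by
      have := (hfi.adj_succ le_rfl (by omega : 0 < n)).symm
      rw [hs] at this
      simpa using this, by
      have := hfi.adj_succ (i := n - 1) (by omega) (by omega)
      rw [sub_add_cancel, ht] at this
      convert this using 2
      ring⟩
  exact ⟨p, k, hp, hpi, hR, hpmin⟩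

/-- A triangle-free ISK4-free graph with a wheel has a star cutset. -/
theorem IsWheel.exists_isStarCutset [Finite V] (h : G.IsWheel L c v) (h3 : G.CliqueFree 3)
    (hI : G.ISK4Free) : ∃ C : Set V, G.IsStarCutset C := by
  classical
  obtain ⟨L₀, hL, -, ⟨c₀, v₀, h₀⟩, hL₀⟩ := exists_least_int
    (p := fun L => ∃ c v, G.IsWheel L c v) h.hole.four_le ⟨c, v, h⟩
  have hprop₀ := h₀.isProper h3 hI (fun L' c' v' h' => by
    by_contra hlt
    exact hL₀ L' h'.hole.four_le (by omega) ⟨c', v', h'⟩)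
  clear h hL hL₀
  -- From here on the hub is fixed and the length no longer matters: the number of spokes is
  -- minimized over the proper wheels with hub `v₀`.
  have hex : ∃ n : ℕ, ∃ L c, G.IsWheel L c v₀ ∧ IsProper G L c v₀ ∧
      (G.neighborSet v₀ ∩ Set.range c).ncard = n := ⟨_, L₀, c₀, h₀, hprop₀, rfl⟩
  obtain ⟨L₁, c₁, h₁, hprop₁, hn⟩ := Nat.find_spec hex
  have hmin : ∀ L' c', G.IsWheel L' c' v₀ → IsProper G L' c' v₀ →
      (G.neighborSet v₀ ∩ Set.range c₁).ncard ≤ (G.neighborSet v₀ ∩ Set.range c').ncard := by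
    intro L' c' h' hp'
    rw [hn]
    exact Nat.find_min' hex ⟨L', c', h', hp', rfl⟩
  refine ⟨insert v₀ (G.neighborSet v₀), fun hpre => ?_, v₀, by simp, ?_⟩
  · obtain ⟨p, k, hb⟩ := h₁.exists_isBadPath h3 hI (by
      have := isConnOn_of_preconnected hpre
      convert this using 1
      ext x
      simp [not_or])
    exact h₁.not_isBadPath h3 hI hprop₁ hmin hb
  · rintro w (rfl | hw) hne
    · exact absurd rfl hne
    · exact hw

end Wheel

end SimpleGraph

/-! ### A hole with a connected set attached to three of its vertices -/

namespace SimpleGraph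

variable {V : Type*} {G : SimpleGraph V}

/-- The vertices of `H` with a neighbour in `T`. -/
def attach (G : SimpleGraph V) (H T : Set V) : Set V := {x ∈ H | ∃ t ∈ T, G.Adj x t}

/-- `T` is connected, disjoint from `H`, and attached to three vertices of `H`. -/
structure IsAttached (G : SimpleGraph V) (H T : Set V) : Prop where
  conn : G.IsConnOn T
  disj : ∀ x ∈ H, x ∉ T
  three : ∃ x y z, x ∈ G.attach H T ∧ y ∈ G.attach H T ∧ z ∈ G.attach H T ∧ x ≠ y ∧ x ≠ z ∧ y ≠ z

/-- `c` is a cycle of length `L`, with chords or not. -/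
structure IsCyc (G : SimpleGraph V) (L : ℤ) (c : ℤ → V) : Prop where
  three_le : 3 ≤ L
  periodic : ∀ i, c (i + L) = c i
  ne : ∀ i j, i < j → j < i + L → c i ≠ c j
  adj : ∀ i, G.Adj (c i) (c (i + 1))

lemma isCyc_of_window {L : ℤ} {c : ℤ → V} (hL : 3 ≤ L) (hper : ∀ i, c (i + L) = c i)
    (hne : ∀ i j, 0 ≤ i → i < j → j < L → c i ≠ c j)
    (hadj : ∀ i, 0 ≤ i → i < L → G.Adj (c i) (c (i + 1))) : G.IsCyc L c := by
  refine ⟨hL, hper, fun i j h1 h2 => ?_, fun i => ?_⟩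
  · obtain ⟨i', a1, a2, a3, k, a4⟩ := periodic_exists hper (by omega) i 0
    rw [← a3, ← periodic_add_mul hper j k]
    rcases lt_or_ge (j + k * L) L with h' | h'
    · exact hne _ _ a1 (by omega) h'
    · rw [← sub_add_cancel (j + k * L) L, hper]
      exact (hne _ _ (by omega) (by omega) (by omega)).symm
  · obtain ⟨i', a1, a2, a3, k, a4⟩ := periodic_exists hper (by omega) i 0
    have := hadj i' a1 (by omega)
    rw [a3] at this
    rwa [← periodic_add_mul hper (i + 1) k, show i + 1 + k * L = i' + 1 by omega]

lemma IsCyc.exists_chord {L : ℤ} {c : ℤ → V} (hc : G.IsCyc L c) {i j : ℤ} (hij : i + 2 ≤ j)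
    (hji : j < i + L) (h : G.Adj (c i) (c j)) :
    ∃ c', G.IsCyc (j - i + 1) c' ∧ Set.range c' = c '' Set.Icc i j := by
  obtain ⟨c', hper, hc'⟩ := exists_periodic_ext (fun t => c (i + t)) (j - i + 1)
  refine ⟨c', isCyc_of_window (by omega) hper ?_ ?_, ?_⟩
  · intro s t h1 h2 h3
    rw [hc' s h1 (by omega), hc' t (by omega) h3]
    exact hc.ne _ _ (by omega) (by omega)
  · intro s h1 h2
    rw [hc' s h1 h2]
    rcases lt_or_eq_of_le (show s ≤ j - i by omega) with h' | rfl
    · rw [hc' (s + 1) (by omega) (by omega)]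
      have := hc.adj (i + s)
      rwa [add_assoc] at this
    · rw [show j - i + 1 = 0 + (j - i + 1) by ring, hper, hc' 0 le_rfl (by omega), add_zero,
        add_sub_cancel]
      exact h.symm
  · rw [range_eq_image_window hper (by omega) 0]
    ext x
    constructor
    · rintro ⟨t, ⟨t1, t2⟩, rfl⟩
      exact ⟨i + t, ⟨by omega, by omega⟩, (hc' t t1 (by omega)).symm⟩
    · rintro ⟨t, ⟨t1, t2⟩, rfl⟩
      refine ⟨t - i, ⟨by omega, by omega⟩, ?_⟩
      rw [hc' _ (by omega) (by omega)]
      simp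

/-- A shortest cycle with a connected set attached to three of its vertices has no chords. -/
lemma IsCyc.isHole (h3 : G.CliqueFree 3) {L : ℤ} {c : ℤ → V} (hc : G.IsCyc L c) {T : Set V}
    (hT : G.IsAttached (Set.range c) T)
    (hmin : ∀ L' c' T', G.IsCyc L' c' → G.IsAttached (Set.range c') T' → L ≤ L') :
    G.IsHole L c := by
  have hL := hc.three_le
  -- If both sides of a chord have attachments, one side closed by the chord is a shorter cycle; the
  -- interior of the other side joins the connected set and is attached to both ends of the chord.
  have hone : ∀ i j, i + 2 ≤ j → j + 2 ≤ i + L → G.Adj (c i) (c j) →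
      (∃ s, i < s ∧ s < j ∧ ∃ t ∈ T, G.Adj (c s) t) →
      ¬ ∃ s, j < s ∧ s < i + L ∧ ∃ t ∈ T, G.Adj (c s) t := by
    rintro i j hij hji hadj ⟨s, s1, s2, t, ht, hst⟩ ⟨s', s1', s2', t', ht', hst'⟩
    obtain ⟨c', hc', hr⟩ := hc.exists_chord hij (by omega) hadj
    have := hmin _ c' (c '' Set.Icc (j + 1) (i + L - 1) ∪ T) hc' (by
      rw [hr]
      refine ⟨(isConnOn_image fun u _ _ => hc.adj u).union hT.conn
        ⟨s', ⟨by omega, by omega⟩, rfl⟩ ht' hst', ?_, c i, c j, c s,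
        ⟨⟨i, ⟨le_rfl, by omega⟩, rfl⟩, c (i + L - 1), .inl ⟨_, ⟨by omega, le_rfl⟩, rfl⟩, ?_⟩,
        ⟨⟨j, ⟨by omega, le_rfl⟩, rfl⟩, c (j + 1), .inl ⟨_, ⟨le_rfl, by omega⟩, rfl⟩, hc.adj j⟩,
        ⟨⟨s, ⟨by omega, by omega⟩, rfl⟩, t, .inr ht, hst⟩, hc.ne _ _ (by omega) (by omega),
        hc.ne _ _ (by omega) (by omega), (hc.ne _ _ (by omega) (by omega)).symm⟩
      · rintro _ ⟨u, ⟨u1, u2⟩, rfl⟩ (⟨w, ⟨w1, w2⟩, hw⟩ | hu)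
        · exact hc.ne u w (by omega) (by omega) hw.symm
        · exact hT.disj _ ⟨u, rfl⟩ hu
      · have := hc.adj (i + L - 1)
        rw [sub_add_cancel, hc.periodic] at this
        exact this.symm)
    omega
  -- A side without attachments can be cut off along the chord.
  have htwo : ∀ i j, i + 2 ≤ j → j + 2 ≤ i + L → G.Adj (c i) (c j) →
      ¬ ∀ s, j < s → s < i + L → ¬ ∃ t ∈ T, G.Adj (c s) t := by
    intro i j hij hji hadj hno
    obtain ⟨c', hc', hr⟩ := hc.exists_chord hij (by omega) hadj
    have hin : ∀ x ∈ G.attach (Set.range c) T, x ∈ G.attach (Set.range c') T := by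
      rintro _ ⟨⟨s, rfl⟩, hx⟩
      obtain ⟨s', s1, s2, s3, -⟩ := periodic_exists hc.periodic (by omega) s i
      rw [← s3] at hx ⊢
      refine ⟨?_, hx⟩
      rw [hr]
      refine ⟨s', ⟨s1, ?_⟩, rfl⟩
      by_contra hlt
      exact hno s' (by omega) (by omega) hx
    obtain ⟨x, y, z, hx, hy, hz, hne⟩ := hT.three
    have := hmin _ c' T hc' ⟨hT.conn, fun x hx => hT.disj x (by
      rw [hr] at hx
      obtain ⟨u, -, rfl⟩ := hx
      exact ⟨u, rfl⟩), x, y, z, hin x hx, hin y hy, hin z hz, hne⟩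
    omega
  have hchord : ∀ i j, i + 2 ≤ j → j + 2 ≤ i + L → ¬ G.Adj (c i) (c j) := by
    intro i j hij hji hadj
    by_cases h1 : ∃ s, i < s ∧ s < j ∧ ∃ t ∈ T, G.Adj (c s) t
    · refine htwo i j hij hji hadj ?_
      have := hone i j hij hji hadj h1
      push Not at this ⊢
      exact this
    · refine htwo j (i + L) (by omega) (by omega) (by rw [hc.periodic]; exact hadj.symm) ?_
      rintro s s1 s2 hs
      refine h1 ⟨s - L, by omega, by omega, ?_⟩
      rwa [← hc.periodic, sub_add_cancel]
  have hL4 : 4 ≤ L := by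
    by_contra hlt
    obtain rfl : L = 3 := by omega
    have h2 := hc.adj 2
    have h0 := hc.periodic 0
    norm_num at h2 h0
    rw [h0] at h2
    exact h3.not_triangle (hc.adj 0) (hc.adj 1) (by simpa using h2.symm)
  refine ⟨hL4, hc.periodic, hc.ne, fun i j hij hji => ⟨fun hadj => ?_, ?_⟩⟩
  · by_contra hne
    exact hchord i j (by omega) (by omega) hadj
  · rintro (rfl | rfl)
    · exact hc.adj i
    · have := hc.adj (i + L - 1)
      rw [sub_add_cancel, hc.periodic] at this
      exact this.symm

lemma Walk.IsCycle.exists_isCyc {u : V} {w : G.Walk u u} (hw : w.IsCycle) :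
    ∃ c, G.IsCyc w.length c ∧ Set.range c = {x | x ∈ w.support} := by
  obtain ⟨c, hper, hc⟩ := exists_periodic_ext (fun i => w.getVert i.toNat) w.length
  have hL := hw.three_le_length
  have hc' : ∀ i : ℕ, i ≤ w.length → c i = w.getVert i := by
    intro i hi
    rcases lt_or_eq_of_le hi with hi | rfl
    · rw [hc i (by omega) (by omega)]
      simp
    · have := hper 0
      rw [zero_add, hc 0 le_rfl (by omega)] at this
      rw [this]
      simp
  refine ⟨c, isCyc_of_window (by omega) hper ?_ ?_, ?_⟩
  · intro i j h1 h2 h4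
    lift i to ℕ using h1
    lift j to ℕ using by omega
    rw [hc' i (by omega), hc' j (by omega)]
    intro heq
    have := hw.getVert_injOn' (x₁ := i) (x₂ := j) (by simp; omega) (by simp; omega) heq
    omega
  · intro i h1 h2
    lift i to ℕ using h1
    have := hc' (i + 1) (by omega)
    push_cast at this
    rw [hc' i (by omega), this]
    exact w.adj_getVert_succ (by omega)
  · ext x
    rw [range_eq_image_window hper (by omega) 0]
    constructor
    · rintro ⟨i, ⟨h1, h2⟩, rfl⟩
      lift i to ℕ using h1
      rw [hc' i (by omega)]
      exact w.getVert_mem_support i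
    · intro hx
      obtain ⟨i, rfl, hi⟩ := Walk.mem_support_iff_exists_getVert.1 hx
      rcases lt_or_eq_of_le hi with hi | rfl
      · exact ⟨i, ⟨by omega, by omega⟩, hc' i (by omega)⟩
      · refine ⟨0, ⟨le_rfl, by omega⟩, ?_⟩
        have := hc' 0 (by omega)
        simpa using this

/-- A graph that is not series-parallel has a cycle and a connected set attached to three of its
vertices. -/
lemma exists_isCyc_of_not_isSeriesParallel (h : ¬ G.IsSeriesParallel) :
    ∃ L c T, G.IsCyc L c ∧ G.IsAttached (Set.range c) T := by
  unfold IsSeriesParallel at h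
  push Not at h
  obtain ⟨H, b, P, hP, hrev, hb, hdisj, -⟩ := h
  have h01 : (completeGraph (Fin 4)).Adj 0 1 := by decide
  have h12 : (completeGraph (Fin 4)).Adj 1 2 := by decide
  have h20 : (completeGraph (Fin 4)).Adj 2 0 := by decide
  have h30 : (completeGraph (Fin 4)).Adj 3 0 := by decide
  have h31 : (completeGraph (Fin 4)).Adj 3 1 := by decide
  have h32 : (completeGraph (Fin 4)).Adj 3 2 := by decide
  -- Paths replacing distinct edges meet in common corners only.
  have hmeet : ∀ u v h u' v' h', s(u, v) ≠ s(u', v') → ∀ w, w ∈ (P u v h).support →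
      w ∈ (P u' v' h').support → ∃ x, w = b x ∧ (x = u ∨ x = v) ∧ (x = u' ∨ x = v') := by
    intro u v h u' v' h' hne w hw hw'
    obtain ⟨x, rfl⟩ := hdisj u v h u' v' h' hne w hw hw'
    exact ⟨x, rfl, hb _ _ _ _ hw, hb _ _ _ _ hw'⟩
  have hstart : ∀ u v h, b u ∉ (P u v h).support.tail := by
    intro u v h
    have hnd := (hP u v h).support_nodup
    rw [← Walk.cons_tail_support, List.nodup_cons] at hnd
    exact hnd.1
  have hpos : ∀ u v h, 0 < (P u v h).length := by
    intro u v h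
    by_contra hlt
    exact h.ne (b.injective (Walk.eq_of_length_eq_zero (p := P u v h) (by omega)))
  -- The cycle replaces the triangle on corners 0, 1, 2; the connected set will consist of the paths
  -- from corner 3.
  have hQ : ((P 0 1 h01).append (P 1 2 h12)).IsPath := by
    rw [Walk.isPath_def, Walk.support_append, List.nodup_append']
    refine ⟨(hP _ _ _).support_nodup, (hP _ _ _).support_nodup.tail, ?_⟩
    intro w hw hw'
    obtain ⟨x, rfl, hx, hx'⟩ := hmeet 0 1 h01 1 2 h12 (by decide) w hw (List.mem_of_mem_tail hw')
    obtain rfl : x = 1 := by omega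
    exact hstart _ _ _ hw'
  have hcyc : (((P 0 1 h01).append (P 1 2 h12)).append (P 2 0 h20)).IsCycle := by
    refine hQ.isCycle_append (hP _ _ _) ?_ (.inl ?_)
    · intro w hw hw'
      rw [Walk.tail_support_append, List.mem_append] at hw
      rcases hw with hw | hw
      · obtain ⟨x, rfl, hx, hx'⟩ := hmeet 0 1 h01 2 0 h20 (by decide) w
          (List.mem_of_mem_tail hw) (List.mem_of_mem_tail hw')
        obtain rfl : x = 0 := by omega
        exact hstart _ _ _ hw
      · obtain ⟨x, rfl, hx, hx'⟩ := hmeet 1 2 h12 2 0 h20 (by decide) w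
          (List.mem_of_mem_tail hw) (List.mem_of_mem_tail hw')
        obtain rfl : x = 2 := by omega
        exact hstart _ _ _ hw'
    · have := hpos 0 1 h01
      have := hpos 1 2 h12
      rw [Walk.length_append]
      omega
  obtain ⟨c, hc, hr⟩ := (hcyc.map (f := H.hom) H.hom_injective).exists_isCyc
  have hr' : ∀ x ∈ Set.range c, ∃ y, y.1 = x ∧ ∃ u v h, u ≠ 3 ∧ v ≠ 3 ∧
      y ∈ (P u v h).support := by
    intro x hx
    rw [hr, Set.mem_ofPred_eq, Walk.support_map, List.mem_map] at hx
    obtain ⟨y, hy, rfl⟩ := hx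
    refine ⟨y, rfl, ?_⟩
    rw [Walk.mem_support_append_iff, Walk.mem_support_append_iff] at hy
    rcases hy with (hy | hy) | hy
    · exact ⟨_, _, _, by decide, by decide, hy⟩
    · exact ⟨_, _, _, by decide, by decide, hy⟩
    · exact ⟨_, _, _, by decide, by decide, hy⟩
  -- The path from corner 3 without its last vertex, which lies on the cycle.
  let A : ∀ i, (completeGraph (Fin 4)).Adj 3 i → Set V := fun i h =>
    (fun t : ℤ => ((P 3 i h).getVert t.toNat).1) '' Set.Icc 0 ((P 3 i h).length - 1)
  have hA : ∀ i h, G.IsConnOn (A i h) := by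
    intro i h
    refine isConnOn_image fun t t1 t2 => ?_
    lift t to ℕ using t1
    exact H.coe_adj_sub _ _ ((P 3 i h).adj_getVert_succ (i := t) (by omega))
  have hA3 : ∀ i h, (b 3).1 ∈ A i h := by
    intro i h
    have := hpos _ _ h
    exact ⟨0, ⟨le_rfl, by omega⟩, by simp⟩
  have hAd : ∀ i h, ∀ x ∈ Set.range c, x ∉ A i h := by
    rintro i h x hx ⟨t, ⟨t1, t2⟩, ht⟩
    lift t to ℕ using t1
    obtain ⟨y, rfl, u, v, h', hu, hv, hy⟩ := hr' x hx
    obtain rfl : (P 3 i h).getVert t = y := Subtype.ext ht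
    obtain ⟨x, hxe, hx1, hx2⟩ := hmeet 3 i h u v h' (by
      intro heq
      rw [Sym2.eq_iff] at heq
      rcases heq with ⟨e, -⟩ | ⟨e, -⟩
      · exact hu e.symm
      · exact hv e.symm) _ ((P 3 i h).getVert_mem_support t) hy
    obtain rfl : x = i := by
      rcases hx1 with rfl | rfl
      · rcases hx2 with e | e
        · exact absurd e.symm hu
        · exact absurd e.symm hv
      · rfl
    have := (hP 3 x h).getVert_injOn (x₁ := t) (x₂ := (P 3 x h).length)
      (by simp; omega) (by simp)
      (hxe.trans (P 3 x h).getVert_length.symm)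
    omega
  have hAa : ∀ i h, ∃ t ∈ A i h, G.Adj (b i).1 t := by
    intro i h
    have h0 := hpos _ _ h
    refine ⟨_, ⟨((P 3 i h).length - 1 : ℕ), ⟨by omega, by omega⟩, rfl⟩, ?_⟩
    have := (P 3 i h).adj_getVert_succ (i := (P 3 i h).length - 1) (by omega)
    rw [Nat.sub_add_cancel h0, Walk.getVert_length] at this
    exact (H.coe_adj_sub _ _ this).symm
  have hbr : ∀ i, i ≠ 3 → (b i).1 ∈ Set.range c := by
    intro i hi
    rw [hr, Set.mem_ofPred_eq, Walk.support_map, List.mem_map]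
    refine ⟨b i, ?_, rfl⟩
    rw [Walk.mem_support_append_iff, Walk.mem_support_append_iff]
    fin_cases i
    · exact .inl (.inl (Walk.start_mem_support _))
    · exact .inl (.inl (Walk.end_mem_support _))
    · exact .inl (.inr (Walk.end_mem_support _))
    · exact absurd rfl hi
  have hbne : ∀ i j, i ≠ j → (b i).1 ≠ (b j).1 := fun i j hij heq =>
    hij (b.injective (Subtype.ext heq))
  refine ⟨_, c, A 0 h30 ∪ A 1 h31 ∪ A 2 h32, hc, ⟨((hA _ _).union_of_mem (hA _ _) (hA3 _ _)
    (hA3 _ _)).union_of_mem (hA _ _) (.inl (hA3 _ _)) (hA3 _ _), ?_, (b 0).1, (b 1).1, (b 2).1,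
    ⟨hbr _ (by decide), ?_⟩, ⟨hbr _ (by decide), ?_⟩, ⟨hbr _ (by decide), ?_⟩,
    hbne _ _ (by decide), hbne _ _ (by decide), hbne _ _ (by decide)⟩⟩
  · rintro x hx ((hx' | hx') | hx')
    · exact hAd _ _ x hx hx'
    · exact hAd _ _ x hx hx'
    · exact hAd _ _ x hx hx'
  · obtain ⟨t, ht, ht'⟩ := hAa 0 h30
    exact ⟨t, .inl (.inl ht), ht'⟩
  · obtain ⟨t, ht, ht'⟩ := hAa 1 h31
    exact ⟨t, .inl (.inr ht), ht'⟩
  · obtain ⟨t, ht, ht'⟩ := hAa 2 h32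
    exact ⟨t, .inr ht, ht'⟩

end SimpleGraph

/-! ### Paths attached to a shortest hole -/

namespace SimpleGraph

variable {V : Type*} {G : SimpleGraph V}

/-- Every vertex of `A` is adjacent to every vertex of `B`, and both sets have three elements. -/
structure IsBiclique (G : SimpleGraph V) (A B : Set V) : Prop where
  adj : ∀ a ∈ A, ∀ b ∈ B, G.Adj a b
  left : 3 ≤ A.ncard
  right : 3 ≤ B.ncard

section

variable {L : ℤ} {c p : ℤ → V} {n : ℤ}

/-- The vertex `p 0` closes the arc from `i` to `j` to a hole of length `j - i + 2`. The rest of `p`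
with the rest of the rim is connected and attached to `c i`, `c j` and `p 0`, so this hole competes
with `c`. -/
lemma IsHole.le_of_fork (hc : G.IsHole L c) (h3 : G.CliqueFree 3) (hp : G.IsIPath p 0 n)
    (hn : 1 ≤ n) (hpc : ∀ t s, 0 ≤ t → t ≤ n → c s ≠ p t)
    (hminL : ∀ L' c' T', G.IsHole L' c' → G.IsAttached (Set.range c') T' → L ≤ L') {i j s : ℤ}
    (hij : i < j) (h0 : ∀ s, i ≤ s → s ≤ j → (G.Adj (p 0) (c s) ↔ s = i ∨ s = j))
    (hjs : j < s) (hsi : s < i + L) (hs : G.Adj (p n) (c s)) : L ≤ j - i + 2 := by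
  have hi := (h0 i le_rfl hij.le).2 (.inl rfl)
  have hj := (h0 j hij.le le_rfl).2 (.inr rfl)
  have hgap := hc.spoke_gap h3 hi hj hij
  obtain ⟨c', hc', -, -, hr⟩ := exists_isHole_glue (hc.isIPath (a := i) (b := j) (by omega))
    (isIPath_self p 0) hij.le le_rfl (by omega)
    (fun s t _ _ t1 t2 => hpc t s t1 (by omega)) (by
      intro s t s1 s2 t1 t2
      obtain rfl : t = 0 := by omega
      rw [G.adj_comm, h0 s s1 s2]
      omega)
  have := hminL _ c' (p '' Set.Icc 1 n ∪ c '' Set.Icc (j + 1) (i + L - 1)) hc' (by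
    rw [hr]
    refine ⟨(hp.mono (by omega) le_rfl).isConnOn.union (hc.isConnOn_arc _ _)
      ⟨n, ⟨hn, le_rfl⟩, rfl⟩ ⟨s, ⟨by omega, by omega⟩, rfl⟩ hs, ?_, c i, c j, p 0,
      ⟨.inl ⟨i, ⟨le_rfl, hij.le⟩, rfl⟩, c (i + L - 1), .inr ⟨_, ⟨by omega, le_rfl⟩, rfl⟩, ?_⟩,
      ⟨.inl ⟨j, ⟨hij.le, le_rfl⟩, rfl⟩, c (j + 1), .inr ⟨_, ⟨le_rfl, by omega⟩, rfl⟩, hc.adj_succ j⟩,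
      ⟨.inr ⟨0, ⟨le_rfl, le_rfl⟩, rfl⟩, p 1, .inl ⟨1, ⟨le_rfl, hn⟩, rfl⟩,
        hp.adj_succ le_rfl (by omega)⟩,
      hc.ne _ _ hij (by omega), hpc _ _ le_rfl (by omega), hpc _ _ le_rfl (by omega)⟩
    · rintro _ (⟨u, ⟨u1, u2⟩, rfl⟩ | ⟨u, ⟨u1, u2⟩, rfl⟩) (⟨w, ⟨w1, w2⟩, hw⟩ | ⟨w, ⟨w1, w2⟩, hw⟩)
      · exact hpc w u (by omega) w2 hw.symm
      · exact hc.ne u w (by omega) (by omega) hw.symm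
      · exact (hp u w u1 (by omega) w2).1 hw.symm
      · exact hpc u w u1 (by omega) hw
    · have := hc.adj_succ (i + L - 1)
      rw [sub_add_cancel, hc.periodic] at this
      exact this.symm)
  omega

/-- If `n = 1`, the square and the two ends of the path form a `K₃,₃`. If `n > 1`, exchanging `c (i
+ 3)` for `p 0` gives a square to which `c (i + 3)` and `p n` send exactly three edges. -/
lemma IsHole.exists_isBiclique_of_square (hc : G.IsHole 4 c) (h3 : G.CliqueFree 3)
    (hI : G.ISK4Free) (hp : G.IsIPath p 0 n) (hn : 1 ≤ n)
    (hpc : ∀ t s, 0 ≤ t → t ≤ n → c s ≠ p t) {i : ℤ}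
    (hatt : ∀ t s, 0 ≤ t → t ≤ n → i ≤ s → s < i + 4 → (G.Adj (p t) (c s) ↔
      (t = 0 ∧ (s = i ∨ s = i + 2)) ∨ (t = n ∧ (s = i + 1 ∨ s = i + 3)))) :
    ∃ A B, G.IsBiclique A B := by
  have e1 := (hatt 0 i le_rfl (by omega) (by omega) (by omega)).2 (by simp)
  have e2 := (hatt 0 (i + 2) le_rfl (by omega) (by omega) (by omega)).2 (by simp)
  have e3 := (hatt n (i + 1) (by omega) le_rfl (by omega) (by omega)).2 (by simp)
  have e4 := (hatt n (i + 3) (by omega) le_rfl (by omega) (by omega)).2 (by simp)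
  have f1 := hc.adj_succ i
  have f2 := hc.adj_succ (i + 1)
  have f3 := hc.adj_succ (i + 2)
  have f4 := hc.adj_succ (i + 3)
  rw [add_assoc] at f2 f3 f4
  norm_num at f2 f3 f4
  rw [hc.periodic] at f4
  rcases lt_or_eq_of_le hn with hn | rfl
  · exfalso
    have hH := isHoleSet_insert (v := p 0) (hc.isIPath (a := i) (b := i + 2) (by omega)) le_rfl
      (fun s _ _ => hpc 0 s le_rfl (by omega)) (fun s s1 s2 => by
        rw [hatt 0 s le_rfl (by omega) s1 (by omega)]
        omega)
    refine no_three_edges h3 hI hH (isConnOn_pair e4) (a₁ := c i) (a₂ := c (i + 2))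
      (a₃ := c (i + 1)) (t₁ := c (i + 3)) (t₂ := c (i + 3)) (t₃ := p n)
      (hc.ne _ _ (by omega) (by omega)) (hc.ne _ _ (by omega) (by omega))
      (hc.ne _ _ (by omega) (by omega)).symm (.inr ⟨i, ⟨by omega, by omega⟩, rfl⟩)
      (.inr ⟨i + 2, ⟨by omega, by omega⟩, rfl⟩) (.inr ⟨i + 1, ⟨by omega, by omega⟩, rfl⟩)
      (by simp) (by simp) (by simp) f4.symm f3 e3.symm ?_ ?_
    · rintro _ (rfl | ⟨s, ⟨s1, s2⟩, rfl⟩) (h' | h')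
      · exact (hp 0 n le_rfl (by omega) le_rfl).1 h'
      · exact hpc 0 _ le_rfl (by omega) h'.symm
      · exact hpc n _ (by omega) le_rfl h'
      · exact hc.ne _ _ (by omega) (by omega) h'
    · rintro _ (rfl | ⟨s, ⟨s1, s2⟩, rfl⟩) _ (rfl | rfl) hadj
      · have := (hp 0 n le_rfl (by omega) le_rfl).2.1 hadj
        omega
      · rw [hatt 0 _ le_rfl (by omega) (by omega) (by omega)] at hadj
        omega
      · have := (hatt n s (by omega) le_rfl s1 (by omega)).1 hadj.symm
        obtain rfl : s = i + 1 := by omega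
        exact .inr (.inr ⟨rfl, rfl⟩)
      · rw [hc.adj _ _ (by omega) (by omega)] at hadj
        obtain rfl | rfl : s = i ∨ s = i + 2 := by omega
        · exact .inl ⟨rfl, rfl⟩
        · exact .inr (.inl ⟨rfl, rfl⟩)
  · have f5 := hp.adj_succ (i := 0) le_rfl (by omega)
    refine ⟨{c i, c (i + 2), p 1}, {c (i + 1), c (i + 3), p 0}, ?_,
      three_le_ncard_of_mem (Set.toFinite _) (x := c i) (y := c (i + 2)) (z := p 1) (by simp)
        (by simp) (by simp) (hc.ne _ _ (by omega) (by omega)) (hpc _ _ (by omega) (by omega))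
        (hpc _ _ (by omega) (by omega)),
      three_le_ncard_of_mem (Set.toFinite _) (x := c (i + 1)) (y := c (i + 3)) (z := p 0) (by simp)
        (by simp) (by simp) (hc.ne _ _ (by omega) (by omega)) (hpc _ _ (by omega) (by omega))
        (hpc _ _ (by omega) (by omega))⟩
    rintro _ (rfl | rfl | rfl) _ (rfl | rfl | rfl)
    exacts [f1, f4.symm, e1.symm, f2.symm, f3, e2.symm, e3, e4, f5.symm]

/-- A neighbour of `p n` on one of the arcs between `x` and `y` bounds the length of the other arc
by two, through `le_of_fork`. An arc of length two has room for one neighbour only, so both arcs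
contain one; hence `L = 4` and the two pairs alternate. -/
lemma IsHole.exists_isBiclique_of_fork (hc : G.IsHole L c) (h3 : G.CliqueFree 3)
    (hI : G.ISK4Free) (hp : G.IsIPath p 0 n) (hn : 1 ≤ n)
    (hpc : ∀ t s, 0 ≤ t → t ≤ n → c s ≠ p t)
    (hminL : ∀ L' c' T', G.IsHole L' c' → G.IsAttached (Set.range c') T' → L ≤ L')
    {x y z w : V} (hx : x ∈ Set.range c) (hy : y ∈ Set.range c) (hz : z ∈ Set.range c)
    (hw : w ∈ Set.range c) (hxy : x ≠ y) (hxz : x ≠ z) (hxw : x ≠ w) (hyz : y ≠ z) (hyw : y ≠ w)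
    (hzw : z ≠ w) (hatt : ∀ t s, 0 ≤ t → t ≤ n → (G.Adj (p t) (c s) ↔
      (t = 0 ∧ (c s = x ∨ c s = y)) ∨ (t = n ∧ (c s = z ∨ c s = w)))) :
    ∃ A B, G.IsBiclique A B := by
  have hL := hc.four_le
  obtain ⟨i, rfl⟩ := hx
  obtain ⟨j, j1, j2, rfl⟩ := hc.exists_window hy i
  obtain ⟨a, a1, a2, rfl⟩ := hc.exists_window hz i
  obtain ⟨b, b1, b2, rfl⟩ := hc.exists_window hw i
  have hwin : ∀ t s, 0 ≤ t → t ≤ n → i ≤ s → s < i + L → (G.Adj (p t) (c s) ↔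
      (t = 0 ∧ (s = i ∨ s = j)) ∨ (t = n ∧ (s = a ∨ s = b))) := by
    intro t s t1 t2 s1 s2
    rw [hatt t s t1 t2, hc.inj_window i s1 s2 le_rfl (by omega), hc.inj_window i s1 s2 j1 j2,
      hc.inj_window i s1 s2 a1 a2, hc.inj_window i s1 s2 b1 b2]
  have n1 : i ≠ j := fun h' => hxy (by rw [h'])
  have n2 : i ≠ a := fun h' => hxz (by rw [h'])
  have n3 : i ≠ b := fun h' => hxw (by rw [h'])
  have n4 : j ≠ a := fun h' => hyz (by rw [h'])
  have n5 : j ≠ b := fun h' => hyw (by rw [h'])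
  have n6 : a ≠ b := fun h' => hzw (by rw [h'])
  have hi := (hwin 0 i le_rfl (by omega) le_rfl (by omega)).2 (by simp)
  have hj := (hwin 0 j le_rfl (by omega) j1 j2).2 (by simp)
  have ha := (hwin n a (by omega) le_rfl a1 a2).2 (by simp)
  have hb := (hwin n b (by omega) le_rfl b1 b2).2 (by simp)
  have hup : ∀ s, G.Adj (p n) (c s) → j < s → s < i + L → L ≤ j - i + 2 := by
    intro s hs s1 s2
    refine hc.le_of_fork h3 hp hn hpc hminL (by omega) (fun u u1 u2 => ?_) s1 s2 hs
    rw [hwin 0 u le_rfl (by omega) u1 (by omega)]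
    omega
  have hdown : ∀ s, G.Adj (p n) (c s) → i < s → s < j → L ≤ i + L - j + 2 := by
    intro s hs s1 s2
    refine hc.le_of_fork h3 hp hn hpc hminL (i := j) (j := i + L) (s := s + L) (by omega)
      (fun u u1 u2 => ?_) (by omega) (by omega) (by rwa [hc.periodic])
    rcases lt_or_eq_of_le u2 with u2 | rfl
    · rw [hwin 0 u le_rfl (by omega) (by omega) (by omega)]
      omega
    · rw [hc.periodic]
      exact iff_of_true hi (.inr rfl)
  have g1 := hc.spoke_gap h3 hi hj (by omega)
  have g2 := hc.spoke_gap h3 hj (j := i + L) (by rwa [hc.periodic]) (by omega)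
  have u1 := hup a ha
  have u2 := hup b hb
  have u3 := hdown a ha
  have u4 := hdown b hb
  obtain rfl : L = 4 := by omega
  refine hc.exists_isBiclique_of_square h3 hI hp hn hpc (i := i) (fun t s t1 t2 s1 s2 => ?_)
  rw [hwin t s t1 t2 s1 s2]
  omega

/-- If `c m` has a single neighbour on the path, the path sends exactly three edges to the hole.
Otherwise the path replaces the arc through `c m`, and `c m` becomes the hub of a wheel. -/
lemma IsHole.exists_isWheel_of_three (hc : G.IsHole L c) (h3 : G.CliqueFree 3)
    (hI : G.ISK4Free) (hp : G.IsIPath p 0 n) (hn : 1 ≤ n)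
    (hpc : ∀ t s, 0 ≤ t → t ≤ n → c s ≠ p t) {i m j : ℤ} (him : i < m) (hmj : m < j)
    (hji : j < i + L) (hi : G.Adj (p 0) (c i)) (hj : G.Adj (p n) (c j))
    (hm : ∃ t, 0 ≤ t ∧ t ≤ n ∧ G.Adj (p t) (c m))
    (hatt : ∀ t s, 0 ≤ t → t ≤ n → G.Adj (p t) (c s) →
      (t = 0 ∧ c s = c i) ∨ (t = n ∧ c s = c j) ∨ c s = c m) :
    ∃ L c v, G.IsWheel L c v := by
  obtain ⟨t₁, a1, a2, ht₁⟩ := hm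
  by_cases hone : ∃ t, 0 ≤ t ∧ t ≤ n ∧ G.Adj (p t) (c m) ∧ t ≠ t₁
  · obtain ⟨t₂, b1, b2, ht₂, hne⟩ := hone
    have hwin : ∀ t s, 0 ≤ t → t ≤ n → j ≤ s → s ≤ i + L → G.Adj (p t) (c s) →
        (s = i + L ∧ t = 0) ∨ (s = j ∧ t = n) := by
      intro t s u1 u2 s1 s2 hs
      rcases hatt t s u1 u2 hs with ⟨e1, e2⟩ | ⟨e1, e2⟩ | e2
      · rw [← hc.periodic i, hc.inj_window j s1 (by omega) (by omega) (by omega)] at e2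
        exact .inl ⟨e2, e1⟩
      · rw [hc.inj_window j s1 (by omega) le_rfl (by omega)] at e2
        exact .inr ⟨e2, e1⟩
      · exact absurd e2.symm (hc.ne m s (by omega) (by omega))
    obtain ⟨c', hc', -, -, hr⟩ := exists_isHole_glue
      (hc.isIPath (a := j) (b := i + L) (by omega)) hp (by omega) (by omega) (by omega)
      (fun s t _ _ u1 u2 => hpc t s u1 u2) (by
        intro s t s1 s2 u1 u2
        rw [G.adj_comm]
        refine ⟨hwin t s u1 u2 s1 s2, ?_⟩
        rintro (⟨rfl, rfl⟩ | ⟨rfl, rfl⟩)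
        · rwa [hc.periodic]
        · exact hj)
    have hm' : c m ∉ Set.range c' := by
      rw [hr]
      rintro (⟨s, ⟨s1, s2⟩, hs⟩ | ⟨t, ⟨u1, u2⟩, ht⟩)
      · exact hc.ne m s (by omega) (by omega) hs.symm
      · exact hpc t m u1 u2 ht.symm
    have hpne : p t₁ ≠ p t₂ := by
      rw [Ne, hp.inj a1 a2 b1 b2]
      exact hne.symm
    have hr₁ : p t₁ ∈ Set.range c' := by
      rw [hr]
      exact .inr ⟨t₁, ⟨a1, a2⟩, rfl⟩
    have hr₂ : p t₂ ∈ Set.range c' := by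
      rw [hr]
      exact .inr ⟨t₂, ⟨b1, b2⟩, rfl⟩
    by_cases hthird : ∃ x ∈ Set.range c', G.Adj (c m) x ∧ x ≠ p t₁ ∧ x ≠ p t₂
    · obtain ⟨x, hx, hmx, hx1, hx2⟩ := hthird
      exact ⟨_, c', c m, hc', hm', three_le_ncard_of_mem (hc'.finite_range.inter_of_right _)
        ⟨ht₁.symm, hr₁⟩ ⟨ht₂.symm, hr₂⟩ ⟨hmx, hx⟩ hpne hx1.symm hx2.symm⟩
    · push Not at hthird
      exfalso
      have hcnot : ∀ s, j ≤ s → s ≤ i + L → ¬ G.Adj (c m) (c s) := by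
        intro s s1 s2 hs
        by_cases e : c s = p t₁
        · exact hpc _ _ a1 a2 e
        · refine hpc _ _ b1 b2 (hthird (c s) ?_ hs e)
          rw [hr]
          exact .inl ⟨s, ⟨s1, s2⟩, rfl⟩
      have hmj' : m + 1 < j := by
        by_contra hlt
        obtain rfl : j = m + 1 := by omega
        exact hcnot _ le_rfl (by omega) (hc.adj_succ m)
      have hmi' : i + 1 < m := by
        by_contra hlt
        obtain rfl : m = i + 1 := by omega
        refine hcnot (i + L) (by omega) le_rfl ?_
        rw [hc.periodic]
        exact (hc.adj_succ i).symm
      -- If `c m` has only two neighbours on the new hole, the arc from `i + 1` to `m` adds a third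
      -- edge, at `c i`; it does not reach `c j` because `m + 1 < j`.
      refine no_three_edges h3 hI hc'.isHoleSet (hc.isConnOn_arc (i + 1) m) (a₁ := c (i + L))
        (a₂ := p t₁) (a₃ := p t₂) (t₁ := c (i + 1)) (t₂ := c m) (t₃ := c m)
        (hpc _ _ a1 a2) (hpc _ _ b1 b2) hpne ?_ hr₁ hr₂ ⟨_, ⟨le_rfl, by omega⟩, rfl⟩
        ⟨_, ⟨by omega, le_rfl⟩, rfl⟩ ⟨_, ⟨by omega, le_rfl⟩, rfl⟩ ?_ ht₁ ht₂ ?_ ?_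
      · rw [hr]
        exact .inl ⟨i + L, ⟨by omega, le_rfl⟩, rfl⟩
      · rw [hc.periodic]
        exact hc.adj_succ i
      · rw [hr]
        rintro _ (⟨s, ⟨s1, s2⟩, rfl⟩ | ⟨t, ⟨u1, u2⟩, rfl⟩) ⟨w, ⟨w1, w2⟩, hw⟩
        · exact hc.ne w s (by omega) (by omega) hw
        · exact hpc t w u1 u2 hw
      · rw [hr]
        rintro _ (⟨s, ⟨s1, s2⟩, rfl⟩ | ⟨t, ⟨u1, u2⟩, rfl⟩) _ ⟨w, ⟨w1, w2⟩, rfl⟩ hadj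
        · have := (hc.adj w s (by omega) (by omega)).1 hadj.symm
          obtain ⟨rfl, rfl⟩ : s = i + L ∧ w = i + 1 := by omega
          exact .inl ⟨rfl, rfl⟩
        · rcases hatt t w u1 u2 hadj with ⟨-, e⟩ | ⟨-, e⟩ | e
          · exact absurd e.symm (hc.ne i w (by omega) (by omega))
          · exact absurd e (hc.ne w j (by omega) (by omega))
          · obtain rfl := (hc.inj_window i (by omega) (by omega) (by omega) (by omega)).1 e
            by_cases e' : p t = p t₁
            · exact .inr (.inl ⟨e', rfl⟩)
            · refine .inr (.inr ⟨hthird (p t) ?_ hadj.symm e', rfl⟩)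
              rw [hr]
              exact .inr ⟨t, ⟨u1, u2⟩, rfl⟩
  · push Not at hone
    exfalso
    refine no_three_edges h3 hI hc.isHoleSet hp.isConnOn (a₁ := c i) (a₂ := c j) (a₃ := c m)
      (t₁ := p 0) (t₂ := p n) (t₃ := p t₁) (hc.ne _ _ (by omega) (by omega))
      (hc.ne _ _ him (by omega)) (hc.ne _ _ hmj (by omega)).symm ⟨_, rfl⟩ ⟨_, rfl⟩ ⟨_, rfl⟩
      ⟨0, ⟨le_rfl, by omega⟩, rfl⟩ ⟨n, ⟨by omega, le_rfl⟩, rfl⟩ ⟨t₁, ⟨a1, a2⟩, rfl⟩ hi.symm hj.symm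
      ht₁.symm ?_ ?_
    · rintro _ ⟨s, rfl⟩ ⟨t, ⟨u1, u2⟩, ht⟩
      exact hpc t s u1 u2 ht.symm
    · rintro _ ⟨s, rfl⟩ _ ⟨t, ⟨u1, u2⟩, rfl⟩ hadj
      rcases hatt t s u1 u2 hadj.symm with ⟨rfl, e⟩ | ⟨rfl, e⟩ | e
      · exact .inl ⟨e, rfl⟩
      · exact .inr (.inl ⟨e, rfl⟩)
      · rw [e] at hadj
        exact .inr (.inr ⟨e, by rw [hone t u1 u2 hadj.symm]⟩)

end

end SimpleGraph

/-! ### Minimal attached sets -/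

namespace SimpleGraph

variable {V : Type*} {G : SimpleGraph V}

lemma attach_mono {H S T : Set V} (h : S ⊆ T) : G.attach H S ⊆ G.attach H T :=
  fun _ ⟨hx, t, ht, hxt⟩ => ⟨hx, t, h ht, hxt⟩

lemma not_three_attached {H S T : Set V} (hT : G.IsAttached H T)
    (hminT : ∀ S, S ⊆ T → G.IsAttached H S → S = T) (hST : S ⊆ T) (hne : S ≠ T)
    (hS : G.IsConnOn S) {x y z : V} (hx : x ∈ G.attach H S) (hy : y ∈ G.attach H S)
    (hz : z ∈ G.attach H S) : x = y ∨ x = z ∨ y = z := by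
  by_contra! hn
  exact hne (hminT S hST ⟨hS, fun w hw hw' => hT.disj w hw (hST hw'), x, y, z, hx, hy, hz,
    hn.1, hn.2.1, hn.2.2⟩)

section

variable {L : ℤ} {c p : ℤ → V} {n : ℤ}

/-- A one-vertex path is a hub. Otherwise, by minimality, dropping either end leaves at most two
attached vertices; so one vertex `a` is attached to `p 0` only and another, `d`, to `p n` only. With
just one more attached vertex, `exists_isWheel_of_three` applies; with more, the attachments split
into two pairs, one at each end. -/
lemma IsHole.wheel_or_biclique_of_path (hc : G.IsHole L c) (h3 : G.CliqueFree 3)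
    (hI : G.ISK4Free) (hp : G.IsIPath p 0 n) (hn : 0 ≤ n)
    (hT : G.IsAttached (Set.range c) (p '' Set.Icc 0 n))
    (hminL : ∀ L' c' T', G.IsHole L' c' → G.IsAttached (Set.range c') T' → L ≤ L')
    (hminT : ∀ S, S ⊆ p '' Set.Icc 0 n → G.IsAttached (Set.range c) S → S = p '' Set.Icc 0 n) :
    (∃ L c v, G.IsWheel L c v) ∨ ∃ A B, G.IsBiclique A B := by
  have hpc : ∀ t s, 0 ≤ t → t ≤ n → c s ≠ p t := fun t s h1 h2 h' =>
    hT.disj (c s) ⟨s, rfl⟩ ⟨t, ⟨h1, h2⟩, h'.symm⟩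
  obtain ⟨x, y, z, hx, hy, hz, hxy, hxz, hyz⟩ := hT.three
  rcases eq_or_lt_of_le hn with rfl | hn
  · left
    have key : ∀ x ∈ G.attach (Set.range c) (p '' Set.Icc 0 0),
        x ∈ G.neighborSet (p 0) ∩ Set.range c := by
      rintro x ⟨hx, _, ⟨t, ⟨t1, t2⟩, rfl⟩, hxt⟩
      obtain rfl : t = 0 := by omega
      exact ⟨hxt.symm, hx⟩
    exact ⟨L, c, p 0, hc, fun h' => hT.disj _ h' ⟨0, ⟨le_rfl, le_rfl⟩, rfl⟩,
      three_le_ncard_of_mem (hc.finite_range.inter_of_right _) (key x hx) (key y hy) (key z hz)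
        hxy hxz hyz⟩
  have s1 : p '' Set.Icc 0 (n - 1) ⊆ p '' Set.Icc 0 n :=
    Set.image_mono (Set.Icc_subset_Icc le_rfl (by omega))
  have s2 : p '' Set.Icc 1 n ⊆ p '' Set.Icc 0 n :=
    Set.image_mono (Set.Icc_subset_Icc (by omega) le_rfl)
  have hs1 : ∀ {x y z}, x ∈ G.attach (Set.range c) (p '' Set.Icc 0 (n - 1)) →
      y ∈ G.attach (Set.range c) (p '' Set.Icc 0 (n - 1)) →
      z ∈ G.attach (Set.range c) (p '' Set.Icc 0 (n - 1)) → x = y ∨ x = z ∨ y = z := by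
    refine fun hx hy hz => not_three_attached hT hminT s1 (fun heq => ?_)
      (hp.mono le_rfl (by omega)).isConnOn hx hy hz
    have : p n ∈ p '' Set.Icc 0 n := ⟨n, ⟨hn.le, le_rfl⟩, rfl⟩
    rw [← heq] at this
    obtain ⟨t, ⟨t1, t2⟩, ht⟩ := this
    exact (hp t n t1 (by omega) le_rfl).1 ht
  have hs2 : ∀ {x y z}, x ∈ G.attach (Set.range c) (p '' Set.Icc 1 n) →
      y ∈ G.attach (Set.range c) (p '' Set.Icc 1 n) →
      z ∈ G.attach (Set.range c) (p '' Set.Icc 1 n) → x = y ∨ x = z ∨ y = z := by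
    refine fun hx hy hz => not_three_attached hT hminT s2 (fun heq => ?_)
      (hp.mono (by omega) le_rfl).isConnOn hx hy hz
    have : p 0 ∈ p '' Set.Icc 0 n := ⟨0, ⟨le_rfl, hn.le⟩, rfl⟩
    rw [← heq] at this
    obtain ⟨t, ⟨t1, t2⟩, ht⟩ := this
    exact (hp 0 t le_rfl (by omega) t2).1 ht.symm
  have m1 : ∀ {t s}, 0 ≤ t → t < n → G.Adj (p t) (c s) →
      c s ∈ G.attach (Set.range c) (p '' Set.Icc 0 (n - 1)) := fun {t s} h1 h2 h =>
    ⟨⟨s, rfl⟩, p t, ⟨t, ⟨h1, by omega⟩, rfl⟩, h.symm⟩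
  have m2 : ∀ {t s}, 0 < t → t ≤ n → G.Adj (p t) (c s) →
      c s ∈ G.attach (Set.range c) (p '' Set.Icc 1 n) := fun {t s} h1 h2 h =>
    ⟨⟨s, rfl⟩, p t, ⟨t, ⟨by omega, by omega⟩, rfl⟩, h.symm⟩
  -- a vertex attached to the first vertex only, and one attached to the last vertex only
  obtain ⟨a, ha, ha2⟩ : ∃ a ∈ G.attach (Set.range c) (p '' Set.Icc 0 n),
      a ∉ G.attach (Set.range c) (p '' Set.Icc 1 n) := by
    by_contra! h'
    have := hs2 (h' x hx) (h' y hy) (h' z hz)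
    tauto
  obtain ⟨d, hd, hd1⟩ : ∃ d ∈ G.attach (Set.range c) (p '' Set.Icc 0 n),
      d ∉ G.attach (Set.range c) (p '' Set.Icc 0 (n - 1)) := by
    by_contra! h'
    have := hs1 (h' x hx) (h' y hy) (h' z hz)
    tauto
  have honly0 : ∀ a, a ∈ G.attach (Set.range c) (p '' Set.Icc 0 n) →
      a ∉ G.attach (Set.range c) (p '' Set.Icc 1 n) → G.Adj (p 0) a := by
    rintro a ⟨⟨s, rfl⟩, _, ⟨t, ⟨t1, t2⟩, rfl⟩, hat⟩ hn'
    rcases eq_or_lt_of_le t1 with rfl | t1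
    · exact hat.symm
    · exact absurd (m2 t1 t2 hat.symm) hn'
  have honlyn : ∀ a, a ∈ G.attach (Set.range c) (p '' Set.Icc 0 n) →
      a ∉ G.attach (Set.range c) (p '' Set.Icc 0 (n - 1)) → G.Adj (p n) a := by
    rintro a ⟨⟨s, rfl⟩, _, ⟨t, ⟨t1, t2⟩, rfl⟩, hat⟩ hn'
    rcases eq_or_lt_of_le t2 with rfl | t2
    · exact hat.symm
    · exact absurd (m1 t1 t2 hat.symm) hn'
  have ha0 := honly0 a ha ha2
  have hdn := honlyn d hd hd1
  have ha1 : a ∈ G.attach (Set.range c) (p '' Set.Icc 0 (n - 1)) :=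
    ⟨ha.1, p 0, ⟨0, ⟨le_rfl, by omega⟩, rfl⟩, ha0.symm⟩
  have hd2 : d ∈ G.attach (Set.range c) (p '' Set.Icc 1 n) :=
    ⟨hd.1, p n, ⟨n, ⟨by omega, le_rfl⟩, rfl⟩, hdn.symm⟩
  have had : a ≠ d := by
    rintro rfl
    exact hd1 ha1
  have hor : ∀ b ∈ G.attach (Set.range c) (p '' Set.Icc 0 n),
      b ∈ G.attach (Set.range c) (p '' Set.Icc 0 (n - 1)) ∨
      b ∈ G.attach (Set.range c) (p '' Set.Icc 1 n) := by
    rintro _ ⟨⟨s, rfl⟩, _, ⟨t, ⟨t1, t2⟩, rfl⟩, hb⟩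
    rcases eq_or_lt_of_le t1 with rfl | t1
    · exact .inl (m1 le_rfl hn hb.symm)
    · exact .inr (m2 t1 t2 hb.symm)
  obtain ⟨b, hb, hba, hbd⟩ : ∃ b ∈ G.attach (Set.range c) (p '' Set.Icc 0 n), b ≠ a ∧ b ≠ d := by
    by_contra! h'
    have e1 := h' x hx
    have e2 := h' y hy
    have e3 := h' z hz
    by_cases x1 : x = a
    · have y1 := e2 (fun h' => hxy (x1.trans h'.symm))
      have z1 := e3 (fun h' => hxz (x1.trans h'.symm))
      exact hyz (y1.trans z1.symm)
    · by_cases y1 : y = a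
      · exact hxz ((e1 x1).trans (e3 (fun h' => hyz (y1.trans h'.symm))).symm)
      · exact hxy ((e1 x1).trans (e2 y1).symm)
  by_cases h4 : ∃ b' ∈ G.attach (Set.range c) (p '' Set.Icc 0 n), b' ≠ a ∧ b' ≠ d ∧ b' ≠ b
  · right
    obtain ⟨b, b', hb, hb', hba, hbd, hba', hbd', hbb⟩ : ∃ b b',
        b ∈ G.attach (Set.range c) (p '' Set.Icc 0 (n - 1)) ∧
        b' ∈ G.attach (Set.range c) (p '' Set.Icc 1 n) ∧ b ≠ a ∧ b ≠ d ∧ b' ≠ a ∧ b' ≠ d ∧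
        b' ≠ b := by
      obtain ⟨b', hb', hba', hbd', hbb⟩ := h4
      rcases hor b hb with k1 | k1 <;> rcases hor b' hb' with k2 | k2
      · have := hs1 ha1 k1 k2
        grind
      · exact ⟨b, b', k1, k2, hba, hbd, hba', hbd', hbb⟩
      · exact ⟨b', b, k2, k1, hba', hbd', hba, hbd, hbb.symm⟩
      · have := hs2 hd2 k1 k2
        grind
    -- If `b` were also attached to a later vertex, the path without `p 0` would be attached to `d`,
    -- `b` and `b'`.
    have hb0 := honly0 b (attach_mono s1 hb) (fun h' => by
      have := hs2 hd2 h' hb'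
      grind)
    have hbn := honlyn b' (attach_mono s2 hb') (fun h' => by
      have := hs1 ha1 hb h'
      grind)
    refine hc.exists_isBiclique_of_fork h3 hI hp hn hpc hminL (x := a) (y := b) (z := d) (w := b')
      ha.1 hb.1 hd.1 hb'.1 hba.symm had hba'.symm hbd hbb.symm hbd'.symm ?_
    intro t s t1 t2
    constructor
    · intro hadj
      have k1 : t < n → c s = a ∨ c s = b := by
        intro hlt
        have := hs1 ha1 hb (m1 t1 hlt hadj)
        grind
      have k2 : 0 < t → c s = d ∨ c s = b' := by
        intro hlt
        have := hs2 hd2 hb' (m2 hlt t2 hadj)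
        grind
      rcases eq_or_lt_of_le t1 with rfl | t1
      · exact .inl ⟨rfl, k1 hn⟩
      · rcases eq_or_lt_of_le t2 with rfl | t2
        · exact .inr ⟨rfl, k2 t1⟩
        · exfalso
          have := k1 t2
          have := k2 t1
          grind
    · rintro (⟨rfl, h' | h'⟩ | ⟨rfl, h' | h'⟩) <;> rw [h'] <;> assumption
  · left
    push Not at h4
    obtain ⟨i, rfl⟩ := ha.1
    obtain ⟨j, j1, j2, rfl⟩ := hc.exists_window hd.1 i
    obtain ⟨m, k1, k2, rfl⟩ := hc.exists_window hb.1 i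
    have hij : i ≠ j := fun h' => had (by rw [h'])
    have him : m ≠ i := fun h' => hba (by rw [h'])
    have hjm : m ≠ j := fun h' => hbd (by rw [h'])
    have hatt : ∀ t s, 0 ≤ t → t ≤ n → G.Adj (p t) (c s) →
        (t = 0 ∧ c s = c i) ∨ (t = n ∧ c s = c j) ∨ c s = c m := by
      intro t s t1 t2 hadj
      have hs : c s ∈ G.attach (Set.range c) (p '' Set.Icc 0 n) :=
        ⟨⟨s, rfl⟩, p t, ⟨t, ⟨t1, t2⟩, rfl⟩, hadj.symm⟩
      by_cases q1 : c s = c i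
      · refine .inl ⟨?_, q1⟩
        by_contra hne
        rw [q1] at hadj
        exact ha2 (m2 (by omega) t2 hadj)
      · by_cases q2 : c s = c j
        · refine .inr (.inl ⟨?_, q2⟩)
          by_contra hne
          rw [q2] at hadj
          exact hd1 (m1 t1 (by omega) hadj)
        · exact .inr (.inr (h4 _ hs q1 q2))
    obtain ⟨-, _, ⟨t, ⟨t1, t2⟩, rfl⟩, hbt⟩ := hb
    -- If `m` is on the other arc, the path is read backwards and the order is `j`, `m`, `i + L`.
    rcases lt_or_gt_of_ne hjm with hlt | hlt
    · exact hc.exists_isWheel_of_three h3 hI hp hn hpc (by omega) hlt j2 ha0 hdn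
        ⟨t, t1, t2, hbt.symm⟩ hatt
    · have hrev := hp.reverse n
      rw [sub_self, sub_zero] at hrev
      refine hc.exists_isWheel_of_three h3 hI hrev hn
        (fun t s t1 t2 => hpc _ _ (by omega) (by omega)) (i := j) (m := m) (j := i + L) hlt
        (by omega) (by omega) (by simpa using hdn) ?_ ⟨n - t, by omega, by omega, ?_⟩ ?_
      · rw [hc.periodic]
        simpa using ha0
      · simpa using hbt.symm
      · intro t s t1 t2 hadj
        rw [hc.periodic]
        rcases hatt (n - t) s (by omega) (by omega) hadj with ⟨e1, e2⟩ | ⟨e1, e2⟩ | e2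
        · exact .inr (.inl ⟨by omega, e2⟩)
        · exact .inl ⟨by omega, e2⟩
        · exact .inr (.inr e2)

end

/-- The union of two legs of a tripod is an induced path. -/
lemma IsTripod.exists_isIPath {T : Set V} {f : Fin 3 → ℤ → V} {n : Fin 3 → ℤ}
    (h : G.IsTripod T f n) {r s : Fin 3} (hrs : r ≠ s) :
    ∃ p k, 0 ≤ k ∧ G.IsIPath p 0 k ∧
      p '' Set.Icc 0 k = f r '' Set.Icc 0 (n r) ∪ f s '' Set.Icc 0 (n s) := by
  have hr := h.nonneg r
  have hs := h.nonneg s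
  refine ⟨fun i => if i ≤ n r then f r (n r - i) else f s (i - n r), n r + n s, by omega, ?_, ?_⟩
  · intro i j h1 h2 h4
    beta_reduce
    by_cases hj : j ≤ n r
    · rw [if_pos (by omega), if_pos hj]
      have := h.ipath r (n r - j) (n r - i) (by omega) (by omega) (by omega)
      refine ⟨this.1.symm, ?_⟩
      rw [G.adj_comm, this.2]
      omega
    · rw [if_neg hj]
      by_cases hi : i < n r
      · rw [if_pos hi.le]
        refine ⟨h.ne r s hrs _ _ (by omega) (by omega) (by omega) (by omega), ?_⟩
        refine iff_of_false (h.not_adj r s hrs _ _ (by omega) (by omega) (by omega) (by omega)) ?_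
        omega
      · have hi' : (if i ≤ n r then f r (n r - i) else f s (i - n r)) = f s (i - n r) := by
          split_ifs with hi'
          · obtain rfl : i = n r := by omega
            rw [sub_self]
            exact h.center r s
          · rfl
        rw [hi']
        have := h.ipath s (i - n r) (j - n r) (by omega) (by omega) (by omega)
        refine ⟨this.1, ?_⟩
        rw [this.2]
        omega
  · ext x
    constructor
    · rintro ⟨i, ⟨h1, h2⟩, rfl⟩
      beta_reduce
      split_ifs
      · exact .inl ⟨_, ⟨by omega, by omega⟩, rfl⟩
      · exact .inr ⟨_, ⟨by omega, by omega⟩, rfl⟩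
    · rintro (⟨i, ⟨h1, h2⟩, rfl⟩ | ⟨i, ⟨h1, h2⟩, rfl⟩)
      · refine ⟨n r - i, ⟨by omega, by omega⟩, ?_⟩
        beta_reduce
        rw [if_pos (by omega), sub_sub_cancel]
      · refine ⟨n r + i, ⟨by omega, by omega⟩, ?_⟩
        beta_reduce
        rcases eq_or_lt_of_le h1 with rfl | h1
        · rw [if_pos (by omega), add_zero, sub_self]
          exact h.center r s
        · rw [if_neg (by omega), add_sub_cancel_left]

/-- A hole with a minimal connected set attached to three of its vertices gives a wheel or a
biclique. -/
lemma IsHole.wheel_or_biclique {L : ℤ} {c : ℤ → V} (hc : G.IsHole L c) (h3 : G.CliqueFree 3)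
    (hI : G.ISK4Free) {T : Set V} (hT : G.IsAttached (Set.range c) T)
    (hminL : ∀ L' c' T', G.IsHole L' c' → G.IsAttached (Set.range c') T' → L ≤ L')
    (hminT : ∀ S, S ⊆ T → G.IsAttached (Set.range c) S → S = T) :
    (∃ L c v, G.IsWheel L c v) ∨ ∃ A B, G.IsBiclique A B := by
  obtain ⟨a, t, ha, hai, ht, hat⟩ : ∃ a t : Fin 3 → V, (∀ r, a r ∈ Set.range c) ∧
      (∀ r s, r ≠ s → a r ≠ a s) ∧ (∀ r, t r ∈ T) ∧ ∀ r, G.Adj (a r) (t r) := by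
    obtain ⟨x, y, z, ⟨hx, tx, htx, hx'⟩, ⟨hy, ty, hty, hy'⟩, ⟨hz, tz, htz, hz'⟩, hxy, hxz, hyz⟩ :=
      hT.three
    refine ⟨![x, y, z], ![tx, ty, tz], ?_, ?_, ?_, ?_⟩
    · intro r
      fin_cases r <;> assumption
    · intro r s hrs
      fin_cases r <;> fin_cases s <;>
        first | exact absurd rfl hrs | assumption | exact Ne.symm (by assumption)
    · intro r
      fin_cases r <;> assumption
    · intro r
      fin_cases r <;> assumption
  obtain ⟨f, n, hf, hft⟩ := exists_isTripod h3 hT.conn t ht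
  let U : (Fin 3 → ℤ) → Set V := fun m =>
    f 0 '' Set.Icc 0 (m 0) ∪ f 1 '' Set.Icc 0 (m 1) ∪ f 2 '' Set.Icc 0 (m 2)
  have hmemU : ∀ m x, x ∈ U m ↔ ∃ r i, 0 ≤ i ∧ i ≤ m r ∧ f r i = x := by
    intro m x
    constructor
    · rintro ((⟨i, ⟨h1, h2⟩, rfl⟩ | ⟨i, ⟨h1, h2⟩, rfl⟩) | ⟨i, ⟨h1, h2⟩, rfl⟩)
      exacts [⟨_, i, h1, h2, rfl⟩, ⟨_, i, h1, h2, rfl⟩, ⟨_, i, h1, h2, rfl⟩]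
    · rintro ⟨r, i, h1, h2, rfl⟩
      fin_cases r
      exacts [.inl (.inl ⟨i, ⟨h1, h2⟩, rfl⟩), .inl (.inr ⟨i, ⟨h1, h2⟩, rfl⟩), .inr ⟨i, ⟨h1, h2⟩, rfl⟩]
  have hUconn : ∀ m : Fin 3 → ℤ, (∀ r, 0 ≤ m r) → (∀ r, m r ≤ n r) → G.IsConnOn (U m) := by
    intro m h0 hmn
    have hA : ∀ r, G.IsConnOn (f r '' Set.Icc 0 (m r)) := fun r =>
      ((hf.ipath r).mono le_rfl (hmn r)).isConnOn
    have hA0 : ∀ r, f 0 0 ∈ f r '' Set.Icc 0 (m r) := fun r =>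
      ⟨0, ⟨le_rfl, h0 r⟩, hf.center r 0⟩
    exact ((hA 0).union_of_mem (hA 1) (hA0 0) (hA0 1)).union_of_mem (hA 2) (.inl (hA0 0)) (hA0 2)
  have hUT : ∀ m : Fin 3 → ℤ, (∀ r, m r ≤ n r) → U m ⊆ T := by
    intro m hmn x hx
    obtain ⟨r, i, h1, h2, rfl⟩ := (hmemU m x).1 hx
    exact hf.mem r i h1 (h2.trans (hmn r))
  -- The tripod is attached to `a 0`, `a 1`, `a 2`, so by minimality it is all of `T`.
  have hUn : U n = T := by
    have hatt : ∀ r, a r ∈ G.attach (Set.range c) (U n) := fun r =>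
      ⟨ha r, t r, (hmemU _ _).2 ⟨r, n r, hf.nonneg r, le_rfl, hft r⟩, hat r⟩
    exact hminT _ (hUT n fun _ => le_rfl) ⟨hUconn n hf.nonneg fun _ => le_rfl,
      fun x hx hx' => hT.disj x hx (hUT n (fun _ => le_rfl) hx'), a 0, a 1, a 2, hatt 0, hatt 1,
      hatt 2, hai _ _ (by decide), hai _ _ (by decide), hai _ _ (by decide)⟩
  -- With a trivial leg the tripod is an induced path. Otherwise removing the end of a leg loses an
  -- attachment, which forces exactly three edges.
  by_cases hzero : ∃ r, n r = 0
  · obtain ⟨r, hr⟩ := hzero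
    obtain ⟨s, u, hsu, hall⟩ : ∃ s u : Fin 3, s ≠ u ∧ ∀ x, x = r ∨ x = s ∨ x = u := by
      clear hr
      revert r
      decide
    obtain ⟨p, k, hk, hp, hpr⟩ := hf.exists_isIPath hsu
    have hpT : p '' Set.Icc 0 k = T := by
      rw [hpr, ← hUn]
      ext x
      rw [hmemU]
      constructor
      · rintro (⟨i, ⟨h1, h2⟩, rfl⟩ | ⟨i, ⟨h1, h2⟩, rfl⟩)
        exacts [⟨_, i, h1, h2, rfl⟩, ⟨_, i, h1, h2, rfl⟩]
      · rintro ⟨x, i, h1, h2, rfl⟩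
        rcases hall x with rfl | rfl | rfl
        · obtain rfl : i = 0 := by omega
          exact .inl ⟨0, ⟨le_rfl, hf.nonneg s⟩, hf.center _ _⟩
        · exact .inl ⟨i, ⟨h1, h2⟩, rfl⟩
        · exact .inr ⟨i, ⟨h1, h2⟩, rfl⟩
    subst hpT
    exact hc.wheel_or_biclique_of_path h3 hI hp hk hT hminL hminT
  · push Not at hzero
    exfalso
    have hpos : ∀ r, 1 ≤ n r := fun r => by
      have := hf.nonneg r
      have := hzero r
      omega
    have hinj : ∀ r s i, 0 ≤ i → i ≤ n s → f s i = f r (n r) → s = r ∧ i = n r := by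
      intro r s i h1 h2 heq
      by_cases hsr : s = r
      · subst hsr
        exact ⟨rfl, ((hf.ipath s).inj h1 h2 (hf.nonneg s) le_rfl).1 heq⟩
      · exfalso
        rcases eq_or_lt_of_le h1 with rfl | h1
        · rw [hf.center s r] at heq
          exact (hf.ipath r 0 (n r) le_rfl (hpos r) le_rfl).1 heq
        · exact hf.ne s r hsr i (n r) h1 h2 (hpos r) le_rfl heq
    -- the attachments of the tripod with a leaf removed
    have hleaf : ∀ r s i x, 0 ≤ i → i ≤ n s → (s = r → i < n s) → x ∈ Set.range c →
        G.Adj x (f s i) → ∃ u, u ≠ r ∧ x = a u := by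
      intro r s i x h1 h2 hsr hx hadj
      let m : Fin 3 → ℤ := fun u => if u = r then n u - 1 else n u
      have hm0 : ∀ u, 0 ≤ m u := fun u => by
        have := hpos u
        simp only [m]
        split_ifs <;> omega
      have hmn : ∀ u, m u ≤ n u := fun u => by
        by_cases hu : u = r <;> simp [m, hu]
      have hne : U m ≠ T := by
        intro heq
        have h5 := ht r
        rw [← heq, hmemU] at h5
        obtain ⟨u, j, j1, j2, hj⟩ := h5
        obtain ⟨rfl, rfl⟩ := hinj r u j j1 (j2.trans (hmn u)) (hj.trans (hft r).symm)
        simp [m] at j2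
      have hxU : x ∈ G.attach (Set.range c) (U m) := by
        refine ⟨hx, f s i, (hmemU _ _).2 ⟨s, i, h1, ?_, rfl⟩, hadj⟩
        by_cases hs : s = r
        · have := hsr hs
          simp only [m, if_pos hs]
          omega
        · simpa only [m, if_neg hs] using h2
      have haU : ∀ u, u ≠ r → a u ∈ G.attach (Set.range c) (U m) := by
        intro u hu
        refine ⟨ha u, t u, (hmemU _ _).2 ⟨u, n u, hf.nonneg u, ?_, hft u⟩, hat u⟩
        simp only [m, if_neg hu, le_refl]
      obtain ⟨u, w, huw, hur, hwr⟩ : ∃ u w : Fin 3, u ≠ w ∧ u ≠ r ∧ w ≠ r :=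
        (by decide : ∀ r : Fin 3, ∃ u w : Fin 3, u ≠ w ∧ u ≠ r ∧ w ≠ r) r
      rcases not_three_attached hT hminT (hUT m hmn) hne (hUconn m hm0 hmn) hxU (haU u hur)
        (haU w hwr) with e | e | e
      · exact ⟨u, hur, e⟩
      · exact ⟨w, hwr, e⟩
      · exact absurd e (hai u w huw)
    have honly : ∀ x ∈ Set.range c, ∀ y ∈ T, G.Adj x y → ∃ r, x = a r ∧ y = t r := by
      intro x hx y hy hadj
      rw [← hUn, hmemU] at hy
      obtain ⟨s, i, h1, h2, rfl⟩ := hy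
      have key : ∀ r, (s = r → i < n s) → x ≠ a r := by
        intro r hsr hxr
        obtain ⟨u, hu, hxu⟩ := hleaf r s i x h1 h2 hsr hx hadj
        exact hai u r hu (hxu.symm.trans hxr)
      -- Any leg other than `s` serves here, to learn that `x` is one of the `a u`; then `key`
      -- leaves only `u = s`.
      obtain ⟨u, hu, hxu⟩ : ∃ u, u ≠ s + 1 ∧ x = a u := hleaf (s + 1) s i x h1 h2 (fun e => by
        exfalso
        revert e
        clear * -
        decide +revert) hx hadj
      have hus : u = s := by
        by_contra hne
        exact key u (fun e => absurd e.symm hne) hxu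
      subst hus
      refine ⟨u, hxu, ?_⟩
      rcases eq_or_lt_of_le h2 with rfl | h2
      · exact hft u
      · exact absurd hxu (key u fun _ => h2)
    refine no_three_edges h3 hI hc.isHoleSet hT.conn (hai 0 1 (by decide)) (hai 0 2 (by decide))
      (hai 1 2 (by decide)) (ha 0) (ha 1) (ha 2) (ht 0) (ht 1) (ht 2) (hat 0) (hat 1) (hat 2)
      hT.disj ?_
    intro x hx y hy hadj
    obtain ⟨r, rfl, rfl⟩ := honly x hx y hy hadj
    fin_cases r
    exacts [.inl ⟨rfl, rfl⟩, .inr (.inl ⟨rfl, rfl⟩), .inr (.inr ⟨rfl, rfl⟩)]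

/-- A triangle-free ISK4-free graph that is not series-parallel contains a wheel or a biclique. -/
theorem wheel_or_biclique [Finite V] (h3 : G.CliqueFree 3) (hI : G.ISK4Free)
    (hsp : ¬ G.IsSeriesParallel) :
    (∃ L c v, G.IsWheel L c v) ∨ ∃ A B, G.IsBiclique A B := by
  classical
  obtain ⟨L₀, c₀, T₀, hc₀, hT₀⟩ := exists_isCyc_of_not_isSeriesParallel hsp
  obtain ⟨L, -, -, ⟨c, T, hcyc, hT⟩, hL⟩ := exists_least_int
    (p := fun L => ∃ c T, G.IsCyc L c ∧ G.IsAttached (Set.range c) T) hc₀.three_le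
    ⟨c₀, T₀, hc₀, hT₀⟩
  have hmin : ∀ L' c' T', G.IsCyc L' c' → G.IsAttached (Set.range c') T' → L ≤ L' := by
    intro L' c' T' hc' hT'
    by_contra hlt
    exact hL L' hc'.three_le (by omega) ⟨c', T', hc', hT'⟩
  have hc := hcyc.isHole h3 hT hmin
  -- For this fixed hole the attached set is now chosen with the fewest vertices.
  have hex : ∃ m : ℕ, ∃ T, G.IsAttached (Set.range c) T ∧ T.ncard = m := ⟨_, T, hT, rfl⟩
  obtain ⟨T, hT, hcard⟩ := Nat.find_spec hex
  refine hc.wheel_or_biclique h3 hI hT (fun L' c' T' hc' hT' => hmin L' c' T'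
    ⟨by have := hc'.four_le; omega, hc'.periodic, hc'.ne, hc'.adj_succ⟩ hT') ?_
  intro S hST hS
  refine Set.eq_of_subset_of_ncard_le hST ?_ (Set.toFinite _)
  rw [hcard]
  exact Nat.find_min' hex ⟨S, hS, rfl⟩

end SimpleGraph

/-! ### Bicliques and clique cutsets -/

namespace SimpleGraph

variable {V : Type*} {G : SimpleGraph V}

lemma exists_mem_ne_ne {s : Set V} (hs : 3 ≤ s.ncard) (x y : V) : ∃ z ∈ s, z ≠ x ∧ z ≠ y := by
  by_contra! h
  have hsub : s ⊆ {x, y} := by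
    intro z hz
    by_cases hzx : z = x
    · exact .inl hzx
    · exact .inr (h z hz hzx)
  have h1 := Set.ncard_le_ncard hsub (Set.toFinite _)
  have h2 := Set.ncard_insert_le x {y}
  rw [Set.ncard_singleton] at h2
  omega

section Biclique

variable {A B : Set V}

lemma IsBiclique.symm (h : G.IsBiclique A B) : G.IsBiclique B A :=
  ⟨fun b hb a ha => (h.adj a ha b hb).symm, h.right, h.left⟩

lemma IsBiclique.not_adj_left (h : G.IsBiclique A B) (h3 : G.CliqueFree 3) {x y : V} (hx : x ∈ A)
    (hy : y ∈ A) : ¬ G.Adj x y := by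
  intro hxy
  obtain ⟨b, hb, -⟩ := exists_mem_ne_ne h.right x x
  exact h3.not_triangle hxy (h.adj y hy b hb) (h.adj x hx b hb)

lemma IsBiclique.disjoint (h : G.IsBiclique A B) {x : V} (hA : x ∈ A) : x ∉ B :=
  fun hB => (h.adj x hA x hB).ne rfl

/-- A four-cycle of a biclique is a hole. -/
lemma isHoleSet_square (h3 : G.CliqueFree 3) {x y z w : V} (hxy : G.Adj x y) (hyz : G.Adj y z)
    (hzw : G.Adj z w) (hwx : G.Adj w x) (hxz : x ≠ z) (hyw : y ≠ w) :
    G.IsHoleSet {w, x, y, z} := by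
  have nxz : ¬ G.Adj x z := fun h => h3.not_triangle hxy hyz h
  have nwy : ¬ G.Adj w y := fun h => h3.not_triangle hwx hxy h
  let f : ℤ → V := fun i => if i = 0 then x else if i = 1 then y else z
  have hf : G.IsIPath f 0 2 := by
    intro i j h1 h2 h4
    obtain ⟨rfl, rfl⟩ | ⟨rfl, rfl⟩ | ⟨rfl, rfl⟩ :
        (i = 0 ∧ j = 1) ∨ (i = 0 ∧ j = 2) ∨ (i = 1 ∧ j = 2) := by omega
    · simpa [f] using ⟨hxy.ne, hxy⟩
    · simpa [f] using ⟨hxz, nxz⟩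
    · simpa [f] using ⟨hyz.ne, hyz⟩
  have := isHoleSet_insert (v := w) hf le_rfl (by
    intro i h1 h2
    obtain rfl | rfl | rfl : i = 0 ∨ i = 1 ∨ i = 2 := by omega
    · simpa [f] using hwx.ne.symm
    · simpa [f] using hyw
    · simpa [f] using hzw.ne) (by
    intro i h1 h2
    obtain rfl | rfl | rfl : i = 0 ∨ i = 1 ∨ i = 2 := by omega
    · simpa [f] using hwx
    · simpa [f] using nwy
    · simpa [f] using hzw.symm)
  convert this using 2
  ext u
  constructor
  · rintro (rfl | rfl | rfl)
    · exact ⟨0, by simp, by simp [f]⟩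
    · exact ⟨1, by simp, by simp [f]⟩
    · exact ⟨2, by simp, by simp [f]⟩
  · rintro ⟨i, ⟨h1, h2⟩, rfl⟩
    obtain rfl | rfl | rfl : i = 0 ∨ i = 1 ∨ i = 2 := by omega
    all_goals simp [f]

/-- A vertex with two neighbours in one side of a biclique is adjacent to the whole side. -/
lemma IsBiclique.adj_of_two (h : G.IsBiclique A B) (h3 : G.CliqueFree 3) (hI : G.ISK4Free) {v : V}
    (hvA : v ∉ A) (hvB : v ∉ B) {a₁ a₂ : V} (h₁ : a₁ ∈ A) (h₂ : a₂ ∈ A) (hne : a₁ ≠ a₂)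
    (hv₁ : G.Adj v a₁) (hv₂ : G.Adj v a₂) : ∀ a ∈ A, G.Adj v a := by
  intro a₃ ha₃
  by_contra hv₃
  obtain ⟨b₁, hb₁, -⟩ := exists_mem_ne_ne h.right v v
  obtain ⟨b₂, hb₂, hb, -⟩ := exists_mem_ne_ne h.right b₁ b₁
  have hvb : ∀ b ∈ B, ¬ G.Adj v b := fun b hb hvb =>
    h3.not_triangle hv₁ (h.adj _ h₁ _ hb) hvb
  have n13 : a₁ ≠ a₃ := fun e => hv₃ (e ▸ hv₁)
  have n23 : a₂ ≠ a₃ := fun e => hv₃ (e ▸ hv₂)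
  -- The square is `v, a₁, b₁, a₂`; the edge `a₃b₂` is attached to it at `a₁`, `a₂`, `b₁`, and also
  -- at `v` unless `a₃` is a nonneighbour.
  refine no_three_edges h3 hI (isHoleSet_square h3 (h.adj _ h₁ _ hb₁) (h.adj _ h₂ _ hb₁).symm
    hv₂.symm hv₁ hne (fun e => hvB (e ▸ hb₁)))
    (isConnOn_pair (h.adj _ ha₃ _ hb₂)) (a₁ := a₁) (a₂ := a₂) (a₃ := b₁) (t₁ := b₂) (t₂ := b₂)
    (t₃ := a₃) hne (h.adj _ h₁ _ hb₁).ne (h.adj _ h₂ _ hb₁).ne (by simp) (by simp) (by simp)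
    (by simp) (by simp) (by simp) (h.adj _ h₁ _ hb₂) (h.adj _ h₂ _ hb₂) (h.adj _ ha₃ _ hb₁).symm
    ?_ ?_
  · rintro _ (rfl | rfl | rfl | rfl) (hx | hx)
    · exact hvA (hx ▸ ha₃)
    · exact hvB (hx ▸ hb₂)
    · exact n13 hx
    · exact (h.adj _ h₁ _ hb₂).ne hx
    · exact (h.adj _ ha₃ _ hb₁).ne hx.symm
    · exact hb hx.symm
    · exact n23 hx
    · exact (h.adj _ h₂ _ hb₂).ne hx
  · rintro _ (rfl | rfl | rfl | rfl) _ (rfl | rfl) hadj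
    · exact absurd hadj hv₃
    · exact absurd hadj (hvb _ hb₂)
    · exact absurd hadj (h.not_adj_left h3 h₁ ha₃)
    · exact .inl ⟨rfl, rfl⟩
    · exact .inr (.inr ⟨rfl, rfl⟩)
    · exact absurd hadj (h.symm.not_adj_left h3 hb₁ hb₂)
    · exact absurd hadj (h.not_adj_left h3 h₂ ha₃)
    · exact .inr (.inl ⟨rfl, rfl⟩)

/-- In a maximal biclique, a vertex outside has at most one neighbour on either side. -/
lemma IsBiclique.eq_of_adj_left [Finite V] (h : G.IsBiclique A B) (h3 : G.CliqueFree 3)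
    (hI : G.ISK4Free) (hmax : ∀ A' B', G.IsBiclique A' B' → (A' ∪ B').ncard ≤ (A ∪ B).ncard)
    {v : V} (hv : v ∉ A ∪ B) {x y : V} (hx : x ∈ A) (hy : y ∈ A) (hvx : G.Adj v x)
    (hvy : G.Adj v y) : x = y := by
  by_contra hne
  have hvA := h.adj_of_two h3 hI (fun h' => hv (.inl h')) (fun h' => hv (.inr h')) hx hy hne hvx hvy
  -- A vertex adjacent to the whole of `A` could be added to `B`.
  have := hmax A (insert v B) ⟨?_, h.left, h.right.trans (Set.ncard_le_ncard (Set.subset_insert _ _)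
    (Set.toFinite _))⟩
  · rw [Set.union_insert, Set.ncard_insert_of_notMem hv (Set.toFinite _)] at this
    omega
  · rintro a ha b (rfl | hb)
    · exact (hvA a ha).symm
    · exact h.adj a ha b hb

/-- In a maximal biclique, a vertex outside has at most one neighbour in the biclique. -/
lemma IsBiclique.eq_of_adj [Finite V] (h : G.IsBiclique A B) (h3 : G.CliqueFree 3)
    (hI : G.ISK4Free) (hmax : ∀ A' B', G.IsBiclique A' B' → (A' ∪ B').ncard ≤ (A ∪ B).ncard)
    {v : V} (hv : v ∉ A ∪ B) {x y : V} (hx : x ∈ A ∪ B) (hy : y ∈ A ∪ B) (hvx : G.Adj v x)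
    (hvy : G.Adj v y) : x = y := by
  rcases hx with hx | hx <;> rcases hy with hy | hy
  · exact h.eq_of_adj_left h3 hI hmax hv hx hy hvx hvy
  · exact (h3.not_triangle hvx (h.adj _ hx _ hy) hvy).elim
  · exact (h3.not_triangle hvx (h.adj _ hy _ hx).symm hvy).elim
  · refine h.symm.eq_of_adj_left h3 hI (fun A' B' h' => ?_) (by rwa [Set.union_comm]) hx hy hvx hvy
    rw [Set.union_comm B A]
    exact hmax A' B' h'

/-- No path outside a biclique joins two vertices of one side, if its interior is attached to at
most one vertex of the other side. -/
lemma IsBiclique.no_ear (h : G.IsBiclique A B) (h3 : G.CliqueFree 3) (hI : G.ISK4Free)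
    {p : ℤ → V} {n : ℤ} (hp : G.IsIPath p 0 n) (hn : 0 ≤ n)
    (hpK : ∀ t, 0 ≤ t → t ≤ n → p t ∉ A ∪ B) {a₁ a₂ b₃ : V} (h₁ : a₁ ∈ A) (h₂ : a₂ ∈ A)
    (hne : a₁ ≠ a₂) (hb₃ : b₃ ∉ A) (ha₁ : G.Adj (p 0) a₁) (ha₂ : G.Adj (p n) a₂)
    (hatt : ∀ t x, 0 ≤ t → t ≤ n → x ∈ A ∪ B → G.Adj (p t) x →
      (t = 0 ∧ x = a₁) ∨ (t = n ∧ x = a₂) ∨ x = b₃) : False := by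
  obtain ⟨b₁, hb₁, n1, -⟩ := exists_mem_ne_ne h.right b₃ b₃
  obtain ⟨b₂, hb₂, n2, n12⟩ := exists_mem_ne_ne h.right b₃ b₁
  obtain ⟨a₃, ha₃, n3, n4⟩ := exists_mem_ne_ne h.left a₁ a₂
  -- The square is `a₁, b₁, a₃, b₂`, avoiding `a₂` and `b₃`. The path with `a₂` is attached to it by
  -- the edges from `p 0` to `a₁` and from `a₂` to `b₁` and `b₂`.
  refine no_three_edges h3 hI (isHoleSet_square h3 (h.adj _ h₁ _ hb₁) (h.adj _ ha₃ _ hb₁).symm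
    (h.adj _ ha₃ _ hb₂) (h.adj _ h₁ _ hb₂).symm n3.symm n12.symm)
    (hp.isConnOn.insert (x := a₂) ⟨n, ⟨hn, le_rfl⟩, rfl⟩ ha₂.symm) (a₁ := a₁) (a₂ := b₁)
    (a₃ := b₂) (t₁ := p 0) (t₂ := a₂) (t₃ := a₂) (h.adj _ h₁ _ hb₁).ne (h.adj _ h₁ _ hb₂).ne
    n12.symm (by simp) (by simp) (by simp) (.inr ⟨0, ⟨le_rfl, hn⟩, rfl⟩) (.inl rfl) (.inl rfl)
    ha₁.symm (h.adj _ h₂ _ hb₁).symm (h.adj _ h₂ _ hb₂).symm ?_ ?_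
  · rintro _ (rfl | rfl | rfl | rfl) (hx | ⟨t, ⟨t1, t2⟩, hx⟩)
    · exact (h.adj _ h₂ _ hb₂).ne hx.symm
    · exact hpK t t1 t2 (hx ▸ .inr hb₂)
    · exact hne hx
    · exact hpK t t1 t2 (hx ▸ .inl h₁)
    · exact (h.adj _ h₂ _ hb₁).ne hx.symm
    · exact hpK t t1 t2 (hx ▸ .inr hb₁)
    · exact n4 hx
    · exact hpK t t1 t2 (hx ▸ .inl ha₃)
  · have hcase : ∀ t x, 0 ≤ t → t ≤ n → x ∈ A ∪ B → x ≠ a₂ → x ≠ b₃ → G.Adj x (p t) →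
        x = a₁ ∧ p t = p 0 := by
      intro t x t1 t2 hx e1 e2 hadj
      rcases hatt t x t1 t2 hx hadj.symm with ⟨rfl, e⟩ | ⟨-, e⟩ | e
      · exact ⟨e, rfl⟩
      · exact absurd e e1
      · exact absurd e e2
    rintro _ (rfl | rfl | rfl | rfl) _ (rfl | ⟨t, ⟨t1, t2⟩, rfl⟩) hadj
    · exact .inr (.inr ⟨rfl, rfl⟩)
    · exact .inl (hcase t _ t1 t2 (.inr hb₂) (h.adj _ h₂ _ hb₂).ne.symm n2 hadj)
    · exact absurd hadj (h.not_adj_left h3 h₁ h₂)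
    · exact .inl (hcase t _ t1 t2 (.inl h₁) hne (fun e => hb₃ (e ▸ h₁)) hadj)
    · exact .inr (.inl ⟨rfl, rfl⟩)
    · exact .inl (hcase t _ t1 t2 (.inr hb₁) (h.adj _ h₂ _ hb₁).ne.symm n1 hadj)
    · exact absurd hadj (h.not_adj_left h3 ha₃ h₂)
    · exact .inl (hcase t _ t1 t2 (.inl ha₃) n4 (fun e => hb₃ (e ▸ ha₃)) hadj)

/-- No shortest path outside a biclique joins two vertices of one side. -/
lemma IsBiclique.no_shortest_ear (h : G.IsBiclique A B) (h3 : G.CliqueFree 3) (hI : G.ISK4Free)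
    {p : ℤ → V} {n : ℤ} (hp : G.IsIPath p 0 n) (hn : 0 ≤ n)
    (hpK : ∀ t, 0 ≤ t → t ≤ n → p t ∉ A ∪ B)
    (hone : ∀ t, 0 ≤ t → t ≤ n → ∀ x ∈ A ∪ B, ∀ y ∈ A ∪ B, G.Adj (p t) x → G.Adj (p t) y → x = y)
    (hmin : ∀ s t x y, 0 ≤ s → s ≤ n → 0 ≤ t → t ≤ n → s - t < n → t - s < n →
      (x ∈ A ∧ y ∈ A ∨ x ∈ B ∧ y ∈ B) → G.Adj (p s) x → G.Adj (p t) y → x = y)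
    {a₁ a₂ : V} (h₁ : a₁ ∈ A) (h₂ : a₂ ∈ A) (hne : a₁ ≠ a₂) (ha₁ : G.Adj (p 0) a₁)
    (ha₂ : G.Adj (p n) a₂) : False := by
  -- Such an attachment would equal both `a₁` and `a₂` by minimality.
  have hmidA : ∀ t x, 0 < t → t < n → x ∈ A → ¬ G.Adj (p t) x := by
    intro t x t1 t2 hx hadj
    exact hne ((hmin 0 t a₁ x le_rfl hn t1.le t2.le (by omega) (by omega) (.inl ⟨h₁, hx⟩) ha₁
      hadj).trans (hmin t n x a₂ t1.le t2.le hn le_rfl (by omega) (by omega) (.inl ⟨hx, h₂⟩) hadj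
      ha₂))
  -- By minimality all attachments of the interior in `B` coincide; if there are none, any vertex of
  -- `B` serves.
  obtain ⟨b₃, hb₃, hb₃'⟩ : ∃ b₃, b₃ ∉ A ∧ ∀ t x, 0 < t → t < n → x ∈ B → G.Adj (p t) x →
      x = b₃ := by
    by_cases hex : ∃ t b, 0 < t ∧ t < n ∧ b ∈ B ∧ G.Adj (p t) b
    · obtain ⟨t, b, t1, t2, hb, htb⟩ := hex
      refine ⟨b, h.symm.disjoint hb, fun s x s1 s2 hx hadj => ?_⟩
      exact hmin s t x b s1.le s2.le t1.le t2.le (by omega) (by omega) (.inr ⟨hx, hb⟩) hadj htb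
    · push Not at hex
      obtain ⟨b, hb, -⟩ := exists_mem_ne_ne h.right a₁ a₁
      exact ⟨b, h.symm.disjoint hb, fun t x t1 t2 hx hadj => absurd hadj (hex t x t1 t2 hx)⟩
  refine h.no_ear h3 hI hp hn hpK h₁ h₂ hne hb₃ ha₁ ha₂ ?_
  intro t x t1 t2 hx hadj
  rcases eq_or_lt_of_le t1 with rfl | t1
  · exact .inl ⟨rfl, hone 0 le_rfl hn x hx a₁ (.inl h₁) hadj ha₁⟩
  rcases eq_or_lt_of_le t2 with rfl | t2
  · exact .inr (.inl ⟨rfl, hone t hn le_rfl x hx a₂ (.inl h₂) hadj ha₂⟩)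
  rcases hx with hx | hx
  · exact absurd hadj (hmidA t x t1 t2 hx)
  · exact .inr (.inr (hb₃' t x t1 t2 hx hadj))

/-- The neighbours of a connected set outside a maximal biclique form a clique. -/
lemma IsBiclique.isClique_attach [Finite V] (h : G.IsBiclique A B) (h3 : G.CliqueFree 3)
    (hI : G.ISK4Free) (hmax : ∀ A' B', G.IsBiclique A' B' → (A' ∪ B').ncard ≤ (A ∪ B).ncard)
    {D : Set V} (hD : G.IsConnOn D) (hDK : ∀ x ∈ A ∪ B, x ∉ D) :
    G.IsClique (G.attach (A ∪ B) D) := by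
  rintro x ⟨hx, s, hs, hxs⟩ y ⟨hy, t, ht, hyt⟩ hne
  by_contra hadj
  -- Vertices on different sides are adjacent.
  have hside : x ∈ A ∧ y ∈ A ∨ x ∈ B ∧ y ∈ B := by
    rcases hx with hx | hx <;> rcases hy with hy | hy
    · exact .inl ⟨hx, hy⟩
    · exact absurd (h.adj _ hx _ hy) hadj
    · exact absurd (h.adj _ hy _ hx).symm hadj
    · exact .inr ⟨hx, hy⟩
  obtain ⟨p, n, hp, ⟨a₁, a₂, hside, hne, ha₁, ha₂⟩, hpi, hmin⟩ := exists_min_seq (T := D)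
    (R := fun s t => ∃ x y, (x ∈ A ∧ y ∈ A ∨ x ∈ B ∧ y ∈ B) ∧ x ≠ y ∧ G.Adj s x ∧ G.Adj t y) (by
      obtain ⟨f, n, hf, h0, hn⟩ := hD.exists_isSeq hs ht
      exact ⟨f, n, hf, x, y, hside, hne, by rw [h0]; exact hxs.symm, by rw [hn]; exact hyt.symm⟩)
  have hpK : ∀ t, 0 ≤ t → t ≤ n → p t ∉ A ∪ B := fun t t1 t2 h' => hDK _ h' (hp.mem t t1 t2)
  have hone : ∀ t, 0 ≤ t → t ≤ n → ∀ x ∈ A ∪ B, ∀ y ∈ A ∪ B, G.Adj (p t) x → G.Adj (p t) y →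
      x = y := fun t t1 t2 x hx y hy => h.eq_of_adj h3 hI hmax (hpK t t1 t2) hx hy
  have hmin' : ∀ s t x y, 0 ≤ s → s ≤ n → 0 ≤ t → t ≤ n → s - t < n → t - s < n →
      (x ∈ A ∧ y ∈ A ∨ x ∈ B ∧ y ∈ B) → G.Adj (p s) x → G.Adj (p t) y → x = y := by
    intro s t x y s1 s2 t1 t2 h1 h2 hxy hsx hty
    by_contra hne
    rcases le_total s t with hle | hle
    · have := hmin _ _ (hp.sub s1 hle t2) ⟨x, y, hxy, hne, by simpa using hsx, by simpa using hty⟩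
      omega
    · have := hmin _ _ (hp.sub t1 hle s2) ⟨y, x, by tauto, Ne.symm hne, by simpa using hty,
        by simpa using hsx⟩
      omega
  rcases hside with ⟨h₁, h₂⟩ | ⟨h₁, h₂⟩
  · exact h.no_shortest_ear h3 hI hpi hp.nonneg hpK hone hmin' h₁ h₂ hne ha₁ ha₂
  · refine h.symm.no_shortest_ear h3 hI hpi hp.nonneg (by rwa [Set.union_comm])
      (by rwa [Set.union_comm]) ?_ h₁ h₂ hne ha₁ ha₂
    intro s t x y s1 s2 t1 t2 k1 k2 hxy
    exact hmin' s t x y s1 s2 t1 t2 k1 k2 hxy.symm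

lemma CliqueFree.encard_le_two [Finite V] {C : Set V} (h3 : G.CliqueFree 3) (hC : G.IsClique C) :
    C.encard ≤ 2 := by
  rw [← (Set.toFinite C).cast_ncard_eq]
  norm_cast
  by_contra! hlt
  obtain ⟨x, y, z, hx, hy, hz, hxy, hxz, hyz⟩ := (Set.two_lt_ncard_iff (Set.toFinite C)).1 hlt
  exact h3.not_triangle (hC hx hy hxy) (hC hy hz hyz) (hC hx hz hxz)

lemma isCompleteBipartite_of_biclique [Finite V] (h : G.IsBiclique A B) (h3 : G.CliqueFree 3)
    (hAB : ∀ x, x ∈ A ∪ B) : G.IsCompleteBipartite := by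
  classical
  obtain rfl : B = Aᶜ := by
    ext x
    exact ⟨fun hB hA => h.disjoint hA hB, fun hA => (hAB x).resolve_left hA⟩
  let e : Fin (Nat.card A) ⊕ Fin (Nat.card (Aᶜ : Set V)) ≃ V :=
    (Equiv.sumCongr (Finite.equivFin A).symm (Finite.equivFin (Aᶜ : Set V)).symm).trans
      (Equiv.Set.sumCompl A)
  have hl : ∀ x, e (.inl x) ∈ A := fun x => ((Finite.equivFin A).symm x).2
  have hr : ∀ x, e (.inr x) ∈ Aᶜ := fun x => ((Finite.equivFin (Aᶜ : Set V)).symm x).2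
  refine ⟨_, _, ⟨RelIso.symm ⟨e, ?_⟩⟩⟩
  intro x y
  rcases x with x | x <;> rcases y with y | y
  · exact iff_of_false (h.not_adj_left h3 (hl x) (hl y)) (by
      rintro (⟨-, e⟩ | ⟨e, -⟩) <;> exact Bool.false_ne_true e)
  · exact iff_of_true (h.adj _ (hl x) _ (hr y)) (.inl ⟨rfl, rfl⟩)
  · exact iff_of_true (h.adj _ (hl y) _ (hr x)).symm (.inr ⟨rfl, rfl⟩)
  · exact iff_of_false (h.symm.not_adj_left h3 (hr x) (hr y)) (by
      rintro (⟨e, -⟩ | ⟨-, e⟩) <;> exact Bool.false_ne_true e)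

/-- A triangle-free ISK4-free graph with a biclique is complete bipartite or has a clique cutset
of size at most two. -/
theorem IsBiclique.isCompleteBipartite_or_cutset [Finite V] (h : G.IsBiclique A B)
    (h3 : G.CliqueFree 3) (hI : G.ISK4Free) :
    G.IsCompleteBipartite ∨ ∃ C : Set V, G.IsCutset C ∧ G.IsClique C ∧ C.encard ≤ 2 := by
  obtain ⟨⟨A, B⟩, h, hmax⟩ := Set.exists_max_image {P : Set V × Set V | G.IsBiclique P.1 P.2}
    (fun P => (P.1 ∪ P.2).ncard) (Set.toFinite _) ⟨(A, B), h⟩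
  replace hmax : ∀ A' B', G.IsBiclique A' B' → (A' ∪ B').ncard ≤ (A ∪ B).ncard :=
    fun A' B' h' => hmax (A', B') h'
  replace h : G.IsBiclique A B := h
  by_cases hAB : ∀ x, x ∈ A ∪ B
  · exact .inl (isCompleteBipartite_of_biclique h h3 hAB)
  right
  push Not at hAB
  obtain ⟨v, hv⟩ := hAB
  -- `D` is the component of `v` outside the biclique, and its attachments are the cutset.
  let S : Set V := (A ∪ B)ᶜ
  let D : Set V := Subtype.val '' ((G.induce S).connectedComponentMk ⟨v, hv⟩).supp
  have hvD : v ∈ D := ⟨⟨v, hv⟩, by simp, rfl⟩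
  have hDK : ∀ x ∈ A ∪ B, x ∉ D := by
    rintro _ hx ⟨⟨x, hx'⟩, -, rfl⟩
    exact hx' hx
  have hstep : ∀ x y, x ∈ D → y ∉ A ∪ B → G.Adj x y → y ∈ D := by
    rintro _ y ⟨⟨x, hx⟩, hxD, rfl⟩ hy hadj
    refine ⟨⟨y, hy⟩, ?_, rfl⟩
    rw [ConnectedComponent.mem_supp_iff] at hxD ⊢
    rw [← hxD, ConnectedComponent.eq]
    exact Adj.reachable (G := G.induce S) (u := ⟨y, hy⟩) (v := ⟨x, hx⟩) hadj.symm
  have hD : G.IsConnOn D := by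
    have key : ∀ x y, Relation.ReflTransGen (G.induce S).Adj x y → x.1 ∈ D →
        Relation.ReflTransGen (fun a b => G.Adj a b ∧ b ∈ D) x.1 y.1 ∧ y.1 ∈ D := by
      intro x y hxy hx
      induction hxy with
      | refl => exact ⟨.refl, hx⟩
      | @tail b c _ hbc ih =>
        have hc := hstep b.1 c.1 ih.2 c.2 hbc
        exact ⟨ih.1.tail ⟨hbc, hc⟩, hc⟩
    rintro _ ⟨x, hx, rfl⟩ _ ⟨y, hy, rfl⟩
    refine (key x y ((reachable_iff_reflTransGen _ _).1 (ConnectedComponent.eq.1 ?_))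
      ⟨x, hx, rfl⟩).1
    rw [ConnectedComponent.mem_supp_iff] at hx hy
    exact hx.trans hy.symm
  have hC := h.isClique_attach h3 hI hmax hD hDK
  refine ⟨_, fun hpre => ?_, hC, h3.encard_le_two hC⟩
  obtain ⟨a, ha, -⟩ := exists_mem_ne_ne h.left v v
  obtain ⟨a', ha', hne, -⟩ := exists_mem_ne_ne h.left a a
  -- Two vertices of `A` are nonadjacent, so they do not both lie in the clique.
  obtain ⟨u, hu, huC⟩ : ∃ u ∈ A, u ∉ G.attach (A ∪ B) D := by
    by_contra! hall
    exact h.not_adj_left h3 ha' ha (hC (hall a' ha') (hall a ha) hne)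
  have hr := isConnOn_of_preconnected hpre v (fun h' => hv h'.1) u huC
  -- A walk from `v` that avoids the attachments of `D` cannot leave `D`.
  have huD : u ∈ D := by
    clear hu huC
    induction hr with
    | refl => exact hvD
    | @tail b c _ hbc ih =>
      refine hstep b c ih (fun hc => ?_) hbc.1
      exact hbc.2 ⟨hc, b, ih, hbc.1.symm⟩
  exact hDK u (.inl hu) huD

end Biclique

end SimpleGraph

theorem mainTheorem3 {V : Type*} [Finite V] (G : SimpleGraph V)
    (hTriangle : G.CliqueFree 3) (hISK4 : G.ISK4Free) :
    G.IsSeriesParallel ∨ G.IsCompleteBipartite ∨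
      (∃ C : Set V, G.IsCutset C ∧ G.IsClique C ∧ C.encard ≤ 2) ∨
      (∃ C : Set V, G.IsStarCutset C) := by
  by_cases hsp : G.IsSeriesParallel
  · exact .inl hsp
  · rcases SimpleGraph.wheel_or_biclique hTriangle hISK4 hsp with ⟨L, c, v, h⟩ | ⟨A, B, h⟩
    · exact .inr (.inr (.inr (h.exists_isStarCutset hTriangle hISK4)))
    · rcases h.isCompleteBipartite_or_cutset hTriangle hISK4 with h | h
      · exact .inr (.inl h)
      · exact .inr (.inr (.inl h))
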